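/- **Conventions.** For a well-founded poset $P$ put $\mathrm{rk}_P(x)=\sup_{y<x}(\mathrm{rk}_P(y)+1)$ and let $|P|=\sup_{x\in P}(\mathrm{rk}_P(x)+1)$ be its ordinal rank. For a Noetherian space $X$, the *stature* $\|X\|$ is the rank of $X$ in the poset of all closed subsets of $X$ ordered by inclusion (so that this poset has ordinal rank $\|X\|+1$), and the *sobrification rank* $\mathrm{sob}\,X$ is the ordinal rank of the poset of irreducible closed subsets of $X$ ordered by inclusion. $X^*$ is the set of finite words over $X$ with the word topology, generated by the sets $X^*U_1X^*U_2X^*\cdots X^*U_nX^*$ with $n\in\mathbb N$ and $U_1,\dots,U_n$ open in $X$. $X^\circledast$ is the set of finite multisets over $X$ with the quotient topology induced by the map $X^*\to X^\circledast$ sending a word to the multiset of its letters. If $X$ is Noetherian, then so are $X^*$ and $X^\circledast$. $\oplus$ and $\otimes$ denote the natural (Hessenberg) sum and product of ordinals: the natural sum of $\omega^{\alpha_1},\dots,\omega^{\alpha_m}$ is obtained by adding them in decreasing order, and $\bigl(\sum_i\omega^{\alpha_i}\bigr)\otimes\bigl(\sum_j\omega^{\beta_j}\bigr)=\bigoplus_{i,j}\omega^{\alpha_i\oplus\beta_j}$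 for Cantor normal forms. $\omega\cdot\alpha$ is the usual ordinal product, $\alpha$ copies of $\omega$. **Theorem.** 1. (Bounds.) For every Noetherian space $X$, the space $X^\circledast$ is Noetherian and $$(\omega\cdot\|X\|)+1\ \le\ \mathrm{sob}(X^\circledast)\ \le\ (\|X\|\otimes\omega)+1 .$$ 2. (Coincidence.) For every Noetherian space $X$, the two bounds are equal if and only if $\|X\|<\omega^\omega$. In that case $\mathrm{sob}(X^\circledast)$ is equal to both of them; explicitly, $\|X\|=\omega^{n_1}+\cdots+\omega^{n_m}$ for some natural numbers $n_1\ge\cdots\ge n_m$, and whenever $\|X\|$ is written in this way, $$\mathrm{sob}(X^\circledast)=\omega^{n_1+1}+\cdots+\omega^{n_m+1}+1 .$$ 3. (The lower bound is attained.) Let $Z$ be a Noetherian space with $\alpha=\|Z\|\ge 2$, and let $X=Z^*$. Then $$\mathrm{sob}(X^\circledast)=\omega^{\omega^{\alpha'}}+1=(\omega\cdot\|X\|)+1 ,$$ where $\alpha'=\alpha-1$ if $\alpha$ is finite, $\alpha'=\alpha+1$ if $\alpha=\varepsilon+n$ for some ordinal $\varepsilon=\omega^\varepsilon$ and some $n\in\mathbb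 N$, and $\alpha'=\alpha$ otherwise. 4. (The upper bound is attained.) Every ordinal $\alpha$, with its Alexandroff topology (the open sets are the upwards-closed subsets), is a Noetherian space with $$\mathrm{sob}(\alpha^\circledast)=(\|\alpha\|\otimes\omega)+1=(\alpha\otimes\omega)+1 .$$ -/

import Mathlib

open TopologicalSpace
open scoped Ordinal

universe u

noncomputable section

/-! ### Natural sum and natural product of ordinals -/

/-- The exponents `α₁ ≥ ⋯ ≥ αₘ` of the Cantor normal form `α = ω ^ α₁ + ⋯ + ω ^ αₘ`, listed with
multiplicity. -/
def cnfExponents (α : Ordinal.{u}) : Multiset Ordinal.{u} :=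
  ((Ordinal.CNF ω α).map fun p => Multiset.replicate (Cardinal.toNat p.2.card) p.1).sum

/-- The ordinal `ω ^ γ₁ + ⋯ + ω ^ γₙ`, where `γ₁ ≥ ⋯ ≥ γₙ` is the given multiset of exponents,
sorted in decreasing order. -/
def ordinalOfExponents (s : Multiset Ordinal.{u}) : Ordinal.{u} :=
  ((s.sort (· ≥ ·)).map fun γ => ω ^ γ).sum

/-- The natural (Hessenberg) sum `α ⊕ β`. -/
def naturalSum (α β : Ordinal.{u}) : Ordinal.{u} :=
  ordinalOfExponents (cnfExponents α + cnfExponents β)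

/-- The natural (Hessenberg) product `α ⊗ β`, namely the natural sum of the terms
`ω ^ (αᵢ ⊕ βⱼ)`. -/
def naturalProd (α β : Ordinal.{u}) : Ordinal.{u} :=
  ordinalOfExponents
    ((cnfExponents α ×ˢ cnfExponents β).map fun p => naturalSum p.1 p.2)

/-! ### Ordinal rank, stature and sobrification rank -/

/-- The ordinal rank `|P|` of a well-founded poset `P`. -/
def ordinalRank (P : Type u) [PartialOrder P] [WellFoundedLT P] : Ordinal.{u} :=
  ⨆ x : P, Order.succ (IsWellFounded.rank (α := P) (· < ·) x)

/-- The stature `‖X‖` of a Noetherian space: the rank of the largest element `X` in the poset of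
closed subsets of `X`. By `ordinalRank_closeds` below, this is `|H₀ X| - 1`. -/
def stature (X : Type u) [TopologicalSpace X] [NoetherianSpace X] : Ordinal.{u} :=
  IsWellFounded.rank (α := Closeds X) (· < ·) ⊤

theorem ordinalRank_closeds (X : Type u) [TopologicalSpace X] [NoetherianSpace X] :
    ordinalRank (Closeds X) = stature X + 1 := by
  rw [← Order.succ_eq_add_one]
  apply le_antisymm
  · exact Ordinal.iSup_le fun x =>
      Order.succ_le_succ (WellFoundedLT.rank_strictMono.monotone le_top)
  · exact Ordinal.le_iSup
      (fun x : Closeds X => Order.succ (IsWellFounded.rank (α := Closeds X) (· < ·) x)) ⊤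

instance irreducibleCloseds_wellFoundedLT (X : Type u) [TopologicalSpace X] [NoetherianSpace X] :
    WellFoundedLT (IrreducibleCloseds X) :=
  StrictMono.wellFoundedLT
    (f := fun C : IrreducibleCloseds X => (⟨(C : Set X), C.isClosed⟩ : Closeds X))
    (fun _ _ h => h)

/-- The sobrification rank of a Noetherian space `X`: the ordinal rank of its sobrification,
that is, of the poset of irreducible closed subsets of `X` under inclusion. -/
def sobrificationRank (X : Type u) [TopologicalSpace X] [NoetherianSpace X] : Ordinal.{u} :=
  ordinalRank (IrreducibleCloseds X)

/-! ### Finite words and finite multisets -/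

/-- Finite words over `X`. -/
def Word (X : Type u) : Type u := List X

/-- The set `X^* U₁ X^* U₂ X^* ⋯ X^* Uₙ X^*` of words having a (scattered) subword `x₁ ⋯ xₙ` with
`xᵢ ∈ Uᵢ` for each `i`. -/
def Word.basicOpen {X : Type u} (U : List (Set X)) : Set (Word X) :=
  {w | ∃ v : List X, List.Forall₂ (fun x V => x ∈ V) v U ∧ List.Sublist v w}

/-- The word topology. -/
instance Word.topology (X : Type u) [TopologicalSpace X] : TopologicalSpace (Word X) :=
  TopologicalSpace.generateFrom
    {S | ∃ U : List (Set X), (∀ V ∈ U, IsOpen V) ∧ S = Word.basicOpen U}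

/-- Finite multisets over `X`. -/
def FinMultiset (X : Type u) : Type u := Multiset X

/-- The Parikh mapping, from words to multisets. -/
def parikh {X : Type u} (w : Word X) : FinMultiset X := Multiset.ofList w

/-- Finite multisets carry the quotient topology induced by the Parikh mapping. -/
instance FinMultiset.topology (X : Type u) [TopologicalSpace X] :
    TopologicalSpace (FinMultiset X) :=
  TopologicalSpace.coinduced parikh (Word.topology X)

/-- The ordinal `α'`: it is `α - 1` if `α` is finite and non-zero, `α + 1` if `α = ε + n` with
`ε = ω ^ ε` and `n` a natural number, and `α` otherwise. -/
def adjustedExponent (α : Ordinal.{u}) : Ordinal.{u} :=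
  open scoped Classical in
  if α < ω then α - 1
  else if ∃ (ε : Ordinal.{u}) (n : ℕ), ε = ω ^ ε ∧ α = ε + n then α + 1
  else α

end

/-! An irreducible closed set of finite multisets is an `elementary F s`: arbitrarily many elements
of a closed set `F`, and at most one element for each member of a finite multiset `s` of irreducible
closed sets (`FinMultiset.exists_eq_elementary`). The largest one is `elementary ⊤ 0`, so the
sobrification rank is its rank plus one.

Lower bound. If `E < F`, choose a point of `F` outside `E`. Adding `n` copies of its closure to the
base `E` gives a strictly increasing ω-chain below `elementary F 0`. Hence every step of rank in the
base is worth at least ω (`FinMultiset.omega0_mul_wfRank_le`).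

Upper bound. `size F s`, the natural sum of ‖F‖ ⊗ ω and the weights of the members of `s`, is
strictly increasing (`FinMultiset.size_lt`). When ‖F‖ grows by δ with leading exponent `a`, the
product by ω gains more than any finite natural sum of weights below ω^(a+1). The heavier weights
lose nothing, because they absorb δ.

Coincidence. On a term ω^e of the normal form the two products by ω are ω^(1+e) and ω^(e+1), which
agree exactly for finite `e`.

Words. The stature of Z^* is ω^(ω^α') (`Word.stature_eq`). From above, a proper closed set of words
over `F` lies in a finite union of concatenations of sets of words over smaller closed sets and
single letters; ranks of concatenations are controlled by natural sums of exponents, so ordinals of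
the form ω^(ω^d) are not exceeded. From below, counting letters outside a smaller closed set
produces lexicographic products, hence powers. For α ≥ 2 this ordinal is unchanged by left
multiplication by ω. Irreducible closed sets of words have rank at most ω^(α+1), since for them
concatenation adds ranks instead of multiplying them; so the weights stay small and `size` does not
reach ω^(ω^α') on a proper subset.

Ordinals. Over an initial segment `p`, each copy of the segment `p + ω^a` is worth a full ω^a, so ω
copies are worth ω^(a+1), and the upper bound is reached. -/

noncomputable section

/-! ### The Hessenberg sum by recursion -/

/-- The Hessenberg sum of two ordinals, defined as the least strictly monotone binary function. -/
def nadd (a b : Ordinal.{u}) : Ordinal.{u} :=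
  max (⨆ x : Set.Iio a, Order.succ (nadd x.1 b)) (⨆ x : Set.Iio b, Order.succ (nadd a x.1))
termination_by (a, b)
decreasing_by
  · exact Prod.Lex.left _ _ x.2
  · exact Prod.Lex.right _ x.2

theorem nadd_le_iff {a b c : Ordinal.{u}} :
    nadd a b ≤ c ↔ (∀ x < a, nadd x b < c) ∧ ∀ x < b, nadd a x < c := by
  rw [nadd, max_le_iff, Ordinal.iSup_le_iff, Ordinal.iSup_le_iff]
  simp

theorem nadd_lt_nadd_right {a b : Ordinal.{u}} (h : a < b) (c : Ordinal.{u}) :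
    nadd a c < nadd b c :=
  (nadd_le_iff.1 le_rfl).1 a h

theorem nadd_lt_nadd_left {a b : Ordinal.{u}} (h : a < b) (c : Ordinal.{u}) :
    nadd c a < nadd c b :=
  (nadd_le_iff.1 le_rfl).2 a h

theorem nadd_comm (a b : Ordinal.{u}) : nadd a b = nadd b a := by
  rw [nadd, nadd, max_comm]
  congr 1
  · congr 1
    ext x
    rw [nadd_comm a x.1]
  · congr 1
    ext x
    rw [nadd_comm x.1 b]
termination_by (a, b)
decreasing_by
  · exact Prod.Lex.right _ x.2
  · exact Prod.Lex.left _ _ x.2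

theorem nadd_strictMono_left (c : Ordinal.{u}) : StrictMono fun a => nadd a c :=
  fun _ _ h => nadd_lt_nadd_right h c

theorem nadd_strictMono_right (c : Ordinal.{u}) : StrictMono (nadd c) :=
  fun _ _ h => nadd_lt_nadd_left h c

theorem nadd_le_nadd {a b c d : Ordinal.{u}} (h : a ≤ b) (h' : c ≤ d) : nadd a c ≤ nadd b d :=
  ((nadd_strictMono_left c).monotone h).trans ((nadd_strictMono_right b).monotone h')

/-- The form in which an element described by two coordinates gets its rank bounded by a Hessenberg
sum: both coordinates grow weakly, and they cannot both stay still. -/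
theorem nadd_lt_of_not_both {a b c d : Ordinal.{u}} (h : a ≤ b) (h' : c ≤ d)
    (hne : a < b ∨ c < d) : nadd a c < nadd b d := by
  rcases hne with hne | hne
  · exact (nadd_lt_nadd_right hne c).trans_le (nadd_le_nadd le_rfl h')
  · exact (nadd_lt_nadd_left hne a).trans_le (nadd_le_nadd h le_rfl)

theorem nadd_zero (a : Ordinal.{u}) : nadd a 0 = a := by
  induction a using WellFoundedLT.induction with
  | ind a ih =>
    apply le_antisymm
    · rw [nadd_le_iff]
      refine ⟨fun x hx => by rwa [ih x hx], fun x hx => absurd hx (by simp)⟩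
    · apply le_of_forall_lt
      intro x hx
      rw [← ih x hx]
      exact nadd_lt_nadd_right hx 0

/-- Anything below `nadd a b` is bounded by a sum with one summand decreased, so induction applies.
Commutativity turns this inequality into associativity. -/
theorem nadd_assoc_le (a b c : Ordinal.{u}) : nadd (nadd a b) c ≤ nadd a (nadd b c) := by
  rw [nadd_le_iff]
  constructor
  · intro x hx
    have key : x < nadd a b → (∃ a' < a, x ≤ nadd a' b) ∨ ∃ b' < b, x ≤ nadd a b' := by
      intro hx
      by_contra! h
      exact absurd (nadd_le_iff.2 ⟨h.1, h.2⟩) (not_le.2 hx)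
    rcases key hx with ⟨a', ha', h⟩ | ⟨b', hb', h⟩
    · calc nadd x c ≤ nadd (nadd a' b) c := nadd_le_nadd h le_rfl
        _ ≤ nadd a' (nadd b c) := nadd_assoc_le a' b c
        _ < _ := nadd_lt_nadd_right ha' _
    · calc nadd x c ≤ nadd (nadd a b') c := nadd_le_nadd h le_rfl
        _ ≤ nadd a (nadd b' c) := nadd_assoc_le a b' c
        _ < _ := nadd_lt_nadd_left (nadd_lt_nadd_right hb' c) _
  · intro x hx
    calc nadd (nadd a b) x ≤ nadd a (nadd b x) := nadd_assoc_le a b x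
      _ < _ := nadd_lt_nadd_left (nadd_lt_nadd_left hx b) _
termination_by (a, b, c)
decreasing_by
  · exact Prod.Lex.left _ _ ha'
  · exact Prod.Lex.right _ (Prod.Lex.left _ _ hb')
  · exact Prod.Lex.right _ (Prod.Lex.right _ hx)

theorem nadd_assoc (a b c : Ordinal.{u}) : nadd (nadd a b) c = nadd a (nadd b c) := by
  apply le_antisymm (nadd_assoc_le a b c)
  calc nadd a (nadd b c) = nadd (nadd c b) a := by rw [nadd_comm, nadd_comm b]
    _ ≤ nadd c (nadd b a) := nadd_assoc_le c b a
    _ = _ := by rw [nadd_comm, nadd_comm b]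

theorem le_nadd_left (a b : Ordinal.{u}) : a ≤ nadd a b := by
  calc a = nadd a 0 := (nadd_zero a).symm
    _ ≤ _ := nadd_le_nadd le_rfl zero_le

theorem add_le_nadd (a b : Ordinal.{u}) : a + b ≤ nadd a b := by
  induction b using WellFoundedLT.induction with
  | ind b ih =>
    apply le_of_forall_lt
    intro x hx
    rcases lt_or_ge x a with h | h
    · exact h.trans_le (le_nadd_left a b)
    · have hb : x - a < b := by
        rwa [← add_lt_add_iff_left a, Ordinal.add_sub_cancel_of_le h]
      calc x = a + (x - a) := (Ordinal.add_sub_cancel_of_le h).symm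
        _ ≤ nadd a (x - a) := ih _ hb
        _ < _ := nadd_lt_nadd_left hb a

theorem exists_eq_mul_add_of_lt {c q y : Ordinal.{u}} (h : y < c * q) :
    ∃ q' < q, ∃ r < c, y = c * q' + r := by
  have hc : c ≠ 0 := by rintro rfl; simp at h
  exact ⟨y / c, (Ordinal.lt_mul_iff_div_lt hc).1 h, y % c, Ordinal.mod_lt _ hc,
    (Ordinal.div_add_mod y c).symm⟩

theorem mul_add_lt_mul_of_lt {c q q' r : Ordinal.{u}} (hq : q' < q) (hr : r < c) :
    c * q' + r < c * q :=
  calc c * q' + r < c * q' + c := by gcongr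
    _ = c * Order.succ q' := (Ordinal.mul_succ c q').symm
    _ ≤ c * q := by gcongr; exact Order.succ_le_of_lt hq

/-- Closure of ω^e under `nadd` is a hypothesis because `nadd_lt_opow` proves it by induction on the
exponent, using this lemma at smaller exponents. -/
theorem nadd_opow_mul_le_of_closed {e : Ordinal.{u}}
    (he : ∀ x < ω ^ e, ∀ y < ω ^ e, nadd x y < ω ^ e) (q x : Ordinal.{u}) (hx : x < ω ^ e) :
    nadd (ω ^ e * q) x ≤ ω ^ e * q + x := by
  induction q using WellFoundedLT.induction generalizing x with
  | ind q ihq =>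
  induction x using WellFoundedLT.induction with
  | ind x ihx =>
  rw [nadd_le_iff]
  constructor
  · intro y hy
    obtain ⟨q', hq', r, hr, rfl⟩ := exists_eq_mul_add_of_lt hy
    calc nadd (ω ^ e * q' + r) x ≤ nadd (nadd (ω ^ e * q') r) x :=
          nadd_le_nadd (add_le_nadd _ _) le_rfl
      _ = nadd (ω ^ e * q') (nadd r x) := nadd_assoc _ _ _
      _ ≤ ω ^ e * q' + nadd r x := ihq q' hq' _ (he r hr x hx)
      _ < ω ^ e * q := mul_add_lt_mul_of_lt hq' (he r hr x hx)
      _ ≤ _ := le_self_add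
  · intro y hy
    calc _ ≤ ω ^ e * q + y := ihx y hy (hy.trans hx)
      _ < _ := by gcongr

theorem nadd_opow_mul_nat_le {e : Ordinal.{u}}
    (he : ∀ x < ω ^ e, ∀ y < ω ^ e, nadd x y < ω ^ e) (k m : ℕ) :
    nadd (ω ^ e * k) (ω ^ e * m) ≤ ω ^ e * (k + m : ℕ) := by
  induction hn : k + m using Nat.strong_induction_on generalizing k m with
  | _ n ih =>
  subst hn
  have key : ∀ k m k' : ℕ, k' < k → ∀ r < ω ^ e,
      nadd (ω ^ e * k') (ω ^ e * m) ≤ ω ^ e * (k' + m : ℕ) →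
      nadd (ω ^ e * k' + r) (ω ^ e * m) < ω ^ e * (k + m : ℕ) := by
    intro k m k' hk' r hr h
    calc nadd (ω ^ e * k' + r) (ω ^ e * m) ≤ nadd (nadd (ω ^ e * k') r) (ω ^ e * m) :=
          nadd_le_nadd (add_le_nadd _ _) le_rfl
      _ = nadd (nadd (ω ^ e * k') (ω ^ e * m)) r := by
          rw [nadd_assoc, nadd_comm r, nadd_assoc]
      _ ≤ nadd (ω ^ e * (k' + m : ℕ)) r := nadd_le_nadd h le_rfl
      _ ≤ ω ^ e * (k' + m : ℕ) + r := nadd_opow_mul_le_of_closed he _ _ hr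
      _ < _ := mul_add_lt_mul_of_lt (by exact_mod_cast Nat.add_lt_add_right hk' m) hr
  rw [nadd_le_iff]
  constructor
  · intro y hy
    obtain ⟨q, hq, r, hr, rfl⟩ := exists_eq_mul_add_of_lt hy
    obtain ⟨k', rfl⟩ := Ordinal.lt_omega0.1 (hq.trans (Ordinal.natCast_lt_omega0 k))
    have hk' : k' < k := by exact_mod_cast hq
    exact key k m k' hk' r hr (ih (k' + m) (by omega) k' m rfl)
  · intro y hy
    obtain ⟨q, hq, r, hr, rfl⟩ := exists_eq_mul_add_of_lt hy
    obtain ⟨m', rfl⟩ := Ordinal.lt_omega0.1 (hq.trans (Ordinal.natCast_lt_omega0 m))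
    have hm' : m' < m := by exact_mod_cast hq
    rw [nadd_comm, add_comm k m]
    exact key m k m' hm' r hr (ih (m' + k) (by omega) m' k rfl)

/-- Both ordinals lie below a finite multiple of one power of ω with exponent less than `e`, and for
such multiples the coefficients simply add. -/
theorem nadd_lt_opow {e x y : Ordinal.{u}} (hx : x < ω ^ e) (hy : y < ω ^ e) :
    nadd x y < ω ^ e := by
  induction e using WellFoundedLT.induction generalizing x y with
  | ind e ih =>
  rcases eq_or_ne (max x y) 0 with h0 | h0
  · have hx0 : x = 0 := le_antisymm ((le_max_left x y).trans h0.le) zero_le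
    have hy0 : y = 0 := le_antisymm ((le_max_right x y).trans h0.le) zero_le
    rw [hx0, hy0, nadd_zero]
    exact Ordinal.opow_pos e Ordinal.omega0_pos
  · have hle : Ordinal.log ω (max x y) < e :=
      (Ordinal.lt_opow_iff_log_lt Ordinal.one_lt_omega0 h0).1 (max_lt hx hy)
    obtain ⟨n, hn⟩ : ∃ n : ℕ, max x y < ω ^ Ordinal.log ω (max x y) * n :=
      Ordinal.lt_omega0_opow_succ.1 (Ordinal.lt_opow_succ_log_self Ordinal.one_lt_omega0 _)
    calc nadd x y ≤ nadd (_ * n) (_ * n) :=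
          nadd_le_nadd ((le_max_left _ _).trans hn.le) ((le_max_right _ _).trans hn.le)
      _ ≤ _ * (n + n : ℕ) := nadd_opow_mul_nat_le (fun x hx y hy => ih _ hle hx hy) n n
      _ < ω ^ e := Ordinal.opow_mul_lt_opow (Ordinal.natCast_lt_omega0 _) hle

/-- Adding a small ordinal to a multiple of a power of `ω` is the same for both sums. -/
theorem nadd_opow_mul_le {e x : Ordinal.{u}} (q : Ordinal.{u}) (hx : x < ω ^ e) :
    nadd (ω ^ e * q) x ≤ ω ^ e * q + x :=
  nadd_opow_mul_le_of_closed (fun _ hx _ hy => nadd_lt_opow hx hy) q x hx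

instance : Std.Commutative nadd.{u} := ⟨nadd_comm⟩

instance : Std.Associative nadd.{u} := ⟨nadd_assoc⟩

/-- The Hessenberg sum of a multiset of ordinals. -/
def naddSum (s : Multiset Ordinal.{u}) : Ordinal.{u} :=
  s.fold nadd 0

@[simp]
theorem naddSum_zero : naddSum.{u} 0 = 0 := Multiset.fold_zero _ _

@[simp]
theorem naddSum_cons (a : Ordinal.{u}) (s : Multiset Ordinal.{u}) :
    naddSum (a ::ₘ s) = nadd a (naddSum s) :=
  Multiset.fold_cons_left _ _ _ _

theorem naddSum_add (s t : Multiset Ordinal.{u}) :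
    naddSum (s + t) = nadd (naddSum s) (naddSum t) := by
  simpa [naddSum, nadd_zero] using Multiset.fold_add nadd 0 0 s t

theorem naddSum_lt_opow {s : Multiset Ordinal.{u}} {e : Ordinal.{u}} (h : ∀ x ∈ s, x < ω ^ e) :
    naddSum s < ω ^ e := by
  induction s using Multiset.induction_on with
  | empty => simpa using Ordinal.opow_pos e Ordinal.omega0_pos
  | cons a s ih =>
    rw [naddSum_cons]
    exact nadd_lt_opow (h a (Multiset.mem_cons_self a s))
      (ih fun x hx => h x (Multiset.mem_cons_of_mem hx))

/-! ### Cantor normal forms and the product by `ω` -/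

theorem lt_opow_log_add_one (α : Ordinal.{u}) : α < ω ^ (Ordinal.log ω α + 1) := by
  rw [← Order.succ_eq_add_one]
  exact Ordinal.lt_opow_succ_log_self Ordinal.one_lt_omega0 α

theorem exists_eq_opow_add {α : Ordinal.{u}} (h : α ≠ 0) :
    ∃ r < α, α = ω ^ Ordinal.log ω α + r ∧ r < ω ^ (Ordinal.log ω α + 1) := by
  have hle := Ordinal.opow_log_le_self ω h
  have hlt := Ordinal.sub_omega0_opow_log_lt h
  exact ⟨_, hlt, (Ordinal.add_sub_cancel_of_le hle).symm, hlt.trans (lt_opow_log_add_one α)⟩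

/-- Induction along the terms of the Cantor normal form. -/
theorem cnf_induction {p : Ordinal.{u} → Prop} (zero : p 0)
    (add : ∀ e r : Ordinal.{u}, r < ω ^ (e + 1) → p r → p (ω ^ e + r)) (α : Ordinal.{u}) : p α := by
  induction α using WellFoundedLT.induction with
  | ind α ih =>
    rcases eq_or_ne α 0 with rfl | h
    · exact zero
    · obtain ⟨r, hr, hα, hr'⟩ := exists_eq_opow_add h
      rw [hα]
      exact add _ r hr' (ih r hr)

theorem lt_opow_add_one {r e : Ordinal.{u}} (h : r < ω ^ (e + 1)) :
    ∃ (m : ℕ) (r' : Ordinal.{u}), r' < ω ^ e ∧ r = ω ^ e * m + r' := by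
  rw [← Order.succ_eq_add_one, Ordinal.opow_succ] at h
  obtain ⟨q, hq, r', hr', rfl⟩ := exists_eq_mul_add_of_lt h
  obtain ⟨m, rfl⟩ := Ordinal.lt_omega0.1 hq
  exact ⟨m, r', hr', rfl⟩

@[simp]
theorem cnfExponents_zero : cnfExponents (0 : Ordinal.{u}) = 0 := by
  simp [cnfExponents]

theorem cnfExponents_opow_mul_add {e r : Ordinal.{u}} (m : ℕ) (hr : r < ω ^ e) :
    cnfExponents (ω ^ e * m + r) = Multiset.replicate m e + cnfExponents r := by
  rcases Nat.eq_zero_or_pos m with rfl | hm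
  · simp
  · rw [cnfExponents, Ordinal.CNF.opow_mul_add Ordinal.one_lt_omega0
      (by exact_mod_cast hm.ne') (Ordinal.natCast_lt_omega0 m) hr]
    simp [cnfExponents]

theorem cnfExponents_opow_add {e r : Ordinal.{u}} (hr : r < ω ^ (e + 1)) :
    cnfExponents (ω ^ e + r) = e ::ₘ cnfExponents r := by
  obtain ⟨m, r', hr', rfl⟩ := lt_opow_add_one hr
  have : ω ^ e + (ω ^ e * m + r') = ω ^ e * ((m + 1 : ℕ) : Ordinal) + r' := by
    rw [← add_assoc, add_comm m, Nat.cast_add, mul_add, Nat.cast_one, mul_one]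
  rw [this, cnfExponents_opow_mul_add _ hr', cnfExponents_opow_mul_add _ hr',
    Multiset.replicate_succ, Multiset.cons_add]

theorem le_of_mem_cnfExponents {e r x : Ordinal.{u}} (hr : r < ω ^ (e + 1))
    (hx : x ∈ cnfExponents r) : x ≤ e := by
  induction r using cnf_induction with
  | zero => simp at hx
  | add a r hra ih =>
    rw [cnfExponents_opow_add hra, Multiset.mem_cons] at hx
    rcases hx with rfl | hx
    · have : ω ^ x < ω ^ (e + 1) := le_self_add.trans_lt hr
      exact Order.lt_add_one_iff.1 ((Ordinal.opow_lt_opow_iff_right Ordinal.one_lt_omega0).1 this)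
    · exact ih (le_add_self.trans_lt hr) hx

@[simp]
theorem ordinalOfExponents_zero : ordinalOfExponents (0 : Multiset Ordinal.{u}) = 0 := by
  simp [ordinalOfExponents]

theorem ordinalOfExponents_cons {e : Ordinal.{u}} {s : Multiset Ordinal.{u}} (h : ∀ x ∈ s, x ≤ e) :
    ordinalOfExponents (e ::ₘ s) = ω ^ e + ordinalOfExponents s := by
  simp [ordinalOfExponents, Multiset.sort_cons e s (· ≥ ·) h]

theorem cnfExponents_one : cnfExponents (1 : Ordinal.{u}) = {0} := by
  have := cnfExponents_opow_add (e := 0) (r := 0) (Ordinal.opow_pos _ Ordinal.omega0_pos)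
  simpa using this

theorem cnfExponents_omega0 : cnfExponents (ω : Ordinal.{u}) = {1} := by
  have := cnfExponents_opow_add (e := 1) (r := 0) (Ordinal.opow_pos _ Ordinal.omega0_pos)
  simpa using this

theorem naturalSum_one (e : Ordinal.{u}) : naturalSum e 1 = e + 1 := by
  rw [naturalSum, cnfExponents_one]
  induction e using cnf_induction with
  | zero => simp [ordinalOfExponents]
  | add e r hr ih =>
    rw [cnfExponents_opow_add hr, Multiset.cons_add, ordinalOfExponents_cons, ih, add_assoc]
    intro x hx
    rcases Multiset.mem_add.1 hx with hx | hx
    · exact le_of_mem_cnfExponents hr hx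
    · rw [Multiset.mem_singleton.1 hx]
      exact zero_le

/-- The normal form of ω has the single exponent 1, and the natural sum with 1 is the successor. -/
theorem naturalProd_omega0_eq (α : Ordinal.{u}) :
    naturalProd α ω = ordinalOfExponents ((cnfExponents α).map (· + 1)) := by
  rw [naturalProd, cnfExponents_omega0]
  congr 1
  have h : cnfExponents α ×ˢ ({1} : Multiset Ordinal.{u})
      = (cnfExponents α).map fun x => (x, 1) := by
    induction cnfExponents α using Multiset.induction_on with
    | empty => rfl
    | cons a s ih => simp [ih]
  rw [h, Multiset.map_map]
  exact Multiset.map_congr rfl fun x _ => naturalSum_one x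

@[simp]
theorem naturalProd_zero_omega0 : naturalProd (0 : Ordinal.{u}) ω = 0 := by
  simp [naturalProd_omega0_eq]

theorem naturalProd_omega0_opow_add {e r : Ordinal.{u}} (hr : r < ω ^ (e + 1)) :
    naturalProd (ω ^ e + r) ω = ω ^ (e + 1) + naturalProd r ω := by
  rw [naturalProd_omega0_eq, naturalProd_omega0_eq, cnfExponents_opow_add hr, Multiset.map_cons,
    ordinalOfExponents_cons]
  intro x hx
  obtain ⟨y, hy, rfl⟩ := Multiset.mem_map.1 hx
  gcongr
  exact le_of_mem_cnfExponents hr hy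

theorem opow_lt_opow_omega0 {a b : Ordinal.{u}} : (ω : Ordinal.{u}) ^ a < ω ^ b ↔ a < b :=
  Ordinal.opow_lt_opow_iff_right Ordinal.one_lt_omega0

theorem opow_le_opow_omega0 {a b : Ordinal.{u}} : (ω : Ordinal.{u}) ^ a ≤ ω ^ b ↔ a ≤ b :=
  Ordinal.opow_le_opow_iff_right Ordinal.one_lt_omega0

theorem naturalProd_omega0_lt {a β : Ordinal.{u}} (h : β < ω ^ a) :
    naturalProd β ω < ω ^ (a + 1) := by
  induction β using cnf_induction with
  | zero => rw [naturalProd_zero_omega0]; exact Ordinal.opow_pos _ Ordinal.omega0_pos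
  | add e r hr ih =>
    rw [naturalProd_omega0_opow_add hr]
    apply Ordinal.isPrincipal_add_omega0_opow
    · have := opow_lt_opow_omega0.1 (le_self_add.trans_lt h)
      rw [opow_lt_opow_omega0, ← Order.succ_eq_add_one, ← Order.succ_eq_add_one]
      exact Order.succ_lt_succ this
    · exact ih (le_add_self.trans_lt h)

theorem opow_dvd_add_opow {a e r : Ordinal.{u}} (hr : r < ω ^ (e + 1)) (h : ω ^ a ∣ ω ^ e + r) :
    a ≤ e ∧ ω ^ a ∣ r := by
  have hae : a ≤ e := by
    have h1 : ω ^ e + r < ω ^ (e + 1) := Ordinal.isPrincipal_add_omega0_opow _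
      (opow_lt_opow_omega0.2 (lt_add_one e)) hr
    have h2 : ω ^ a ≤ ω ^ e + r :=
      Ordinal.le_of_dvd ((Ordinal.opow_pos e Ordinal.omega0_pos).trans_le le_self_add).ne' h
    exact Order.lt_add_one_iff.1 (opow_lt_opow_omega0.1 (h2.trans_lt h1))
  exact ⟨hae, (Ordinal.dvd_add_iff (Ordinal.opow_dvd_opow ω hae)).1 h⟩

/-- All exponents of `p` are at least `a` and those of `ρ` are at most `a`, so the normal form of `p
+ ρ` is the concatenation of the two normal forms. -/
theorem naturalProd_omega0_add {a p ρ : Ordinal.{u}} (hp : ω ^ a ∣ p) (hρ : ρ < ω ^ (a + 1)) :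
    naturalProd (p + ρ) ω = naturalProd p ω + naturalProd ρ ω := by
  induction p using cnf_induction with
  | zero => simp
  | add e r hr ih =>
    obtain ⟨hae, hdvd⟩ := opow_dvd_add_opow hr hp
    have : r + ρ < ω ^ (e + 1) := Ordinal.isPrincipal_add_omega0_opow _ hr
      (hρ.trans_le (opow_le_opow_omega0.2 (by gcongr)))
    rw [add_assoc, naturalProd_omega0_opow_add this, ih hdvd, naturalProd_omega0_opow_add hr,
      add_assoc]

theorem opow_dvd_naturalProd_omega0 {a p : Ordinal.{u}} (hp : ω ^ a ∣ p) :
    ω ^ (a + 1) ∣ naturalProd p ω := by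
  induction p using cnf_induction with
  | zero => simp
  | add e r hr ih =>
    obtain ⟨hae, hdvd⟩ := opow_dvd_add_opow hr hp
    rw [naturalProd_omega0_opow_add hr]
    exact dvd_add (Ordinal.opow_dvd_opow ω (by gcongr)) (ih hdvd)

theorem opow_le_naturalProd_omega0 {δ : Ordinal.{u}} (h : δ ≠ 0) :
    ω ^ (Ordinal.log ω δ + 1) ≤ naturalProd δ ω := by
  obtain ⟨r, -, hδ, hr⟩ := exists_eq_opow_add h
  conv_rhs => rw [hδ]
  rw [naturalProd_omega0_opow_add hr]
  exact le_self_add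

/-- The arithmetic behind the upper bound: increasing β by δ pays for every `x` below ω times the
leading power of δ. The part ρ of β below that power is absorbed in `β + δ`; multiplied by ω and
joined with `x`, it remains below ω^(a+1), which is at most δ ⊗ ω. -/
theorem nadd_naturalProd_omega0_lt {β δ x : Ordinal.{u}} (hδ : δ ≠ 0)
    (hx : x < ω ^ (Ordinal.log ω δ + 1)) :
    nadd (naturalProd β ω) x < naturalProd (β + δ) ω := by
  set a := Ordinal.log ω δ with ha
  have hpos : (ω : Ordinal.{u}) ^ a ≠ 0 := (Ordinal.opow_pos a Ordinal.omega0_pos).ne'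
  set p := ω ^ a * (β / ω ^ a) with hp
  set ρ := β % ω ^ a with hρ
  have hβ : β = p + ρ := (Ordinal.div_add_mod β (ω ^ a)).symm
  have hρlt : ρ < ω ^ a := Ordinal.mod_lt _ hpos
  have hdvd : ω ^ a ∣ p := dvd_mul_right _ _
  have hle : (ω : Ordinal.{u}) ^ a ≤ ω ^ (a + 1) := opow_le_opow_omega0.2 le_self_add
  obtain ⟨q, hq⟩ := opow_dvd_naturalProd_omega0 hdvd
  have hz : nadd (naturalProd ρ ω) x < ω ^ (a + 1) := nadd_lt_opow (naturalProd_omega0_lt hρlt) hx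
  calc nadd (naturalProd β ω) x
      = nadd (naturalProd p ω + naturalProd ρ ω) x := by
        rw [hβ, naturalProd_omega0_add hdvd (hρlt.trans_le hle)]
    _ ≤ nadd (nadd (naturalProd p ω) (naturalProd ρ ω)) x :=
        nadd_le_nadd (add_le_nadd _ _) le_rfl
    _ = nadd (naturalProd p ω) (nadd (naturalProd ρ ω) x) := nadd_assoc _ _ _
    _ ≤ naturalProd p ω + nadd (naturalProd ρ ω) x := by
        rw [hq]; exact nadd_opow_mul_le q hz
    _ < naturalProd p ω + ω ^ (a + 1) := by gcongr
    _ ≤ naturalProd p ω + naturalProd δ ω := by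
        gcongr; exact opow_le_naturalProd_omega0 hδ
    _ = naturalProd (p + δ) ω := (naturalProd_omega0_add hdvd (lt_opow_log_add_one δ)).symm
    _ = naturalProd (β + δ) ω := by
        rw [hβ, add_assoc, Ordinal.add_of_omega0_opow_le hρlt (Ordinal.opow_log_le_self ω hδ)]

/-! ### Coincidence of the two products by `ω` -/

theorem omega0_mul_opow (e : Ordinal.{u}) : ω * ω ^ e = (ω : Ordinal.{u}) ^ (1 + e) :=
  (Ordinal.opow_one_add ω e).symm

theorem one_add_natCast' (n : ℕ) : (1 : Ordinal.{u}) + n = n + 1 := by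
  exact_mod_cast congrArg (Nat.cast (R := Ordinal.{u})) (Nat.add_comm 1 n)

/-- An infinite leading exponent `e` satisfies `1 + e = e`, so ω · α stays below ω^(e+1), which α ⊗
ω reaches. For finite exponents the two products agree term by term. -/
theorem omega0_mul_eq_naturalProd_iff {α : Ordinal.{u}} :
    ω * α = naturalProd α ω ↔ α < ω ^ (ω : Ordinal.{u}) := by
  constructor
  · intro h
    by_contra! hα
    have h0 : α ≠ 0 := by
      rintro rfl
      exact absurd hα (not_le.2 (Ordinal.opow_pos _ Ordinal.omega0_pos))
    have he : ω ≤ Ordinal.log ω α := Ordinal.le_log_of_opow_le Ordinal.one_lt_omega0 hα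
    have h1 : ω * α < ω ^ (Ordinal.log ω α + 1) := by
      calc ω * α < ω * ω ^ (Ordinal.log ω α + 1) := by
            gcongr
            · exact Ordinal.omega0_pos
            · exact lt_opow_log_add_one α
        _ = _ := by rw [omega0_mul_opow, ← add_assoc, Ordinal.one_add_of_omega0_le he]
    exact absurd (opow_le_naturalProd_omega0 h0) (not_le.2 (h ▸ h1))
  · intro hα
    induction α using cnf_induction with
    | zero => simp
    | add e r hr ih =>
      obtain ⟨n, rfl⟩ := Ordinal.lt_omega0.1 (opow_lt_opow_omega0.1 (le_self_add.trans_lt hα))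
      rw [mul_add, naturalProd_omega0_opow_add hr, ih (le_add_self.trans_lt hα), omega0_mul_opow,
        one_add_natCast']

theorem exists_list_eq_sum_opow {α : Ordinal.{u}} (h : α < ω ^ (ω : Ordinal.{u})) :
    ∃ l : List ℕ, l.Pairwise (· ≥ ·) ∧ α = (l.map fun n : ℕ => ω ^ (n : Ordinal.{u})).sum := by
  suffices H : ∃ l : List ℕ, l.Pairwise (· ≥ ·) ∧
      α = (l.map fun n : ℕ => ω ^ (n : Ordinal.{u})).sum ∧
      ∀ n ∈ l, ω ^ (n : Ordinal.{u}) ≤ α by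
    obtain ⟨l, h1, h2, -⟩ := H
    exact ⟨l, h1, h2⟩
  induction α using cnf_induction with
  | zero => exact ⟨[], List.Pairwise.nil, by simp, by simp⟩
  | add e r hr ih =>
    obtain ⟨n, rfl⟩ := Ordinal.lt_omega0.1 (opow_lt_opow_omega0.1 (le_self_add.trans_lt h))
    obtain ⟨l, h1, h2, h3⟩ := ih (le_add_self.trans_lt h)
    refine ⟨n :: l, List.Pairwise.cons (fun m hm => ?_) h1,
      by rw [List.map_cons, List.sum_cons, ← h2], ?_⟩
    · have := opow_lt_opow_omega0.1 ((h3 m hm).trans_lt hr)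
      have : m < n + 1 := by exact_mod_cast this
      omega
    · intro m hm
      rcases List.mem_cons.1 hm with rfl | hm
      · exact le_self_add
      · exact (h3 m hm).trans le_add_self

theorem omega0_mul_sum_opow (l : List ℕ) :
    ω * (l.map fun n : ℕ => ω ^ (n : Ordinal.{u})).sum =
      (l.map fun n : ℕ => ω ^ ((n : Ordinal.{u}) + 1)).sum := by
  induction l with
  | nil => simp
  | cons n l ih =>
    simp only [List.map_cons, List.sum_cons]
    rw [mul_add, ih, omega0_mul_opow, one_add_natCast']

/-! ### The adjusted exponent -/

theorem adjustedExponent_add_one_of_nat (n : ℕ) :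
    adjustedExponent ((n : Ordinal.{u}) + 1) = n := by
  have h : (n : Ordinal.{u}) + 1 = 1 + n := (one_add_natCast' n).symm
  rw [adjustedExponent, if_pos (by exact_mod_cast Ordinal.natCast_lt_omega0 (n + 1)), h,
    Ordinal.add_sub_cancel]

theorem adjustedExponent_of_epsilon {α ε : Ordinal.{u}} {n : ℕ} (hε : ε = ω ^ ε)
    (h : α = ε + n) : adjustedExponent α = α + 1 := by
  have hω : ω ≤ ε := by
    rw [hε]
    apply Ordinal.left_le_opow
    rw [pos_iff_ne_zero]
    rintro rfl
    simp at hε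
  have : ¬ α < ω := by
    rw [h, not_lt]
    exact hω.trans le_self_add
  rw [adjustedExponent, if_neg this, if_pos ⟨ε, n, hε, h⟩]

theorem adjustedExponent_of_not_epsilon {α : Ordinal.{u}} (hα : ω ≤ α)
    (h : ¬ ∃ (ε : Ordinal.{u}) (n : ℕ), ε = ω ^ ε ∧ α = ε + n) : adjustedExponent α = α := by
  rw [adjustedExponent, if_neg hα.not_gt, if_neg h]

theorem le_adjustedExponent {α : Ordinal.{u}} (hα : ω ≤ α) : α ≤ adjustedExponent α := by
  by_cases h : ∃ (ε : Ordinal.{u}) (n : ℕ), ε = ω ^ ε ∧ α = ε + n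
  · obtain ⟨ε, n, hε, hα⟩ := h
    rw [adjustedExponent_of_epsilon hε hα]
    exact le_self_add
  · rw [adjustedExponent_of_not_epsilon hα h]

theorem exists_nat_add_one_eq {α : Ordinal.{u}} (h1 : 1 ≤ α) (h : α < ω) :
    ∃ n : ℕ, α = (n : Ordinal.{u}) + 1 := by
  obtain ⟨n, rfl⟩ := Ordinal.lt_omega0.1 h
  have : 1 ≤ n := by exact_mod_cast h1
  exact ⟨n - 1, by exact_mod_cast (Nat.sub_add_cancel this).symm⟩

/-- The values at 0 and 1 are both 0, hence the condition on γ. The extra 1 at `ε + n` causes no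
collision, because the next ordinal is again of the form `ε + (n + 1)`. -/
theorem adjustedExponent_lt {γ β : Ordinal.{u}} (h1 : 1 ≤ γ) (h : γ < β) :
    adjustedExponent γ < adjustedExponent β := by
  rcases lt_or_ge γ ω with hγ | hγ
  · obtain ⟨n, rfl⟩ := exists_nat_add_one_eq h1 hγ
    rw [adjustedExponent_add_one_of_nat]
    rcases lt_or_ge β ω with hβ | hβ
    · obtain ⟨m, rfl⟩ := exists_nat_add_one_eq (h1.trans h.le) hβ
      rw [adjustedExponent_add_one_of_nat]
      simpa using h
    · exact (Ordinal.natCast_lt_omega0 n).trans_le (hβ.trans (le_adjustedExponent hβ))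
  · have hβ : ω ≤ β := hγ.trans h.le
    by_cases hε : ∃ (ε : Ordinal.{u}) (n : ℕ), ε = ω ^ ε ∧ γ = ε + n
    · obtain ⟨ε, n, hε, hγε⟩ := hε
      rw [adjustedExponent_of_epsilon hε hγε]
      have h1 : γ + 1 ≤ β := Order.add_one_le_of_lt h
      rcases h1.eq_or_lt with h1 | h1
      · rw [adjustedExponent_of_epsilon (n := n + 1) hε, ← h1]
        · exact lt_add_one _
        · rw [← h1, hγε]
          push_cast
          rw [add_assoc]
      · exact h1.trans_le (le_adjustedExponent hβ)
    · rw [adjustedExponent_of_not_epsilon hγ hε]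
      exact h.trans_le (le_adjustedExponent hβ)

/-- The correction at `ε + n` is what makes the inequality strict at fixed points of ω^·. It fails
for β = 1, where the right side is 1; this is where stature at least 2 is needed. -/
theorem add_one_lt_opow_adjustedExponent {β : Ordinal.{u}} (h : 2 ≤ β) :
    β + 1 < ω ^ adjustedExponent β := by
  have hlim : ∀ {x e : Ordinal.{u}}, e ≠ 0 → x < ω ^ e → x + 1 < ω ^ e := fun he hx =>
    Ordinal.isPrincipal_add_omega0_opow _ hx
      (Ordinal.one_lt_opow.2 ⟨Ordinal.one_lt_omega0, he⟩)
  rcases lt_or_ge β ω with hβ | hβ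
  · have h1 : (1 : Ordinal.{u}) ≤ β := le_trans (by norm_num) h
    obtain ⟨n, rfl⟩ := exists_nat_add_one_eq h1 hβ
    rw [adjustedExponent_add_one_of_nat]
    have hn : 1 ≤ n := by
      have : 2 ≤ n + 1 := by exact_mod_cast h
      omega
    have hn' : (n : Ordinal.{u}) ≠ 0 := by exact_mod_cast (by omega : n ≠ 0)
    exact hlim hn' (hβ.trans_le (Ordinal.left_le_opow ω (pos_iff_ne_zero.2 hn')))
  · have h0 : β ≠ 0 := (Ordinal.omega0_pos.trans_le hβ).ne'
    by_cases hε : ∃ (ε : Ordinal.{u}) (n : ℕ), ε = ω ^ ε ∧ β = ε + n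
    · obtain ⟨ε, n, hε, hβε⟩ := hε
      rw [adjustedExponent_of_epsilon hε hβε]
      apply hlim (by simp)
      exact (lt_add_one β).trans_le (Ordinal.right_le_opow _ Ordinal.one_lt_omega0)
    · rw [adjustedExponent_of_not_epsilon hβ hε]
      apply hlim h0
      apply lt_of_le_of_ne (Ordinal.right_le_opow _ Ordinal.one_lt_omega0)
      intro h
      exact hε ⟨β, 0, h, by simp⟩

theorem opow_add_one_lt_opow_opow_adjustedExponent {β : Ordinal.{u}} (h : 2 ≤ β) :
    ω ^ (β + 1) < (ω : Ordinal.{u}) ^ (ω : Ordinal.{u}) ^ adjustedExponent β :=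
  opow_lt_opow_omega0.2 (add_one_lt_opow_adjustedExponent h)

theorem lt_opow_opow_adjustedExponent (β : Ordinal.{u}) :
    β < (ω : Ordinal.{u}) ^ (ω : Ordinal.{u}) ^ adjustedExponent β := by
  rcases lt_or_ge β ω with hβ | hβ
  · apply hβ.trans_le
    apply Ordinal.left_le_opow
    exact Ordinal.opow_pos _ Ordinal.omega0_pos
  · have h2 : 2 ≤ β := le_trans (by exact_mod_cast (Ordinal.natCast_lt_omega0 2).le) hβ
    refine lt_of_lt_of_le (lt_add_one β)
      (le_trans ?_ (opow_add_one_lt_opow_opow_adjustedExponent h2).le)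
    exact Ordinal.right_le_opow _ Ordinal.one_lt_omega0

theorem adjustedExponent_ne_zero {β : Ordinal.{u}} (h : 2 ≤ β) : adjustedExponent β ≠ 0 := by
  intro h0
  have := add_one_lt_opow_adjustedExponent h
  rw [h0, Ordinal.opow_zero] at this
  exact absurd this (not_lt.2 le_add_self)

theorem opow_opow_add_one_le {c Λ : Ordinal.{u}}
    (h : ∀ k : ℕ, ((ω : Ordinal.{u}) ^ (ω : Ordinal.{u}) ^ c) ^ k ≤ Λ) :
    (ω : Ordinal.{u}) ^ (ω : Ordinal.{u}) ^ (c + 1) ≤ Λ := by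
  rw [Ordinal.opow_add_one, Ordinal.opow_mul,
    ← Ordinal.iSup_pow_natCast (Ordinal.opow_pos _ Ordinal.omega0_pos)]
  exact Ordinal.iSup_le h

theorem opow_opow_limit_le {β Λ : Ordinal.{u}} (hβ : Order.IsSuccLimit β)
    (h : ∀ γ < β, (ω : Ordinal.{u}) ^ (ω : Ordinal.{u}) ^ γ ≤ Λ) :
    (ω : Ordinal.{u}) ^ (ω : Ordinal.{u}) ^ β ≤ Λ := by
  have hlim : Order.IsSuccLimit ((ω : Ordinal.{u}) ^ β) :=
    Ordinal.isSuccLimit_opow Ordinal.one_lt_omega0 hβ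
  apply le_of_forall_lt
  intro x hx
  obtain ⟨c, hc, hxc⟩ := (Ordinal.lt_opow_of_isSuccLimit Ordinal.omega0_ne_zero hlim).1 hx
  obtain ⟨γ, hγ, hcγ⟩ := (Ordinal.lt_opow_of_isSuccLimit Ordinal.omega0_ne_zero hβ).1 hc
  exact (hxc.trans (opow_lt_opow_omega0.2 hcγ)).trans_le (h γ hγ)

/-- Reduces the lower bound for words to closure under powers, since ω^(ω^(c+1)) is the supremum of
the finite powers of ω^(ω^c). Powers of `β` itself are needed only when β = ω^β, and `hω` only for β
= 1. -/
theorem opow_opow_adjustedExponent_le {β Λ : Ordinal.{u}} (h1 : 1 ≤ β) (hω : ω ≤ Λ)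
    (hpow : ∀ k : ℕ, β ^ k ≤ Λ)
    (hlt : ∀ γ, 1 ≤ γ → γ < β → ∀ k : ℕ,
      ((ω : Ordinal.{u}) ^ (ω : Ordinal.{u}) ^ adjustedExponent γ) ^ k ≤ Λ) :
    (ω : Ordinal.{u}) ^ (ω : Ordinal.{u}) ^ adjustedExponent β ≤ Λ := by
  rcases lt_or_ge β ω with hβ | hβ
  · obtain ⟨n, rfl⟩ := exists_nat_add_one_eq h1 hβ
    rw [adjustedExponent_add_one_of_nat]
    rcases Nat.eq_zero_or_pos n with rfl | hn
    · simpa using hω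
    · obtain ⟨m, rfl⟩ := Nat.exists_eq_add_of_lt hn
      simp only [Nat.zero_add, Nat.cast_add, Nat.cast_one] at *
      apply opow_opow_add_one_le
      have := hlt (m + 1) le_add_self (lt_add_one _)
      rwa [adjustedExponent_add_one_of_nat] at this
  · by_cases hε : ∃ (ε : Ordinal.{u}) (n : ℕ), ε = ω ^ ε ∧ β = ε + n
    · obtain ⟨ε, n, hε, hβε⟩ := hε
      rw [adjustedExponent_of_epsilon hε hβε]
      apply opow_opow_add_one_le
      rcases Nat.eq_zero_or_pos n with rfl | hn
      · have : (ω : Ordinal.{u}) ^ (ω : Ordinal.{u}) ^ β = β := by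
          rw [show β = ε by simpa using hβε, ← hε, ← hε]
        rwa [this]
      · obtain ⟨m, rfl⟩ := Nat.exists_eq_add_of_lt hn
        have hβ' : β = (ε + m) + 1 := by rw [hβε]; push_cast; simp [add_assoc]
        have hε1 : 1 ≤ ε := by
          rw [hε, Order.one_le_iff_pos]
          exact Ordinal.opow_pos _ Ordinal.omega0_pos
        have := hlt (ε + m) (hε1.trans le_self_add) (by rw [hβ']; exact lt_add_one _)
        rwa [adjustedExponent_of_epsilon hε rfl, ← hβ'] at this
    · rw [adjustedExponent_of_not_epsilon hβ hε]
      rcases Ordinal.zero_or_succ_or_isSuccLimit β with h0 | ⟨γ, hγ⟩ | hlim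
      · exact absurd h0 (Ordinal.omega0_pos.trans_le hβ).ne'
      · subst hγ
        have hγ : ω ≤ γ := by
          by_contra! hγ
          obtain ⟨n, rfl⟩ := Ordinal.lt_omega0.1 hγ
          exact absurd hβ (not_le.2 (by exact_mod_cast Ordinal.natCast_lt_omega0 (n + 1)))
        have hne : ¬ ∃ (ε : Ordinal.{u}) (n : ℕ), ε = ω ^ ε ∧ γ = ε + n := by
          rintro ⟨ε, n, h, rfl⟩
          exact hε ⟨ε, n + 1, h, by push_cast; simp [add_assoc]⟩
        apply opow_opow_add_one_le
        have := hlt γ ((Order.one_le_iff_pos.2 Ordinal.omega0_pos).trans hγ) (by simp)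
        rwa [adjustedExponent_of_not_epsilon hγ hne] at this
      · apply opow_opow_limit_le hlim
        intro γ hγ
        have hγ' : γ + 1 < β := by
          rw [← Order.succ_eq_add_one]; exact hlim.succ_lt hγ
        -- Passing to `γ + 1` compensates for the decrease by one that the adjustment makes on
        -- finite ordinals.
        refine le_trans ?_ (by simpa using hlt (γ + 1) le_add_self hγ' 1)
        apply opow_le_opow_omega0.2
        apply opow_le_opow_omega0.2
        rcases lt_or_ge γ ω with hγω | hγω
        · obtain ⟨n, rfl⟩ := Ordinal.lt_omega0.1 hγω
          rw [adjustedExponent_add_one_of_nat]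
        · exact le_self_add.trans (le_adjustedExponent (hγω.trans le_self_add))

/-! ### Ranks in well-founded orders -/

/-- The rank of an element of a well-founded order. -/
abbrev wfRank {α : Type u} [Preorder α] [WellFoundedLT α] (a : α) : Ordinal.{u} :=
  IsWellFounded.rank (α := α) (· < ·) a

section WfRank

variable {α : Type u} [Preorder α] [WellFoundedLT α]

theorem wfRank_lt {a b : α} (h : a < b) : wfRank a < wfRank b :=
  IsWellFounded.rank_lt_of_rel h

theorem wfRank_le_iff {a : α} {o : Ordinal.{u}} : wfRank a ≤ o ↔ ∀ b < a, wfRank b < o := by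
  rw [wfRank, IsWellFounded.rank_eq, Ordinal.iSup_le_iff]
  simp

theorem wfRank_le_of_strictMonoOn (f : α → Ordinal.{u}) (a : α)
    (h : ∀ b c, b < c → c ≤ a → f b < f c) : wfRank a ≤ f a := by
  induction a using WellFoundedLT.induction with
  | ind a ih =>
    rw [wfRank_le_iff]
    intro b hb
    exact (ih b hb fun c d hcd hd => h c d hcd (hd.trans hb.le)).trans_lt (h b a hb le_rfl)

end WfRank

theorem wfRank_mono {α : Type u} [PartialOrder α] [WellFoundedLT α] {a b : α} (h : a ≤ b) :
    wfRank a ≤ wfRank b :=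
  WellFoundedLT.rank_strictMono.monotone h

/-! ### Ranks in intervals of distributive lattices -/

/-- The rank of `D ⊔ A` in the poset of elements above `D`. -/
def relRank {L : Type u} [Lattice L] [WellFoundedLT L] (D A : L) : Ordinal.{u} :=
  wfRank (⟨D ⊔ A, le_sup_left⟩ : Set.Ici D)

section RelRank

variable {L : Type u} [Lattice L] [WellFoundedLT L]

theorem relRank_lt {D A B : L} (h : D ⊔ A < D ⊔ B) : relRank D A < relRank D B :=
  wfRank_lt (α := Set.Ici D) h

theorem relRank_lt_of_le {D A B : L} (hD : D ≤ A) (h : A < B) : relRank D A < relRank D B :=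
  relRank_lt (by rwa [sup_eq_right.2 hD, sup_eq_right.2 (hD.trans h.le)])

theorem relRank_mono {D A B : L} (h : A ≤ B) : relRank D A ≤ relRank D B :=
  wfRank_mono (α := Set.Ici D) (sup_le_sup_left h D)

theorem relRank_sup_left (D A : L) : relRank D (D ⊔ A) = relRank D A := by
  simp [relRank]

theorem relRank_le_iff {D A : L} {o : Ordinal.{u}} :
    relRank D A ≤ o ↔ ∀ B, D ≤ B → B < D ⊔ A → relRank D B < o := by
  rw [relRank, wfRank_le_iff]
  constructor
  · intro h B hD hB
    simpa [relRank, sup_eq_right.2 hD] using h ⟨B, hD⟩ hB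
  · rintro h ⟨B, hD⟩ hB
    simpa [relRank, sup_eq_right.2 (Set.mem_Ici.1 hD)] using h B hD hB

theorem relRank_le_of_strictMonoOn {D A : L} (hD : D ≤ A) (f : L → Ordinal.{u})
    (h : ∀ B C, D ≤ B → B < C → C ≤ A → f B < f C) : relRank D A ≤ f A := by
  have := wfRank_le_of_strictMonoOn (α := Set.Ici D) (fun B => f B.1) ⟨A, hD⟩
    fun B C hBC hC => h B.1 C.1 B.2 hBC hC
  simpa [relRank, sup_eq_right.2 hD] using this

theorem relRank_bot [OrderBot L] (A : L) : relRank ⊥ A = wfRank A := by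
  apply le_antisymm
  · exact relRank_le_of_strictMonoOn bot_le _ fun B C _ h _ => wfRank_lt h
  · exact wfRank_le_of_strictMonoOn (relRank ⊥) A fun B C h _ => relRank_lt_of_le bot_le h

theorem relRank_self_of_le {D A : L} (h : A ≤ D) : relRank D A = 0 := by
  rw [← nonpos_iff_eq_zero, relRank_le_iff]
  intro B hD hB
  exact absurd (hB.trans_le (sup_le le_rfl h)) (not_lt_of_ge hD)

theorem relRank_pos {D A : L} (h : D < A) : 0 < relRank D A := by
  rw [← relRank_self_of_le (le_refl D)]
  exact relRank_lt_of_le le_rfl h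

/-- A rank function takes every smaller value: a minimal counterexample `A` would have only elements
of rank less than `o` strictly below it. -/
theorem exists_relRank_eq {D A : L} (hDA : D ≤ A) {o : Ordinal.{u}} (ho : o ≤ relRank D A) :
    ∃ E, D ≤ E ∧ E ≤ A ∧ relRank D E = o := by
  induction A using WellFoundedLT.induction with
  | ind A ih =>
    rcases ho.eq_or_lt with ho | ho
    · exact ⟨A, hDA, le_rfl, ho.symm⟩
    · by_contra! hcon
      refine absurd ho (not_lt.2 ?_)
      rw [relRank_le_iff]
      intro B hD hB
      rw [sup_eq_right.2 hDA] at hB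
      by_contra! hB'
      obtain ⟨E, h1, h2, h3⟩ := ih B hB hD hB'
      exact hcon E h1 (h2.trans hB.le) h3

/-- Consecutive intervals concatenate, so the ordinary sum is a lower bound; `relRank_le_nadd` gives
the matching upper bound with the Hessenberg sum. -/
theorem relRank_add_relRank_le {D E A : L} (hDE : D ≤ E) (hEA : E ≤ A) :
    relRank D E + relRank E A ≤ relRank D A := by
  induction A using WellFoundedLT.induction with
  | ind A ih =>
    apply le_of_forall_lt
    intro x hx
    rcases lt_or_ge x (relRank D E) with h | h
    · exact h.trans_le (relRank_mono hEA)
    · have hx' : x - relRank D E < relRank E A := by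
        rwa [← add_lt_add_iff_left (relRank D E), Ordinal.add_sub_cancel_of_le h]
      obtain ⟨B, hEB, hBA, hB⟩ := exists_relRank_eq hEA hx'.le
      have hne : B < A := by
        refine lt_of_le_of_ne hBA ?_
        rintro rfl
        exact hx'.ne' hB
      calc x = relRank D E + relRank E B := by rw [hB, Ordinal.add_sub_cancel_of_le h]
        _ ≤ relRank D B := ih B hne hEB
        _ < relRank D A := relRank_lt_of_le (hDE.trans hEB) hne

end RelRank

section Distrib

variable {L : Type u} [DistribLattice L] [WellFoundedLT L]

/-- In a distributive lattice an element `C` is determined by the pair `C ⊓ E`, `C ⊔ E`, and the two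
coordinates lie in the two intervals. -/
theorem relRank_le_nadd {D E A : L} (hDE : D ≤ E) (hEA : E ≤ A) :
    relRank D A ≤ nadd (relRank D E) (relRank E A) := by
  have key := relRank_le_of_strictMonoOn (hDE.trans hEA)
    (fun C => nadd (relRank D (C ⊓ E)) (relRank E C)) ?_
  · simpa [inf_eq_right.2 hEA] using key
  · intro B C hDB hBC hCA
    refine nadd_lt_of_not_both (relRank_mono (inf_le_inf_right E hBC.le)) (relRank_mono hBC.le) ?_
    by_contra! h
    apply hBC.ne
    apply eq_of_inf_eq_sup_eq (a := E)
    · by_contra hne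
      have hlt := lt_of_le_of_ne (inf_le_inf_right E hBC.le) hne
      exact absurd (relRank_lt_of_le (le_inf hDB hDE) hlt) (not_lt.2 h.1)
    · by_contra hne
      rw [sup_comm B, sup_comm C] at hne
      exact absurd (relRank_lt (lt_of_le_of_ne (sup_le_sup_left hBC.le E) hne)) (not_lt.2 h.2)

/-- An element between `D` and `D ⊔ A ⊔ B` is the join of its traces on `D ⊔ A` and `D ⊔ B`. -/
theorem relRank_sup_le {D A B : L} :
    relRank D (A ⊔ B) ≤ nadd (relRank D A) (relRank D B) := by
  have key := relRank_le_of_strictMonoOn (D := D) (A := D ⊔ (A ⊔ B)) le_sup_left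
    (fun C => nadd (relRank D (C ⊓ (D ⊔ A))) (relRank D (C ⊓ (D ⊔ B)))) ?_
  · refine (relRank_sup_left D (A ⊔ B)).ge.trans (key.trans ?_)
    exact nadd_le_nadd ((relRank_mono inf_le_right).trans (relRank_sup_left D A).le)
      ((relRank_mono inf_le_right).trans (relRank_sup_left D B).le)
  · intro C C' hD hlt hle
    refine nadd_lt_of_not_both (relRank_mono (inf_le_inf_right _ hlt.le))
      (relRank_mono (inf_le_inf_right _ hlt.le)) ?_
    by_contra! h
    have aux : ∀ M : L, D ≤ M → relRank D (C' ⊓ M) ≤ relRank D (C ⊓ M) → C' ⊓ M = C ⊓ M := by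
      intro M hM h
      by_contra hne
      have := lt_of_le_of_ne (inf_le_inf_right M hlt.le) (Ne.symm hne)
      exact absurd (relRank_lt_of_le (le_inf hD hM) this) (not_lt.2 h)
    have hA := aux _ le_sup_left h.1
    have hB := aux _ le_sup_left h.2
    have hC' : C' = C' ⊓ (D ⊔ A) ⊔ C' ⊓ (D ⊔ B) := by
      rw [← inf_sup_left, eq_comm, inf_eq_left]
      exact hle.trans (sup_le (le_sup_left.trans le_sup_left)
        (sup_le_sup le_sup_right le_sup_right))
    have hC'C : C' ≤ C := by
      rw [hC', hA, hB]
      exact sup_le inf_le_left inf_le_left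
    exact absurd hlt (not_lt_of_ge hC'C)

/-- Between `E ⊔ D` and `H ⊔ D`, an element contains `D` and is therefore recovered from its trace
on `H`. -/
theorem relRank_sup_sup_le {D E E' H : L} (hE' : E' ≤ (E ⊔ D) ⊓ H) (hEH : E ≤ H) :
    relRank (E ⊔ D) (H ⊔ D) ≤ relRank E' H := by
  have key := relRank_le_of_strictMonoOn (D := E ⊔ D) (A := H ⊔ D) (sup_le_sup_right hEH D)
    (fun C => relRank E' (C ⊓ H)) ?_
  · simpa using key
  · intro B C hB hBC hC
    have h1 : E' ≤ B ⊓ H := hE'.trans (inf_le_inf_right H hB)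
    refine relRank_lt_of_le h1 (lt_of_le_of_ne (inf_le_inf_right H hBC.le) ?_)
    intro h
    have hD : D ≤ B := le_sup_right.trans hB
    have : C ≤ B := by
      calc C = C ⊓ (H ⊔ D) := (inf_eq_left.2 hC).symm
        _ = C ⊓ H ⊔ C ⊓ D := inf_sup_left _ _ _
        _ ≤ B := sup_le (h ▸ inf_le_left) (inf_le_right.trans hD)
    exact absurd hBC (not_lt_of_ge this)

end Distrib

/-! ### Ranks of boxes -/

/-- A binary map between lattices that behaves like the map sending two closed subsets `F` and `G`
to the closure of the image of `F × G` under a continuous map. -/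
structure IsBoxMap {L₁ L₂ L : Type u} [DistribLattice L₁] [DistribLattice L₂] [DistribLattice L]
    (c : L₁ → L₂ → L) : Prop where
  mono : ∀ {F F' G G'}, F ≤ F' → G ≤ G' → c F G ≤ c F' G'
  split : ∀ {F G A}, A < c F G → ∃ F₁ < F, ∃ G₁ < G, A ≤ c F₁ G ⊔ c F G₁ ∧
    (∀ F' ≤ F, c F' G ≤ A → F' ≤ F₁) ∧ ∀ G' ≤ G, c F G' ≤ A → G' ≤ G₁

section Box

variable {L₁ L₂ L : Type u} [DistribLattice L₁] [DistribLattice L₂] [DistribLattice L]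

theorem IsBoxMap.flip {c : L₁ → L₂ → L} (hc : IsBoxMap c) : IsBoxMap fun G F => c F G where
  mono h h' := hc.mono h' h
  split h := by
    obtain ⟨F₁, hF, G₁, hG, h1, h2, h3⟩ := hc.split h
    exact ⟨G₁, hG, F₁, hF, by rwa [sup_comm], h3, h2⟩

variable [WellFoundedLT L₁] [WellFoundedLT L]

/-- Cuts the side from `F'` to `F` into finitely many pieces, following the Cantor normal form of
its relative rank. The contributions of the pieces are joined by Hessenberg sums, under which ω^z is
closed. -/
theorem IsBoxMap.relRank_lt_of_pieces {c : L₁ → L₂ → L} (hc : IsBoxMap c) {a z : Ordinal.{u}}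
    {G' G : L₂} (hG : G' ≤ G)
    (h : ∀ e < a, ∀ F' F : L₁, F' ≤ F → relRank F' F ≤ ω ^ e →
      relRank (c F' G ⊔ c F G') (c F G) < ω ^ z)
    {F' F : L₁} (hF : F' ≤ F) (hr : relRank F' F < ω ^ a) :
    relRank (c F' G ⊔ c F G') (c F G) < ω ^ z := by
  induction hρ : relRank F' F using WellFoundedLT.induction generalizing F' F with
  | ind ρ ih =>
  subst hρ
  rcases eq_or_ne (relRank F' F) 0 with h0 | h0
  · have : F' = F := by
      by_contra hne
      exact (relRank_pos (lt_of_le_of_ne hF hne)).ne' h0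
    subst this
    rw [relRank_self_of_le le_sup_left]
    exact Ordinal.opow_pos _ Ordinal.omega0_pos
  · obtain ⟨E, hE1, hE2, hE⟩ := exists_relRank_eq hF (Ordinal.opow_log_le_self ω h0)
    have hea : Ordinal.log ω (relRank F' F) < a :=
      (Ordinal.lt_opow_iff_log_lt Ordinal.one_lt_omega0 h0).1 hr
    have hlt : relRank E F < relRank F' F := by
      refine lt_of_le_of_lt ?_ (Ordinal.sub_omega0_opow_log_lt h0)
      rw [← add_le_add_iff_left (ω ^ Ordinal.log ω (relRank F' F)),
        Ordinal.add_sub_cancel_of_le (Ordinal.opow_log_le_self ω h0)]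
      have := relRank_add_relRank_le hE1 hE2
      rwa [hE] at this
    have h1 : relRank (c E G ⊔ c F G') (c F G) < ω ^ z :=
      ih _ hlt hE2 (hlt.trans hr) rfl
    have h2 : relRank (c F' G ⊔ c F G') (c E G ⊔ c F G') < ω ^ z := by
      refine lt_of_le_of_lt (relRank_sup_sup_le (E' := c F' G ⊔ c E G') ?_ ?_)
        (h _ hea F' E hE1 hE.le)
      · exact le_inf (sup_le_sup_left (hc.mono hE2 le_rfl) _)
          (sup_le (hc.mono hE1 le_rfl) (hc.mono le_rfl hG))
      · exact hc.mono hE1 le_rfl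
    exact (relRank_le_nadd (sup_le_sup_right (hc.mono hE1 le_rfl) _)
      (sup_le (hc.mono hE2 le_rfl) (hc.mono le_rfl hG))).trans_lt (nadd_lt_opow h2 h1)

variable [WellFoundedLT L₂]

/-- A proper part `A` of the box is covered by two boxes, each with one side shortened to relative
rank below its power of ω. Cutting that side into pieces with smaller exponents makes induction
applicable, and ω to the `nadd a b` is closed under the resulting sums. -/
theorem IsBoxMap.relRank_le_opow {c : L₁ → L₂ → L} (hc : IsBoxMap c) (a b : Ordinal.{u})
    {F' F : L₁} (hF : F' ≤ F) {G' G : L₂} (hG : G' ≤ G)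
    (ha : relRank F' F ≤ ω ^ a) (hb : relRank G' G ≤ ω ^ b) :
    relRank (c F' G ⊔ c F G') (c F G) ≤ ω ^ nadd a b := by
  rw [relRank_le_iff]
  intro A hD hA
  rw [sup_eq_right.2 (sup_le (hc.mono hF le_rfl) (hc.mono le_rfl hG))] at hA
  obtain ⟨F₁, hF₁, G₁, hG₁, hA', h1, h2⟩ := hc.split hA
  have hF' : F' ≤ F₁ := h1 F' hF (le_sup_left.trans hD)
  have hG' : G' ≤ G₁ := h2 G' hG (le_sup_right.trans hD)
  set D := c F' G ⊔ c F G' with hDdef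
  have hFa : relRank F' F₁ < ω ^ a := (relRank_lt_of_le hF' hF₁).trans_le ha
  have hGb : relRank G' G₁ < ω ^ b := (relRank_lt_of_le hG' hG₁).trans_le hb
  have hbox1 : relRank (c F' G ⊔ c F₁ G') (c F₁ G) < ω ^ nadd a b := by
    refine hc.relRank_lt_of_pieces hG (a := a) (fun e he E' E hE hr => ?_) hF' hFa
    exact (IsBoxMap.relRank_le_opow hc e b hE hG hr hb).trans_lt
      (opow_lt_opow_omega0.2 (nadd_lt_nadd_right he b))
  have hbox2 : relRank (c F G' ⊔ c F' G₁) (c F G₁) < ω ^ nadd a b := by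
    refine hc.flip.relRank_lt_of_pieces hF (a := b) (fun e he E' E hE hr => ?_) hG' hGb
    rw [sup_comm]
    exact (IsBoxMap.relRank_le_opow hc a e hF hE ha hr).trans_lt
      (opow_lt_opow_omega0.2 (nadd_lt_nadd_left he a))
  -- Enlarging the removed part to `D` cannot increase the relative rank of the box.
  have hD1 : relRank D (c F₁ G) ≤ relRank (c F' G ⊔ c F₁ G') (c F₁ G) := by
    have := relRank_sup_sup_le (D := D) (E := c F' G) (E' := c F' G ⊔ c F₁ G') (H := c F₁ G)
      (le_inf (sup_le le_sup_left ((hc.mono hF₁.le le_rfl).trans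
        (le_sup_right.trans le_sup_right)))
        (sup_le (hc.mono hF' le_rfl) (hc.mono le_rfl hG))) (hc.mono hF' le_rfl)
    rw [sup_eq_right.2 (le_sup_left : c F' G ≤ D), sup_comm _ D, relRank_sup_left] at this
    exact this
  have hD2 : relRank D (c F G₁) ≤ relRank (c F G' ⊔ c F' G₁) (c F G₁) := by
    have := relRank_sup_sup_le (D := D) (E := c F G') (E' := c F G' ⊔ c F' G₁) (H := c F G₁)
      (le_inf (sup_le le_sup_left ((hc.mono le_rfl hG₁.le).trans
        (le_sup_left.trans le_sup_right)))
        (sup_le (hc.mono le_rfl hG') (hc.mono hF le_rfl))) (hc.mono le_rfl hG')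
    rw [sup_eq_right.2 (le_sup_right : c F G' ≤ D), sup_comm _ D, relRank_sup_left] at this
    exact this
  calc relRank D A ≤ relRank D (c F₁ G ⊔ c F G₁) := relRank_mono hA'
    _ ≤ nadd (relRank D (c F₁ G)) (relRank D (c F G₁)) := relRank_sup_le
    _ < ω ^ nadd a b := nadd_lt_opow (hD1.trans_lt hbox1) (hD2.trans_lt hbox2)
termination_by (a, b)
decreasing_by
  · exact Prod.Lex.left _ _ he
  · exact Prod.Lex.right _ he

/-- Leading exponents combine by `nadd`, and ω^d is closed under `nadd`; so ω^(ω^d) bounds boxes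
with both sides below it. -/
theorem IsBoxMap.wfRank_lt_opow_opow [OrderBot L₁] [OrderBot L₂] [OrderBot L]
    {c : L₁ → L₂ → L} (hc : IsBoxMap c) (hbot₁ : ∀ G, c ⊥ G = ⊥) (hbot₂ : ∀ F, c F ⊥ = ⊥)
    {F : L₁} {G : L₂} {d : Ordinal.{u}} (hF : wfRank F < ω ^ (ω : Ordinal.{u}) ^ d)
    (hG : wfRank G < ω ^ (ω : Ordinal.{u}) ^ d) :
    wfRank (c F G) < ω ^ (ω : Ordinal.{u}) ^ d := by
  have hlog : ∀ {x : Ordinal.{u}}, x < ω ^ (ω : Ordinal.{u}) ^ d →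
      Ordinal.log ω x < ω ^ d := by
    intro x hx
    rcases eq_or_ne x 0 with rfl | h0
    · rw [Ordinal.log_zero_right]; exact Ordinal.opow_pos _ Ordinal.omega0_pos
    · exact (Ordinal.lt_opow_iff_log_lt Ordinal.one_lt_omega0 h0).1 hx
  set a := Ordinal.log ω (wfRank F) with ha
  set b := Ordinal.log ω (wfRank G) with hb
  have hab : nadd a b < ω ^ d := nadd_lt_opow (hlog hF) (hlog hG)
  have key : relRank (c ⊥ G ⊔ c F ⊥) (c F G) < ω ^ (nadd a b + 1) := by
    -- Both sides are cut in turn; the bounds `a + 1` and `b + 1` mean that the pieces have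
    -- exponents at most `a` and `b`.
    refine hc.relRank_lt_of_pieces bot_le (a := a + 1) (fun e he E' E hE hr => ?_) bot_le
      (by rw [relRank_bot]; exact lt_opow_log_add_one _)
    rw [sup_comm]
    refine hc.flip.relRank_lt_of_pieces hE (a := b + 1) (fun e' he' H' H hH hr' => ?_) bot_le
      (by rw [relRank_bot]; exact lt_opow_log_add_one _)
    rw [sup_comm]
    refine (hc.relRank_le_opow e e' hE hH hr hr').trans_lt (opow_lt_opow_omega0.2 ?_)
    exact Order.lt_add_one_iff.2
      (nadd_le_nadd (Order.lt_add_one_iff.1 he) (Order.lt_add_one_iff.1 he'))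
  rw [hbot₁, hbot₂, sup_idem, relRank_bot] at key
  exact key.trans_le (opow_le_opow_omega0.2 (Order.add_one_le_of_lt hab))

end Box

/-! ### Accessibility in distributive lattices -/

/-- Accessibility of single elements replaces ranks here, since well-foundedness of the closed sets
of words is still to be proved. An element strictly below `A ⊔ B` has a strictly smaller trace on
`A` or on `B`. -/
theorem acc_sup {L : Type u} [DistribLattice L] {A B : L} (hA : Acc (· < ·) A)
    (hB : Acc (· < ·) B) : Acc (· < ·) (A ⊔ B) := by
  induction hA generalizing B with
  | intro A hA ihA =>
  induction hB with
  | intro B hB ihB =>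
  refine ⟨_, fun C hC => ?_⟩
  have hdec : C = C ⊓ A ⊔ C ⊓ B := by rw [← inf_sup_left, inf_eq_left.2 hC.le]
  rcases (inf_le_right : C ⊓ A ≤ A).lt_or_eq with h1 | h1
  · rcases (inf_le_right : C ⊓ B ≤ B).lt_or_eq with h2 | h2
    · rw [hdec]; exact ihA _ h1 (hB _ h2)
    · rw [hdec, h2]; exact ihA _ h1 ⟨_, hB⟩
  · rcases (inf_le_right : C ⊓ B ≤ B).lt_or_eq with h2 | h2
    · rw [hdec, h1]; exact ihB _ h2
    · rw [hdec, h1, h2] at hC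
      exact absurd hC (lt_irrefl _)

theorem acc_of_le {L : Type u} [PartialOrder L] {A B : L} (h : A ≤ B) (hB : Acc (· < ·) B) :
    Acc (· < ·) A := by
  rcases h.lt_or_eq with h | rfl
  · exact hB.inv h
  · exact hB

theorem IsBoxMap.acc {L₁ L₂ L : Type u} [DistribLattice L₁] [DistribLattice L₂] [DistribLattice L]
    {c : L₁ → L₂ → L} (hc : IsBoxMap c) {F : L₁} {G : L₂} (hF : Acc (· < ·) F)
    (hG : Acc (· < ·) G) : Acc (· < ·) (c F G) := by
  induction hF generalizing G with
  | intro F hF ihF =>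
  induction hG with
  | intro G hG ihG =>
  refine ⟨_, fun A hA => ?_⟩
  obtain ⟨F₁, hF₁, G₁, hG₁, hA, -⟩ := hc.split hA
  exact acc_of_le hA (acc_sup (ihF _ hF₁ ⟨_, hG⟩) (ihG _ hG₁))

/-! ### Irreducible closed sets and continuous binary operations -/

theorem le_or_le_of_isIrreducible {X : Type u} [TopologicalSpace X] {A B C : Closeds X}
    (hA : IsIrreducible (A : Set X)) (h : A ≤ B ⊔ C) : A ≤ B ∨ A ≤ C :=
  isPreirreducible_iff_isClosed_union_isClosed.1 hA.isPreirreducible _ _ B.isClosed C.isClosed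
    (by exact_mod_cast h)

/-- The closed set underlying an irreducible closed set. -/
def TopologicalSpace.IrreducibleCloseds.toClosed {X : Type u} [TopologicalSpace X]
    (C : IrreducibleCloseds X) : Closeds X :=
  ⟨C, C.isClosed⟩

theorem TopologicalSpace.IrreducibleCloseds.toClosed_le {X : Type u} [TopologicalSpace X]
    {C D : IrreducibleCloseds X} : C.toClosed ≤ D.toClosed ↔ C ≤ D := Iff.rfl

theorem TopologicalSpace.IrreducibleCloseds.toClosed_lt {X : Type u} [TopologicalSpace X]
    {C D : IrreducibleCloseds X} : C.toClosed < D.toClosed ↔ C < D := Iff.rfl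

theorem TopologicalSpace.IrreducibleCloseds.toClosed_injective {X : Type u} [TopologicalSpace X]
    {C D : IrreducibleCloseds X} (h : C.toClosed = D.toClosed) : C = D :=
  le_antisymm (toClosed_le.1 h.le) (toClosed_le.1 h.ge)

theorem wfRank_irreducible_le {X : Type u} [TopologicalSpace X] [NoetherianSpace X]
    (C : IrreducibleCloseds X) : wfRank C ≤ wfRank C.toClosed :=
  wfRank_le_of_strictMonoOn (fun D => wfRank D.toClosed) C fun _ _ h _ => wfRank_lt h

/-- The closure of the image of `F × G` under a binary operation. -/
def closedImage {X Y W : Type u} [TopologicalSpace X] [TopologicalSpace Y] [TopologicalSpace W]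
    (op : X → Y → W) (F : Closeds X) (G : Closeds Y) : Closeds W :=
  Closeds.closure (Set.image2 op F G)

section ClosedImage

variable {X Y W : Type u} [TopologicalSpace X] [TopologicalSpace Y] [TopologicalSpace W]
  {op : X → Y → W}

theorem closedImage_le {F : Closeds X} {G : Closeds Y} {A : Closeds W} :
    closedImage op F G ≤ A ↔ ∀ x ∈ F, ∀ y ∈ G, op x y ∈ A := by
  rw [closedImage, Closeds.closure_le, Set.image2_subset_iff]
  rfl

theorem mem_closedImage {F : Closeds X} {G : Closeds Y} {x : X} {y : Y} (hx : x ∈ F)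
    (hy : y ∈ G) : op x y ∈ closedImage op F G :=
  closedImage_le.1 le_rfl x hx y hy

theorem closedImage_mono {F F' : Closeds X} {G G' : Closeds Y} (hF : F ≤ F') (hG : G ≤ G') :
    closedImage op F G ≤ closedImage op F' G' :=
  closedImage_le.2 fun _ hx _ hy => mem_closedImage (hF hx) (hG hy)

theorem closedImage_bot_left (G : Closeds Y) : closedImage op ⊥ G = ⊥ :=
  le_bot_iff.1 (closedImage_le.2 fun _ hx => absurd hx (Set.notMem_empty _))

theorem closedImage_bot_right (F : Closeds X) : closedImage op F ⊥ = ⊥ :=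
  le_bot_iff.1 (closedImage_le.2 fun _ _ _ hy => absurd hy (Set.notMem_empty _))

/-- A continuous binary operation that sends pairs of closed sets to closed sets. -/
structure IsClosedOp (op : X → Y → W) : Prop where
  continuous : Continuous fun p : X × Y => op p.1 p.2
  isClosed : ∀ (F : Closeds X) (G : Closeds Y), IsClosed (Set.image2 op F G)

theorem IsClosedOp.mem_closedImage_iff (hop : IsClosedOp op) {F : Closeds X} {G : Closeds Y}
    {w : W} : w ∈ closedImage op F G ↔ ∃ x ∈ F, ∃ y ∈ G, op x y = w := by
  rw [closedImage, Closeds.mem_closure, (hop.isClosed F G).closure_eq]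
  rfl

/-- A point of the box missing from `A` has a product neighbourhood `U × V` missing from `A`.
Removing `U` from `F`, or `V` from `G`, gives the smaller sides. Closedness of images lets every
element of the box be written as `op x y`. -/
theorem IsClosedOp.isBoxMap (hop : IsClosedOp op) : IsBoxMap (closedImage op) where
  mono := closedImage_mono
  split := by
    intro F G A hA
    have hnot : ¬ ∀ x ∈ F, ∀ y ∈ G, op x y ∈ A := fun h =>
      absurd hA (not_lt_of_ge (closedImage_le.2 h))
    push Not at hnot
    obtain ⟨x, hx, y, hy, hxy⟩ := hnot
    have hopen : IsOpen ((fun p : X × Y => op p.1 p.2) ⁻¹' (A : Set W)ᶜ) :=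
      A.isClosed.isOpen_compl.preimage hop.continuous
    obtain ⟨U, V, hU, hV, hxU, hyV, hUV⟩ := isOpen_prod_iff.1 hopen x y hxy
    have hUV' : ∀ x' ∈ U, ∀ y' ∈ V, op x' y' ∉ A := fun x' hx' y' hy' =>
      hUV (Set.mk_mem_prod hx' hy')
    let CU : Closeds X := ⟨Uᶜ, hU.isClosed_compl⟩
    let CV : Closeds Y := ⟨Vᶜ, hV.isClosed_compl⟩
    refine ⟨F ⊓ CU, inf_lt_left.2 fun h => h hx hxU, G ⊓ CV, inf_lt_left.2 fun h => h hy hyV,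
      ?_, ?_, ?_⟩
    · intro w hw
      obtain ⟨x', hx', y', hy', rfl⟩ := hop.mem_closedImage_iff.1 (hA.le hw)
      by_cases hU' : x' ∈ U
      · by_cases hV' : y' ∈ V
        · exact absurd hw (hUV' x' hU' y' hV')
        · exact Or.inr (mem_closedImage hx' ⟨hy', hV'⟩)
      · exact Or.inl (mem_closedImage ⟨hx', hU'⟩ hy')
    · intro F' hF' h
      refine le_inf hF' fun x' hx' hx'U => ?_
      exact hUV' x' hx'U y hyV (h (mem_closedImage hx' hy))
    · intro G' hG' h
      refine le_inf hG' fun y' hy' hy'V => ?_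
      exact hUV' x hxU y' hy'V (h (mem_closedImage hx hy'))

theorem exists_isIrreducible_or {F : Closeds X} (hF : (F : Set X).Nonempty) :
    IsIrreducible (F : Set X) ∨ ∃ F₁ < F, ∃ F₂ < F, F ≤ F₁ ⊔ F₂ := by
  by_cases h : IsPreirreducible (F : Set X)
  · exact Or.inl ⟨hF, h⟩
  · right
    simp only [isPreirreducible_iff_isClosed_union_isClosed, not_forall, not_or] at h
    obtain ⟨z₁, z₂, hz₁, hz₂, h, hz₁', hz₂'⟩ := h
    lift z₁ to Closeds X using hz₁
    lift z₂ to Closeds X using hz₂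
    refine ⟨F ⊓ z₁, inf_lt_left.2 hz₁', F ⊓ z₂, inf_lt_left.2 hz₂', ?_⟩
    rw [← inf_sup_left]
    exact le_inf le_rfl (by exact_mod_cast h)

variable [NoetherianSpace X] [NoetherianSpace Y]

/-- An irreducible closed set contained in a closed box is itself an irreducible closed box. -/
theorem IsClosedOp.exists_irreducible_eq (hop : IsClosedOp op) {A : Closeds W}
    (hA : IsIrreducible (A : Set W)) {F : Closeds X} {G : Closeds Y}
    (h : A ≤ closedImage op F G) :
    ∃ (C : IrreducibleCloseds X) (D : IrreducibleCloseds Y), C.toClosed ≤ F ∧ D.toClosed ≤ G ∧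
      A = closedImage op C.toClosed D.toClosed := by
  induction F using WellFoundedLT.induction generalizing G with
  | ind F ihF =>
  induction G using WellFoundedLT.induction with
  | ind G ihG =>
  have stepF : ∀ F₁ < F, A ≤ closedImage op F₁ G → ∃ (C : IrreducibleCloseds X)
      (D : IrreducibleCloseds Y), C.toClosed ≤ F ∧ D.toClosed ≤ G ∧
      A = closedImage op C.toClosed D.toClosed := by
    intro F₁ hF₁ h₁
    obtain ⟨C, D, hC, hD, hCD⟩ := ihF F₁ hF₁ h₁
    exact ⟨C, D, hC.trans hF₁.le, hD, hCD⟩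
  have stepG : ∀ G₁ < G, A ≤ closedImage op F G₁ → ∃ (C : IrreducibleCloseds X)
      (D : IrreducibleCloseds Y), C.toClosed ≤ F ∧ D.toClosed ≤ G ∧
      A = closedImage op C.toClosed D.toClosed := by
    intro G₁ hG₁ h₁
    obtain ⟨C, D, hC, hD, hCD⟩ := ihG G₁ hG₁ h₁
    exact ⟨C, D, hC, hD.trans hG₁.le, hCD⟩
  -- A proper inclusion allows one side to shrink. If `A` is the whole box, a reducible side can be
  -- split and irreducibility of `A` again selects a smaller box.
  rcases h.lt_or_eq with hlt | heq
  · obtain ⟨F₁, hF₁, G₁, hG₁, h₁, -⟩ := hop.isBoxMap.split hlt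
    rcases le_or_le_of_isIrreducible hA h₁ with h₁ | h₁
    · exact stepF F₁ hF₁ h₁
    · exact stepG G₁ hG₁ h₁
  · obtain ⟨w, hw⟩ := hA.nonempty
    obtain ⟨x, hx, y, hy, -⟩ := hop.mem_closedImage_iff.1 (h hw)
    rcases exists_isIrreducible_or ⟨x, hx⟩ with hFi | ⟨F₁, hF₁, F₂, hF₂, hF⟩
    · rcases exists_isIrreducible_or ⟨y, hy⟩ with hGi | ⟨G₁, hG₁, G₂, hG₂, hG⟩
      · exact ⟨⟨F, hFi, F.isClosed⟩, ⟨G, hGi, G.isClosed⟩, le_rfl, le_rfl, heq⟩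
      · have : A ≤ closedImage op F G₁ ⊔ closedImage op F G₂ := by
          refine h.trans (closedImage_le.2 fun x hx y hy => ?_)
          rcases hG hy with hy | hy
          · exact Or.inl (mem_closedImage hx hy)
          · exact Or.inr (mem_closedImage hx hy)
        rcases le_or_le_of_isIrreducible hA this with h₁ | h₁
        · exact stepG G₁ hG₁ h₁
        · exact stepG G₂ hG₂ h₁
    · have : A ≤ closedImage op F₁ G ⊔ closedImage op F₂ G := by
        refine h.trans (closedImage_le.2 fun x hx y hy => ?_)
        rcases hF hx with hx | hx
        · exact Or.inl (mem_closedImage hx hy)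
        · exact Or.inr (mem_closedImage hx hy)
      rcases le_or_le_of_isIrreducible hA this with h₁ | h₁
      · exact stepF F₁ hF₁ h₁
      · exact stepF F₂ hF₂ h₁

variable [NoetherianSpace W]

/-- Irreducible closed subsets of a box are boxes with irreducible sides, and a strict inclusion
lowers the rank of a side. Thus among irreducible closed sets ranks add, whereas boxes in the
lattice of all closed sets involve products. -/
theorem IsClosedOp.wfRank_le_nadd (hop : IsClosedOp op) (A : IrreducibleCloseds W)
    {C : IrreducibleCloseds X} {D : IrreducibleCloseds Y}
    (h : A.toClosed ≤ closedImage op C.toClosed D.toClosed) :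
    wfRank A ≤ nadd (wfRank C) (wfRank D) := by
  induction A using WellFoundedLT.induction generalizing C D with
  | ind A ih =>
  obtain ⟨C₁, D₁, hC₁, hD₁, hA⟩ := hop.exists_irreducible_eq A.isIrreducible h
  refine le_trans ?_ (nadd_le_nadd (wfRank_mono (IrreducibleCloseds.toClosed_le.1 hC₁))
    (wfRank_mono (IrreducibleCloseds.toClosed_le.1 hD₁)))
  rw [wfRank_le_iff]
  intro B hB
  have hBA : B.toClosed ≤ closedImage op C₁.toClosed D₁.toClosed :=
    hA ▸ IrreducibleCloseds.toClosed_le.2 hB.le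
  obtain ⟨C₂, D₂, hC₂, hD₂, hB'⟩ := hop.exists_irreducible_eq B.isIrreducible hBA
  rw [IrreducibleCloseds.toClosed_le] at hC₂ hD₂
  refine (ih B hB hB'.le).trans_lt (nadd_lt_of_not_both (wfRank_mono hC₂) (wfRank_mono hD₂) ?_)
  by_contra! hcon
  have hC : C₂ = C₁ := by
    by_contra hne
    exact absurd (wfRank_lt (lt_of_le_of_ne hC₂ hne)) (not_lt.2 hcon.1)
  have hD : D₂ = D₁ := by
    by_contra hne
    exact absurd (wfRank_lt (lt_of_le_of_ne hD₂ hne)) (not_lt.2 hcon.2)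
  rw [hC, hD, ← hA] at hB'
  exact hB.ne (IrreducibleCloseds.toClosed_injective hB')

theorem IsClosedOp.wfRank_lt_opow (hop : IsClosedOp op) {F : Closeds X} {G : Closeds Y}
    {e : Ordinal.{u}} (hF : ∀ C : IrreducibleCloseds X, C.toClosed ≤ F → wfRank C < ω ^ e)
    (hG : ∀ D : IrreducibleCloseds Y, D.toClosed ≤ G → wfRank D < ω ^ e)
    (A : IrreducibleCloseds W) (h : A.toClosed ≤ closedImage op F G) : wfRank A < ω ^ e := by
  obtain ⟨C, D, hC, hD, hA⟩ := hop.exists_irreducible_eq A.isIrreducible h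
  exact (hop.wfRank_le_nadd A hA.le).trans_lt (nadd_lt_opow (hF C hC) (hG D hD))

end ClosedImage

/-! ### The word topology -/

section SublistForall

variable {α β : Type u} {R : α → β → Prop}

theorem List.SublistForall₂.of_sublist_left {v w : List α} {w' : List β} (h : v.Sublist w)
    (hw : List.SublistForall₂ R w w') : List.SublistForall₂ R v w' := by
  induction hw generalizing v with
  | nil => rw [List.sublist_nil.1 h]; exact .nil
  | cons hr _ ih =>
    rcases h with _ | h | h
    · exact .cons_right (ih (by assumption))
    · exact .cons hr (ih (by assumption))
  | cons_right _ ih => exact .cons_right (ih h)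

theorem List.SublistForall₂.of_sublist_right {w : List α} {v' w' : List β} (h : v'.Sublist w')
    (hw : List.SublistForall₂ R w v') : List.SublistForall₂ R w w' := by
  obtain ⟨l, h1, h2⟩ := List.sublistForall₂_iff.1 hw
  exact List.sublistForall₂_iff.2 ⟨l, h1, h2.trans h⟩

theorem List.SublistForall₂.mono {S : α → β → Prop} {w : List α} {w' : List β}
    (h : ∀ x y, R x y → S x y) (hw : List.SublistForall₂ R w w') :
    List.SublistForall₂ S w w' := by
  obtain ⟨l, h1, h2⟩ := List.sublistForall₂_iff.1 hw
  exact List.sublistForall₂_iff.2 ⟨l, h1.imp h, h2⟩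

theorem List.SublistForall₂.append {u v : List α} {u' v' : List β}
    (hu : List.SublistForall₂ R u u') (hv : List.SublistForall₂ R v v') :
    List.SublistForall₂ R (u ++ v) (u' ++ v') := by
  obtain ⟨l, h1, h2⟩ := List.sublistForall₂_iff.1 hu
  obtain ⟨l', h1', h2'⟩ := List.sublistForall₂_iff.1 hv
  exact List.sublistForall₂_iff.2 ⟨l ++ l', List.rel_append h1 h1', h2.append h2'⟩

theorem List.SublistForall₂.exists_of_append {w : List α} {u' v' : List β}
    (h : List.SublistForall₂ R w (u' ++ v')) :
    ∃ n : Fin (w.length + 1), List.SublistForall₂ R (w.take n) u' ∧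
      List.SublistForall₂ R (w.drop n) v' := by
  obtain ⟨l, h1, h2⟩ := List.sublistForall₂_iff.1 h
  obtain ⟨l₁, l₂, rfl, h3, h4⟩ := List.sublist_append_iff.1 h2
  refine ⟨⟨l₁.length, ?_⟩, ?_, ?_⟩
  · have := h1.length_eq
    rw [List.length_append] at this
    omega
  · exact List.sublistForall₂_iff.2 ⟨l₁, List.forall₂_take_append _ _ _ h1, h3⟩
  · exact List.sublistForall₂_iff.2 ⟨l₂, List.forall₂_drop_append _ _ _ h1, h4⟩

theorem List.Forall₂.exists_right {l : List α} {l' : List β} (h : List.Forall₂ R l l') {x : α}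
    (hx : x ∈ l) : ∃ y ∈ l', R x y := by
  induction h with
  | nil => simp at hx
  | cons hr _ ih =>
    rcases List.mem_cons.1 hx with rfl | hx
    · exact ⟨_, List.mem_cons_self, hr⟩
    · obtain ⟨y, hy, h⟩ := ih hx
      exact ⟨y, List.mem_cons_of_mem _ hy, h⟩

end SublistForall

/-! ### Basic neighbourhoods of words and concatenation. -/

variable {X : Type u}

/-- The letters of a word. -/
def Word.letters (w : Word X) : List X := w

/-- Concatenation of words. -/
def Word.append (u v : Word X) : Word X := u.letters ++ v.letters

@[simp]
theorem Word.letters_append (u v : Word X) : (u.append v).letters = u.letters ++ v.letters := rfl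

/-- The one-letter word. -/
def Word.letter (x : X) : Word X := [x]

@[simp]
theorem Word.letters_letter (x : X) : (Word.letter x).letters = [x] := rfl

/-- The words containing a subword obtained from `w` by replacing each letter `x` by an element
of `U x`. -/
def Word.nhd (U : X → Set X) (w : Word X) : Set (Word X) :=
  {w' | List.SublistForall₂ (fun x y => y ∈ U x) w.letters w'.letters}

theorem Word.nhd_eq_basicOpen (U : X → Set X) (w : Word X) :
    Word.nhd U w = Word.basicOpen (w.letters.map U) := by
  ext w'
  refine List.sublistForall₂_iff.trans (exists_congr fun l => and_congr_left fun _ => ?_)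
  rw [List.forall₂_map_right_iff]
  exact ⟨List.Forall₂.flip, List.Forall₂.flip⟩

/-- A choice of an open neighbourhood of each point. -/
def IsNhdChoice [TopologicalSpace X] (U : X → Set X) : Prop := ∀ x, IsOpen (U x) ∧ x ∈ U x

theorem isNhdChoice_univ [TopologicalSpace X] : IsNhdChoice fun _ : X => Set.univ :=
  fun x => ⟨isOpen_univ, Set.mem_univ x⟩

theorem IsNhdChoice.iInter [TopologicalSpace X] {ι : Type*} [Finite ι] {U : ι → X → Set X}
    (h : ∀ i, IsNhdChoice (U i)) : IsNhdChoice fun x => ⋂ i, U i x :=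
  fun x => ⟨isOpen_iInter_of_finite fun i => (h i x).1, Set.mem_iInter.2 fun i => (h i x).2⟩

/-- The neighbourhoods that avoid each of finitely many closed sets wherever possible. -/
theorem isNhdChoice_of_finite [TopologicalSpace X] {𝒞 : Set (Set X)} (h𝒞 : 𝒞.Finite)
    (h : ∀ C ∈ 𝒞, IsClosed C) : IsNhdChoice fun x : X => {y | ∀ C ∈ 𝒞, y ∈ C → x ∈ C} := by
  intro x
  refine ⟨?_, fun C _ hx => hx⟩
  have : {y | ∀ C ∈ 𝒞, y ∈ C → x ∈ C} = ⋂ C ∈ {C ∈ 𝒞 | x ∉ C}, Cᶜ := by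
    ext y
    simp only [Set.mem_ofPred_eq, Set.mem_iInter, Set.mem_compl_iff]
    exact ⟨fun h C hC hy => hC.2 (h C hC.1 hy), fun h C hC hy => by
      by_contra hx
      exact h C ⟨hC, hx⟩ hy⟩
  change IsOpen {y | ∀ C ∈ 𝒞, y ∈ C → x ∈ C}
  rw [this]
  exact (h𝒞.subset fun C hC => hC.1).isOpen_biInter fun C hC => (h C hC.1).isOpen_compl

theorem Word.nhd_mono {U V : X → Set X} (h : ∀ x, U x ⊆ V x) (w : Word X) :
    Word.nhd U w ⊆ Word.nhd V w :=
  fun _ hw => hw.mono fun x _ hy => h x hy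

variable [TopologicalSpace X]

theorem Word.isOpen_nhd {U : X → Set X} (hU : IsNhdChoice U) (w : Word X) :
    IsOpen (Word.nhd U w) := by
  rw [Word.nhd_eq_basicOpen]
  refine isOpen_generateFrom_of_mem ⟨_, fun V hV => ?_, rfl⟩
  obtain ⟨x, -, rfl⟩ := List.mem_map.1 hV
  exact (hU x).1

theorem Word.mem_nhd_self {U : X → Set X} (hU : IsNhdChoice U) (w : Word X) :
    w ∈ Word.nhd U w :=
  List.sublistForall₂_iff.2 ⟨w.letters, List.forall₂_same.2 fun x _ => (hU x).2,
    List.Sublist.refl _⟩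

/-- The sets `Word.nhd U w` form a neighbourhood base at `w`; assigning one open set to each letter,
instead of one to each position, makes finite intersections immediate. -/
theorem Word.exists_nhd_subset {O : Set (Word X)} (hO : IsOpen O) {w : Word X} (hw : w ∈ O) :
    ∃ U : X → Set X, IsNhdChoice U ∧ Word.nhd U w ⊆ O := by
  induction hO with
  | basic S hS =>
    obtain ⟨Us, hUs, rfl⟩ := hS
    obtain ⟨v, hv, hvw⟩ := hw
    -- The neighbourhood of `x` is the intersection of those listed open sets that contain `x`.
    refine ⟨fun x => {y | ∀ V ∈ {V | V ∈ Us}, x ∈ V → y ∈ V}, ?_, ?_⟩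
    · have := isNhdChoice_of_finite (X := X) (𝒞 := compl '' {V | V ∈ Us})
        ((List.finite_toSet Us).image _) (by
          rintro _ ⟨V, hV, rfl⟩
          exact (hUs V hV).isClosed_compl)
      convert this using 3 with x
      ext y
      exact ⟨fun h C hC hy => by
          obtain ⟨V, hV, rfl⟩ := hC
          exact fun hx => hy (h V hV hx),
        fun h V hV hx => by
          by_contra hy
          exact h _ ⟨V, hV, rfl⟩ hy hx⟩
    · intro w' hw'
      obtain ⟨l, h1, h2⟩ := List.sublistForall₂_iff.1 (hw'.of_sublist_left hvw)
      refine ⟨l, ?_, h2⟩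
      have aux : ∀ (v l : List X) (Us' : List (Set X)), (∀ V ∈ Us', V ∈ Us) →
          List.Forall₂ (fun x V => x ∈ V) v Us' →
          List.Forall₂ (fun x y => y ∈ {y | ∀ V ∈ {V | V ∈ Us}, x ∈ V → y ∈ V}) v l →
          List.Forall₂ (fun x V => x ∈ V) l Us' := by
        intro v l Us' hsub h1 h2
        induction h1 generalizing l with
        | nil => rw [List.forall₂_nil_left_iff.1 h2]; exact .nil
        | cons hxV _ ih =>
          obtain ⟨y, l', hy, hl', rfl⟩ := List.forall₂_cons_left_iff.1 h2
          exact .cons (hy _ (hsub _ List.mem_cons_self) hxV)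
            (ih l' (fun V hV => hsub V (List.mem_cons_of_mem _ hV)) hl')
      exact aux v l Us (fun _ h => h) hv h1
  | univ => exact ⟨_, isNhdChoice_univ, Set.subset_univ _⟩
  | inter s t _ _ ihs iht =>
    obtain ⟨U, hU, hUs⟩ := ihs hw.1
    obtain ⟨V, hV, hVt⟩ := iht hw.2
    refine ⟨fun x => U x ∩ V x, fun x => ⟨(hU x).1.inter (hV x).1, (hU x).2, (hV x).2⟩,
      Set.subset_inter ?_ ?_⟩
    · exact (Word.nhd_mono (fun _ => Set.inter_subset_left) w).trans hUs
    · exact (Word.nhd_mono (fun _ => Set.inter_subset_right) w).trans hVt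
  | sUnion S _ ih =>
    obtain ⟨s, hs, hws⟩ := hw
    obtain ⟨U, hU, hUs⟩ := ih s hs hws
    exact ⟨U, hU, hUs.trans (Set.subset_sUnion_of_mem hs)⟩

theorem Word.isOpen_iff {O : Set (Word X)} :
    IsOpen O ↔ ∀ w ∈ O, ∃ U : X → Set X, IsNhdChoice U ∧ Word.nhd U w ⊆ O := by
  refine ⟨fun hO w hw => Word.exists_nhd_subset hO hw, fun h => ?_⟩
  rw [isOpen_iff_forall_mem_open]
  intro w hw
  obtain ⟨U, hU, hUO⟩ := h w hw
  exact ⟨_, hUO, Word.isOpen_nhd hU w, Word.mem_nhd_self hU w⟩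

theorem Word.isClosed_iff {A : Set (Word X)} :
    IsClosed A ↔ ∀ w ∉ A, ∃ U : X → Set X, IsNhdChoice U ∧ ∀ w' ∈ Word.nhd U w, w' ∉ A := by
  rw [← isOpen_compl_iff, Word.isOpen_iff]
  rfl

theorem Word.mem_of_sublist {A : Set (Word X)} (hA : IsClosed A) {w w' : Word X}
    (h : w.letters.Sublist w'.letters) (hw' : w' ∈ A) : w ∈ A := by
  by_contra hw
  obtain ⟨U, hU, h'⟩ := Word.isClosed_iff.1 hA w hw
  exact h' w' ((Word.mem_nhd_self hU w).of_sublist_right h) hw'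

/-- A set of words defined from finitely many closed sets of letters, in a way that is stable by
taking subwords and by specializing letters, is closed. -/
theorem Word.isClosed_of_finite {A : Set (Word X)} {𝒞 : Set (Set X)} (h𝒞 : 𝒞.Finite)
    (hcl : ∀ C ∈ 𝒞, IsClosed C)
    (hsub : ∀ w w' : Word X, w.letters.Sublist w'.letters → w' ∈ A → w ∈ A)
    (hspec : ∀ w w' : Word X,
      List.Forall₂ (fun x y => ∀ C ∈ 𝒞, y ∈ C → x ∈ C) w.letters w'.letters → w' ∈ A → w ∈ A) :
    IsClosed A := by
  rw [Word.isClosed_iff]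
  intro w hw
  refine ⟨_, isNhdChoice_of_finite h𝒞 hcl, fun w' hw' hA => hw ?_⟩
  obtain ⟨l, h1, h2⟩ := List.sublistForall₂_iff.1 hw'
  exact hspec w l h1 (hsub l w' h2 hA)

theorem Word.isClosedOp_append : IsClosedOp (Word.append (X := X)) where
  continuous := by
    rw [continuous_def]
    intro O hO
    rw [isOpen_prod_iff]
    intro u v huv
    obtain ⟨U, hU, hUO⟩ := Word.exists_nhd_subset hO huv
    refine ⟨Word.nhd U u, Word.nhd U v, Word.isOpen_nhd hU u, Word.isOpen_nhd hU v,
      Word.mem_nhd_self hU u, Word.mem_nhd_self hU v, ?_⟩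
    rintro ⟨u', v'⟩ ⟨hu', hv'⟩
    exact hUO (List.SublistForall₂.append hu' hv')
  isClosed := by
    intro A B
    rw [Word.isClosed_iff]
    intro w hw
    -- At every cut of `w` one of the two halves lies outside its closed set. There are finitely
    -- many cuts, and any factorization of a word above `w` induces one of them, so intersecting the
    -- neighbourhoods suffices.
    have key : ∀ n : Fin (w.letters.length + 1), ∃ U : X → Set X, IsNhdChoice U ∧
        ∀ u' v' : Word X, u' ∈ Word.nhd U (w.letters.take n) →
          v' ∈ Word.nhd U (w.letters.drop n) → ¬ (u' ∈ A ∧ v' ∈ B) := by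
      intro n
      by_cases hA : (w.letters.take n : Word X) ∈ A
      · by_cases hB : (w.letters.drop n : Word X) ∈ B
        · exact absurd ⟨_, hA, _, hB, List.take_append_drop _ _⟩ hw
        · obtain ⟨U, hU, h⟩ := Word.isClosed_iff.1 B.isClosed _ hB
          exact ⟨U, hU, fun u' v' _ hv' h' => h v' hv' h'.2⟩
      · obtain ⟨U, hU, h⟩ := Word.isClosed_iff.1 A.isClosed _ hA
        exact ⟨U, hU, fun u' v' hu' _ h' => h u' hu' h'.1⟩
    choose U hU hUA using key
    refine ⟨_, IsNhdChoice.iInter hU, ?_⟩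
    rintro _ hw' ⟨u', hu', v', hv', rfl⟩
    obtain ⟨n, h1, h2⟩ := List.SublistForall₂.exists_of_append hw'
    exact hUA n u' v' (h1.mono fun x y hy => Set.mem_iInter.1 hy n)
      (h2.mono fun x y hy => Set.mem_iInter.1 hy n) ⟨hu', hv'⟩

/-! ### Closed sets of words and the Noetherian property. -/

/-- The closed set of words over a closed set of letters. -/
def Word.over (F : Closeds X) : Closeds (Word X) where
  carrier := {w | ∀ x ∈ w.letters, x ∈ F}
  isClosed' := by
    refine Word.isClosed_of_finite (Set.finite_singleton (F : Set X))
      (by rintro _ rfl; exact F.isClosed) (fun w w' h hw' x hx => hw' x (h.subset hx)) ?_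
    intro w w' h hw' x hx
    obtain ⟨y, hy, hxy⟩ := h.exists_right hx
    exact hxy _ rfl (hw' y hy)

/-- The closed set of words with at most one letter, taken in a closed set of letters. -/
def Word.single (F : Closeds X) : Closeds (Word X) where
  carrier := {w | w.letters.length ≤ 1 ∧ ∀ x ∈ w.letters, x ∈ F}
  isClosed' := by
    refine Word.isClosed_of_finite (Set.finite_singleton (F : Set X))
      (by rintro _ rfl; exact F.isClosed)
      (fun w w' h hw' => ⟨h.length_le.trans hw'.1, fun x hx => hw'.2 x (h.subset hx)⟩) ?_
    refine fun w w' h hw' => ⟨h.length_eq.le.trans hw'.1, fun x hx => ?_⟩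
    obtain ⟨y, hy, hxy⟩ := h.exists_right hx
    exact hxy _ rfl (hw'.2 y hy)

theorem Word.mem_over {F : Closeds X} {w : Word X} : w ∈ Word.over F ↔ ∀ x ∈ w.letters, x ∈ F :=
  Iff.rfl

theorem Word.mem_single {F : Closeds X} {w : Word X} :
    w ∈ Word.single F ↔ w.letters.length ≤ 1 ∧ ∀ x ∈ w.letters, x ∈ F :=
  Iff.rfl

theorem Word.letter_mem_single {F : Closeds X} {x : X} :
    Word.letter x ∈ Word.single F ↔ x ∈ F := by
  simp [Word.mem_single]

theorem Word.continuous_letter : Continuous (Word.letter (X := X)) := by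
  rw [continuous_def]
  intro O hO
  rw [isOpen_iff_forall_mem_open]
  intro x hx
  obtain ⟨U, hU, hUO⟩ := Word.exists_nhd_subset hO hx
  exact ⟨U x, fun y hy => hUO (List.SublistForall₂.cons hy .nil), (hU x).1, (hU x).2⟩

/-- A non-empty closed set of words with at most one letter is determined by its letters. -/
theorem Word.eq_bot_or_eq_single {A : Closeds (Word X)} {F : Closeds X} (h : A ≤ Word.single F) :
    A = ⊥ ∨ ∃ G ≤ F, A = Word.single G := by
  rcases Set.eq_empty_or_nonempty (A : Set (Word X)) with h0 | ⟨w₀, hw₀⟩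
  · exact Or.inl (SetLike.coe_injective h0)
  · refine Or.inr ⟨⟨_, A.isClosed.preimage Word.continuous_letter⟩,
      fun x hx => Word.letter_mem_single.1 (h hx), le_antisymm ?_ ?_⟩
    · intro w hw
      refine ⟨(h hw).1, fun x hx => ?_⟩
      exact Word.mem_of_sublist A.isClosed (List.singleton_sublist.2 hx) hw
    · intro w hw
      obtain ⟨hlen, hmem⟩ := Word.mem_single.1 hw
      match w, hlen, hmem with
      | [], _, _ => exact Word.mem_of_sublist A.isClosed (List.nil_sublist _) hw₀
      | [x], _, hmem => exact hmem x (List.mem_singleton.2 rfl)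

theorem Word.single_mono {F G : Closeds X} (h : F ≤ G) : Word.single F ≤ Word.single G :=
  fun _ hw => ⟨hw.1, fun x hx => h (hw.2 x hx)⟩

/-- A closed set of words containing all words over `F` that avoid the subwords `x₁ ⋯ xₙ` with
`xᵢ` outside `Gᵢ`. -/
def Word.avoiding (F : Closeds X) : List (Closeds X) → Closeds (Word X)
  | [] => ⊥
  | G :: Gs => Word.over G ⊔
      closedImage Word.append (closedImage Word.append (Word.over G) (Word.single F))
        (Word.avoiding F Gs)

/-- Split `w'` at its first letter in `U x`, where `x` is the first letter of `w`: the prefix avoids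
`U x`, and the remainder must avoid the tail of `w`. -/
theorem Word.mem_avoiding {F : Closeds X} {U : X → Set X} (hU : IsNhdChoice U) (w : List X)
    {w' : List X} (hw' : (w' : Word X) ∈ Word.over F)
    (h : ¬ List.SublistForall₂ (fun x y => y ∈ U x) w w') :
    (w' : Word X) ∈ Word.avoiding F (w.map fun x => F ⊓ ⟨(U x)ᶜ, (hU x).1.isClosed_compl⟩) := by
  induction w generalizing w' with
  | nil => exact absurd .nil h
  | cons x w ihw =>
    induction w' with
    | nil => exact Or.inl fun y hy => absurd hy (List.not_mem_nil)
    | cons y w' ih =>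
      have hyF : y ∈ F := hw' y List.mem_cons_self
      have hw'F : (w' : Word X) ∈ Word.over F := fun z hz => hw' z (List.mem_cons_of_mem _ hz)
      by_cases hy : y ∈ U x
      · refine Or.inr ?_
        have h1 : ([] ++ [y] : List X) ∈ closedImage Word.append
            (Word.over (F ⊓ ⟨(U x)ᶜ, (hU x).1.isClosed_compl⟩)) (Word.single F) :=
          mem_closedImage (op := Word.append) (x := ([] : List X)) (y := ([y] : List X))
            (fun z hz => absurd hz List.not_mem_nil) (Word.letter_mem_single.2 hyF)
        exact mem_closedImage (op := Word.append) (x := ([y] : List X)) (y := w') h1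
          (ihw hw'F fun h' => h (.cons hy h'))
      · rcases ih hw'F fun h' => h (.cons_right h') with h' | h'
        · refine Or.inl fun z hz => ?_
          rcases List.mem_cons.1 hz with rfl | hz
          · exact ⟨hyF, hy⟩
          · exact h' z hz
        · refine Or.inr ?_
          obtain ⟨u, hu, v, hv, huv⟩ := Word.isClosedOp_append.mem_closedImage_iff.1 h'
          obtain ⟨p, hp, l, hl, rfl⟩ := Word.isClosedOp_append.mem_closedImage_iff.1 hu
          have hp' : (y :: p.letters : List X) ∈
              Word.over (F ⊓ ⟨(U x)ᶜ, (hU x).1.isClosed_compl⟩) := by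
            intro z hz
            rcases List.mem_cons.1 hz with rfl | hz
            · exact ⟨hyF, hy⟩
            · exact hp z hz
          have := mem_closedImage (op := Word.append) (mem_closedImage (op := Word.append) hp' hl)
            hv
          rw [← huv]
          exact this

/-- `A` misses a neighbourhood of some word over `F`. Each resulting `G` is `F` minus the
neighbourhood of a letter in `F`, hence strictly smaller. -/
theorem Word.exists_le_avoiding {A : Closeds (Word X)} {F : Closeds X} (h : A < Word.over F) :
    ∃ Gs : List (Closeds X), (∀ G ∈ Gs, G < F) ∧ A ≤ Word.avoiding F Gs := by
  obtain ⟨w, hwF, hwA⟩ := Set.exists_of_ssubset (SetLike.coe_ssubset_coe.2 h)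
  obtain ⟨U, hU, hUA⟩ := Word.isClosed_iff.1 A.isClosed w hwA
  refine ⟨_, ?_, fun w' hw' => Word.mem_avoiding hU w.letters (h.le hw') fun h' => hUA w' h' hw'⟩
  intro G hG
  obtain ⟨x, hx, rfl⟩ := List.mem_map.1 hG
  exact inf_lt_left.2 fun h' => h' (hwF x hx) (hU x).2

theorem acc_bot {L : Type u} [PartialOrder L] [OrderBot L] : Acc (· < ·) (⊥ : L) :=
  ⟨_, fun _ h => absurd h not_lt_bot⟩

theorem Word.acc_single {F : Closeds X} (hF : Acc (· < ·) F) : Acc (· < ·) (Word.single F) := by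
  induction hF with
  | intro F _ ih =>
  refine ⟨_, fun A hA => ?_⟩
  rcases Word.eq_bot_or_eq_single hA.le with rfl | ⟨G, hG, rfl⟩
  · exact acc_bot
  · refine ih G (lt_of_le_of_ne hG ?_)
    rintro rfl
    exact lt_irrefl _ hA

theorem Word.acc_over [NoetherianSpace X] (F : Closeds X) : Acc (· < ·) (Word.over F) := by
  induction F using WellFoundedLT.induction with
  | ind F ih =>
  have hav : ∀ Gs : List (Closeds X), (∀ G ∈ Gs, G < F) → Acc (· < ·) (Word.avoiding F Gs) := by
    intro Gs hGs
    induction Gs with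
    | nil => exact acc_bot
    | cons G Gs ihGs =>
      have hG := ih G (hGs G List.mem_cons_self)
      have hbox := (Word.isClosedOp_append (X := X)).isBoxMap
      exact acc_sup hG (hbox.acc (hbox.acc hG (Word.acc_single (wellFounded_lt.apply F)))
        (ihGs fun G hG => hGs G (List.mem_cons_of_mem _ hG)))
  refine ⟨_, fun A hA => ?_⟩
  obtain ⟨Gs, hGs, hle⟩ := Word.exists_le_avoiding hA
  exact acc_of_le hle (hav Gs hGs)

theorem Word.over_top : Word.over (⊤ : Closeds X) = ⊤ :=
  top_le_iff.1 fun _ _ _ _ => trivial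

/-- The topological Higman lemma. -/
instance Word.noetherianSpace [NoetherianSpace X] : NoetherianSpace (Word X) := by
  have h : WellFoundedLT (Closeds (Word X)) := ⟨⟨fun A => ?_⟩⟩
  · exact ((noetherianSpace_TFAE (Word X)).out 0 1).2 h
  exact acc_of_le le_top (Word.over_top (X := X) ▸ Word.acc_over ⊤)

/-! ### The stature of spaces of words: upper bound -/

section WordStature

theorem wfRank_bot {L : Type u} [PartialOrder L] [OrderBot L] [WellFoundedLT L] :
    wfRank (⊥ : L) = 0 := by
  rw [← nonpos_iff_eq_zero, wfRank_le_iff]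
  exact fun b hb => absurd hb not_lt_bot

theorem wfRank_pos_iff {L : Type u} [PartialOrder L] [OrderBot L] [WellFoundedLT L] {a : L} :
    1 ≤ wfRank a ↔ a ≠ ⊥ := by
  rw [Order.one_le_iff_pos]
  constructor
  · rintro h rfl
    exact h.ne' wfRank_bot
  · intro h
    rw [← wfRank_bot (L := L)]
    exact wfRank_lt (bot_lt_iff_ne_bot.2 h)

theorem wfRank_sup_le {L : Type u} [DistribLattice L] [OrderBot L] [WellFoundedLT L] (A B : L) :
    wfRank (A ⊔ B) ≤ nadd (wfRank A) (wfRank B) := by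
  simpa [relRank_bot] using relRank_sup_le (D := (⊥ : L)) (A := A) (B := B)

theorem exists_wfRank_eq {L : Type u} [Lattice L] [OrderBot L] [WellFoundedLT L] {A : L}
    {o : Ordinal.{u}} (ho : o < wfRank A) : ∃ E < A, wfRank E = o := by
  obtain ⟨E, -, hE, h⟩ := exists_relRank_eq (o := o) (bot_le : ⊥ ≤ A)
    (by rw [relRank_bot]; exact ho.le)
  rw [relRank_bot] at h
  refine ⟨E, lt_of_le_of_ne hE ?_, h⟩
  rintro rfl
  exact ho.ne' h

variable {X : Type u} [TopologicalSpace X] [NoetherianSpace X]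

/-- The extra 1 accounts for the empty word, which belongs to `Word.single F` even when `F` is
empty. -/
theorem Word.wfRank_single_le (F : Closeds X) : wfRank (Word.single F) ≤ wfRank F + 1 := by
  induction F using WellFoundedLT.induction with
  | ind F ih =>
  rw [wfRank_le_iff]
  intro A hA
  rcases Word.eq_bot_or_eq_single hA.le with rfl | ⟨G, hG, rfl⟩
  · rw [wfRank_bot]
    exact Order.lt_add_one_iff.2 zero_le
  · have hGF : G < F := by
      refine lt_of_le_of_ne hG ?_
      rintro rfl
      exact lt_irrefl _ hA
    refine (ih G hGF).trans_lt ?_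
    rw [Order.lt_add_one_iff]
    exact Order.add_one_le_of_lt (wfRank_lt hGF)

theorem Word.wfRank_avoiding_lt {F : Closeds X} {d : Ordinal.{u}}
    (hF : wfRank F + 1 < ω ^ (ω : Ordinal.{u}) ^ d) (Gs : List (Closeds X))
    (hGs : ∀ G ∈ Gs, wfRank (Word.over G) < ω ^ (ω : Ordinal.{u}) ^ d) :
    wfRank (Word.avoiding F Gs) < ω ^ (ω : Ordinal.{u}) ^ d := by
  induction Gs with
  | nil =>
    rw [Word.avoiding, wfRank_bot]
    exact Ordinal.opow_pos _ Ordinal.omega0_pos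
  | cons G Gs ih =>
    have hG := hGs G List.mem_cons_self
    have hbox := (Word.isClosedOp_append (X := X)).isBoxMap
    refine (wfRank_sup_le _ _).trans_lt (nadd_lt_opow hG ?_)
    refine hbox.wfRank_lt_opow_opow closedImage_bot_left closedImage_bot_right ?_
      (ih fun G hG => hGs G (List.mem_cons_of_mem _ hG))
    exact hbox.wfRank_lt_opow_opow closedImage_bot_left closedImage_bot_right hG
      ((Word.wfRank_single_le F).trans_lt hF)

theorem Word.wfRank_over_bot_le : wfRank (Word.over (⊥ : Closeds X)) ≤ 1 := by
  rw [wfRank_le_iff]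
  intro A hA
  obtain ⟨Gs, hGs, hle⟩ := Word.exists_le_avoiding hA
  match Gs, hGs, hle with
  | [], _, hle =>
    rw [le_bot_iff.1 hle, wfRank_bot]
    exact zero_lt_one
  | G :: _, hGs, _ => exact absurd (hGs G List.mem_cons_self) not_lt_bot

theorem add_one_lt_opow_opow {x d : Ordinal.{u}} (h : x < ω ^ (ω : Ordinal.{u}) ^ d) :
    x + 1 < ω ^ (ω : Ordinal.{u}) ^ d :=
  Ordinal.isPrincipal_add_omega0_opow _ h
    (Ordinal.one_lt_opow.2 ⟨Ordinal.one_lt_omega0, (Ordinal.opow_pos _ Ordinal.omega0_pos).ne'⟩)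

/-- `A` lies in a union of concatenations built from words over some `G < F`. By induction these
have rank below the bound, which unions and boxes do not exceed. The empty `G` is treated apart
because the adjusted exponent is not strictly increasing at 0. -/
theorem Word.wfRank_lt_of_lt_over {F : Closeds X} {A : Closeds (Word X)} (h : A < Word.over F) :
    wfRank A < ω ^ (ω : Ordinal.{u}) ^ adjustedExponent (wfRank F) := by
  induction F using WellFoundedLT.induction generalizing A with
  | ind F ih =>
  obtain ⟨Gs, hGs, hle⟩ := Word.exists_le_avoiding h
  refine (wfRank_mono hle).trans_lt (Word.wfRank_avoiding_lt
    (add_one_lt_opow_opow (lt_opow_opow_adjustedExponent _)) Gs fun G hG => ?_)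
  have hGF := hGs G hG
  rcases eq_or_ne G ⊥ with rfl | hG0
  · refine Word.wfRank_over_bot_le.trans_lt ?_
    exact Ordinal.one_lt_opow.2
      ⟨Ordinal.one_lt_omega0, (Ordinal.opow_pos _ Ordinal.omega0_pos).ne'⟩
  · have hle : wfRank (Word.over G) ≤ ω ^ (ω : Ordinal.{u}) ^ adjustedExponent (wfRank G) :=
      wfRank_le_iff.2 fun B hB => ih G hGF hB
    exact hle.trans_lt (opow_lt_opow_omega0.2 (opow_lt_opow_omega0.2
      (adjustedExponent_lt (wfRank_pos_iff.2 hG0) (wfRank_lt hGF))))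

/-- Here concatenation contributes only Hessenberg sums, so a single exponential suffices where the
stature needs a double one. -/
theorem Word.wfRank_irreducible_le {F : Closeds X} (A : IrreducibleCloseds (Word X))
    (h : A.toClosed ≤ Word.over F) : wfRank A ≤ ω ^ (wfRank F + 1) := by
  induction F using WellFoundedLT.induction generalizing A with
  | ind F ih =>
  have key : ∀ B : IrreducibleCloseds (Word X), B.toClosed < Word.over F →
      wfRank B < ω ^ (wfRank F + 1) := by
    intro B hB
    obtain ⟨Gs, hGs, hle⟩ := Word.exists_le_avoiding hB
    have hsingle : ∀ C : IrreducibleCloseds (Word X), C.toClosed ≤ Word.single F →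
        wfRank C < ω ^ (wfRank F + 1) := by
      intro C hC
      calc wfRank C ≤ wfRank (Word.single F) :=
            (_root_.wfRank_irreducible_le C).trans (wfRank_mono hC)
        _ ≤ wfRank F + 1 := Word.wfRank_single_le F
        _ ≤ ω ^ wfRank F * 1 + 1 := by
            rw [mul_one]
            gcongr
            exact Ordinal.right_le_opow _ Ordinal.one_lt_omega0
        _ ≤ ω ^ wfRank F * 2 := by
            rw [← one_add_one_eq_two, mul_add, mul_one]
            gcongr
            rw [Order.one_le_iff_pos]
            exact Ordinal.opow_pos _ Ordinal.omega0_pos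
        _ < ω ^ (wfRank F + 1) := Ordinal.opow_mul_lt_opow
            (by exact_mod_cast Ordinal.natCast_lt_omega0 2) (lt_add_one _)
    have hav : ∀ Gs : List (Closeds X), (∀ G ∈ Gs, G < F) →
        ∀ C : IrreducibleCloseds (Word X), C.toClosed ≤ Word.avoiding F Gs →
        wfRank C < ω ^ (wfRank F + 1) := by
      intro Gs hGs
      induction Gs with
      | nil =>
        intro C hC
        obtain ⟨w, hw⟩ := C.isIrreducible.nonempty
        exact absurd (hC hw) (Set.notMem_empty w)
      | cons G Gs ihGs =>
        have hGF := hGs G List.mem_cons_self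
        have hG : ∀ C : IrreducibleCloseds (Word X), C.toClosed ≤ Word.over G →
            wfRank C < ω ^ (wfRank F + 1) := fun C hC => (ih G hGF C hC).trans_lt
          (opow_lt_opow_omega0.2 (Order.lt_add_one_iff.2 (Order.add_one_le_of_lt (wfRank_lt hGF))))
        intro C hC
        rcases le_or_le_of_isIrreducible C.isIrreducible hC with hC | hC
        · exact hG C hC
        · exact Word.isClosedOp_append.wfRank_lt_opow
            (Word.isClosedOp_append.wfRank_lt_opow hG hsingle)
            (ihGs fun G hG => hGs G (List.mem_cons_of_mem _ hG)) C hC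
    exact hav Gs hGs B hle
  rw [wfRank_le_iff]
  intro B hB
  exact key B ((IrreducibleCloseds.toClosed_lt.2 hB).trans_le h)

end WordStature

/-! ### The stature of spaces of words: lower bound -/

/-- A lexicographic chain: the ordinal with quotient `q` and remainder `r` is realized by `c X G ⊔ c
A K`, with `G` of relative rank `q` and `A` of relative rank `r`. -/
theorem mul_relRank_le {L₁ L₂ L : Type u} [Lattice L₁] [Lattice L₂] [Lattice L]
    [WellFoundedLT L₁] [WellFoundedLT L₂] [WellFoundedLT L] {c : L₁ → L₂ → L} {D₁ X : L₁}
    {D₂ K : L₂} (hX : D₁ ≤ X) (hK : D₂ ≤ K)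
    (hmono : ∀ {F F' G G'}, F ≤ F' → G ≤ G' → c F G ≤ c F' G')
    (hstrict : ∀ G G', D₂ ≤ G → G < G' → G' ≤ K → ∀ A A', D₁ ≤ A → A < A' → A' ≤ X →
      c X G ⊔ c A G' < c X G ⊔ c A' G') :
    relRank D₁ X * relRank D₂ K ≤ relRank (c X D₂) (c X K) := by
  induction K using WellFoundedLT.induction with
  | ind K ih =>
  apply le_of_forall_lt
  intro x hx
  obtain ⟨q, hq, r, hr, rfl⟩ := exists_eq_mul_add_of_lt hx
  obtain ⟨G, hG, hGK, rfl⟩ := exists_relRank_eq hK hq.le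
  obtain ⟨A, hA, hAX, rfl⟩ := exists_relRank_eq hX hr.le
  have hGK' : G < K := lt_of_le_of_ne hGK (by rintro rfl; exact lt_irrefl _ hq)
  have hAX' : A < X := lt_of_le_of_ne hAX (by rintro rfl; exact lt_irrefl _ hr)
  have h1 := ih G hGK' hG fun H H' h h' h'' => hstrict H H' h h' (h''.trans hGK)
  have h2 : relRank D₁ A ≤ relRank (c X G) (c X G ⊔ c A K) :=
    relRank_le_of_strictMonoOn hA (fun A => relRank (c X G) (c X G ⊔ c A K))
      fun B C hB hBC hC => relRank_lt_of_le le_sup_left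
        (hstrict G K hG hGK' le_rfl B C hB hBC (hC.trans hAX))
  calc relRank D₁ X * relRank D₂ G + relRank D₁ A
      ≤ relRank (c X D₂) (c X G) + relRank (c X G) (c X G ⊔ c A K) := add_le_add h1 h2
    _ ≤ relRank (c X D₂) (c X G ⊔ c A K) := relRank_add_relRank_le (hmono le_rfl hG) le_sup_left
    _ < relRank (c X D₂) (c X G ⊔ c X K) := relRank_lt_of_le
        ((hmono le_rfl hG).trans le_sup_left) (hstrict G K hG hGK' le_rfl A X hA hAX' le_rfl)
    _ ≤ relRank (c X D₂) (c X K) := relRank_mono (sup_le (hmono le_rfl hGK) le_rfl)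

/-! ### Counting the letters outside a smaller closed set. -/

section WordStature

variable {X : Type u} [TopologicalSpace X]

open scoped Classical in
/-- The number of letters of a word outside a closed set. -/
def Word.defect (G : Closeds X) (w : Word X) : ℕ := w.letters.countP fun x => x ∉ G

theorem Word.defect_append (G : Closeds X) (u v : Word X) :
    Word.defect G (u.append v) = Word.defect G u + Word.defect G v :=
  List.countP_append

theorem Word.defect_eq_zero {G : Closeds X} {w : Word X} :
    Word.defect G w = 0 ↔ w ∈ Word.over G := by
  simp [Word.defect, List.countP_eq_zero, Word.mem_over]

theorem Word.defect_le_length (G : Closeds X) (w : Word X) :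
    Word.defect G w ≤ w.letters.length :=
  List.countP_le_length

/-- The words over `F` with less than `n` letters outside `G`. -/
def Word.defectLT (F G : Closeds X) (n : ℕ) : Closeds (Word X) where
  carrier := {w | w ∈ Word.over F ∧ Word.defect G w < n}
  isClosed' := by
    refine (Word.over F).isClosed.inter (Word.isClosed_of_finite (Set.finite_singleton (G : Set X))
      (by rintro _ rfl; exact G.isClosed) (A := {w | Word.defect G w < n}) (fun w w' h hw' =>
        lt_of_le_of_lt (b := Word.defect G w') h.countP_le hw') ?_)
    intro w w' h hw'
    refine lt_of_le_of_lt (b := Word.defect G w') ?_ hw'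
    unfold Word.defect
    generalize w.letters = l at h
    generalize w'.letters = l' at h
    induction h with
    | nil => simp
    | @cons x y l l' hxy _ ih =>
      have hxy' : y ∈ G → x ∈ G := hxy _ rfl
      by_cases hx : x ∈ G
      · rw [List.countP_cons_of_neg (by simpa using hx)]
        exact ih.trans (List.sublist_cons_self _ _).countP_le
      · rw [List.countP_cons_of_pos (by simpa using hx),
          List.countP_cons_of_pos (by simpa using fun h => hx (hxy' h))]
        omega

theorem Word.defectLT_zero (F G : Closeds X) : Word.defectLT F G 0 = ⊥ :=
  le_bot_iff.1 fun _ hw => absurd hw.2 (Nat.not_lt_zero _)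

theorem Word.defectLT_mono (F G : Closeds X) {m n : ℕ} (h : m ≤ n) :
    Word.defectLT F G m ≤ Word.defectLT F G n :=
  fun _ hw => ⟨hw.1, hw.2.trans_le h⟩

/-- The words over `F` whose letters after the first one are all in `G`. -/
def Word.block (F G : Closeds X) : Closeds (Word X) :=
  closedImage Word.append (Word.single F) (Word.over G)

theorem Word.over_le_block (F G : Closeds X) : Word.over G ≤ Word.block F G := fun w hw =>
  mem_closedImage (op := Word.append) (x := ([] : List X)) (y := w)
    (Word.mem_single.2 ⟨Nat.zero_le _, fun _ h => absurd h List.not_mem_nil⟩) hw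

theorem Word.mem_block {F G : Closeds X} {w : Word X} (hw : w ∈ Word.block F G) :
    w ∈ Word.over G ∨ ∃ x ∈ F, x ∉ G ∧ ∃ v ∈ Word.over G, w.letters = x :: v.letters := by
  obtain ⟨l, hl, v, hv, rfl⟩ := Word.isClosedOp_append.mem_closedImage_iff.1 hw
  match l, hl with
  | [], _ => exact Or.inl hv
  | [x], hl =>
    by_cases hx : x ∈ G
    · left
      intro y hy
      rcases List.mem_cons.1 hy with rfl | hy
      · exact hx
      · exact hv y hy
    · exact Or.inr ⟨x, Word.letter_mem_single.1 hl, hx, v, hv, rfl⟩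
  | _ :: _ :: _, hl => exact absurd hl.1 (by simp [Word.letters])

theorem List.append_cons_inj_of_forall {α : Type u} {p : α → Prop} {u u' v v' : List α} {x x' : α}
    (hx : ¬ p x) (hx' : ¬ p x') (hv : ∀ y ∈ v, p y) (hv' : ∀ y ∈ v', p y)
    (h : u ++ x :: v = u' ++ x' :: v') : u = u' ∧ x :: v = x' :: v' := by
  rcases List.append_eq_append_iff.1 h with ⟨a, rfl, ha⟩ | ⟨a, rfl, ha⟩
  · cases a with
    | nil => exact ⟨by simp, ha⟩
    | cons b a =>
      obtain ⟨rfl, rfl⟩ := List.cons_eq_cons.1 ha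
      exact absurd (hv x' (by simp)) hx'
  · cases a with
    | nil => exact ⟨by simp, ha.symm⟩
    | cons b a =>
      obtain ⟨rfl, rfl⟩ := List.cons_eq_cons.1 ha
      exact absurd (hv' x (by simp)) hx

/-- The last letter outside `G` marks where the block begins. The bound on the defect of `u'`
excludes the case of a block `k'` entirely over `G`. -/
theorem Word.append_injective_of_defect {F G : Closeds X} {n : ℕ} {u u' k k' : Word X}
    (hu : Word.defect G u = n) (hu' : Word.defect G u' ≤ n) (hk : k ∈ Word.block F G)
    (hk' : k' ∈ Word.block F G) (hkG : k ∉ Word.over G) (h : u.append k = u'.append k') :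
    u = u' ∧ k = k' := by
  obtain hk | ⟨x, -, hx, v, hv, hkx⟩ := Word.mem_block hk
  · exact absurd hk hkG
  have hdef := congrArg (Word.defect G) h
  rw [Word.defect_append, Word.defect_append] at hdef
  have hk0 : Word.defect G k ≠ 0 := fun h => hkG (Word.defect_eq_zero.1 h)
  obtain hk' | ⟨x', -, hx', v', hv', hkx'⟩ := Word.mem_block hk'
  · rw [Word.defect_eq_zero.2 hk'] at hdef
    omega
  · have h' : u.letters ++ k.letters = u'.letters ++ k'.letters := h
    rw [hkx, hkx'] at h'
    obtain ⟨h1, h2⟩ := List.append_cons_inj_of_forall (p := (· ∈ G)) hx hx' hv hv' h'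
    exact ⟨h1, hkx.trans (h2.trans hkx'.symm)⟩

variable [NoetherianSpace X]

/-- Appending a block to a word with exactly `n` letters outside `G` is a unique factorization, so
each layer of the filtration by defect contains the lexicographic product of the previous layer and
the block. -/
theorem Word.pow_le_relRank_defectLT {F G : Closeds X} (hGF : G ≤ F) (n : ℕ) :
    relRank (Word.over G) (Word.block F G) ^ n ≤
      relRank (Word.defectLT F G n) (Word.defectLT F G (n + 1)) := by
  induction n with
  | zero =>
    rw [pow_zero, Order.one_le_iff_pos]
    apply relRank_pos
    rw [Word.defectLT_zero, bot_lt_iff_ne_bot]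
    intro h
    have h0 : ([] : List X) ∈ Word.defectLT F G (0 + 1) :=
      ⟨fun _ h => absurd h List.not_mem_nil, by simp [Word.defect, Word.letters]⟩
    rw [h] at h0
    exact absurd h0 (Set.notMem_empty _)
  | succ n ih =>
    have key := mul_relRank_le (c := closedImage Word.append) (D₁ := Word.defectLT F G n)
      (X := Word.defectLT F G (n + 1)) (D₂ := Word.over G) (K := Word.block F G)
      (Word.defectLT_mono F G n.le_succ) (Word.over_le_block F G) closedImage_mono ?_
    · rw [pow_succ]
      refine (mul_le_mul_left ih _).trans (key.trans ?_)
      have h1 : closedImage Word.append (Word.defectLT F G (n + 1)) (Word.over G) =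
          Word.defectLT F G (n + 1) := by
        apply le_antisymm
        · refine closedImage_le.2 fun u hu v hv => ⟨fun x hx => ?_, ?_⟩
          · rcases List.mem_append.1 hx with hx | hx
            · exact hu.1 x hx
            · exact hGF (hv x hx)
          · rw [Word.defect_append, Word.defect_eq_zero.2 hv]
            exact hu.2
        · intro u hu
          rw [show u = u.append ([] : List X) from (List.append_nil _).symm]
          exact mem_closedImage hu fun _ h => absurd h List.not_mem_nil
      rw [h1]
      refine relRank_mono (closedImage_le.2 fun u hu v hv => ⟨fun x hx => ?_, ?_⟩)
      · rcases List.mem_append.1 hx with hx | hx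
        · exact hu.1 x hx
        · obtain ⟨l, hl, p, hp, rfl⟩ := Word.isClosedOp_append.mem_closedImage_iff.1 hv
          rcases List.mem_append.1 hx with hx | hx
          · exact hl.2 x hx
          · exact hGF (hp x hx)
      · obtain ⟨l, hl, p, hp, rfl⟩ := Word.isClosedOp_append.mem_closedImage_iff.1 hv
        have h1 := (Word.defect_le_length G l).trans hl.1
        have h2 := hu.2
        rw [Word.defect_append, Word.defect_append, Word.defect_eq_zero.2 hp]
        omega
    · intro K K' hK hKK' hK' A A' hA hAA' hA'
      refine lt_of_le_of_ne (sup_le_sup_left (closedImage_mono hAA'.le le_rfl) _) ?_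
      intro heq
      obtain ⟨u, huA', huA⟩ := Set.exists_of_ssubset (SetLike.coe_ssubset_coe.2 hAA')
      obtain ⟨k, hkK', hkK⟩ := Set.exists_of_ssubset (SetLike.coe_ssubset_coe.2 hKK')
      have hu : Word.defect G u = n := by
        have h1 : Word.defect G u < n + 1 := (hA' huA').2
        have h2 : ¬ Word.defect G u < n := fun h => huA (hA ⟨(hA' huA').1, h⟩)
        omega
      have hkG : k ∉ Word.over G := fun h => hkK (hK h)
      have hmem : u.append k ∈ closedImage Word.append (Word.defectLT F G (n + 1)) K ⊔
          closedImage Word.append A K' := by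
        rw [heq]
        exact Or.inr (mem_closedImage huA' hkK')
      rcases hmem with hmem | hmem
      · obtain ⟨u', hu', k', hk', h⟩ := Word.isClosedOp_append.mem_closedImage_iff.1 hmem
        obtain ⟨-, rfl⟩ := Word.append_injective_of_defect hu (Nat.lt_succ_iff.1 hu'.2)
          (hK' hkK') (hK' (hKK'.le hk')) hkG h.symm
        exact hkK hk'
      · obtain ⟨u', hu', k', hk', h⟩ := Word.isClosedOp_append.mem_closedImage_iff.1 hmem
        obtain ⟨rfl, -⟩ := Word.append_injective_of_defect hu
          (Nat.lt_succ_iff.1 (hA' (hAA'.le hu')).2) (hK' hkK') (hK' hk') hkG h.symm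
        exact huA hu'

theorem Word.wfRank_defectLT_add_pow_le {F G : Closeds X} (hGF : G ≤ F) (n : ℕ) :
    wfRank (Word.defectLT F G n) + relRank (Word.over G) (Word.block F G) ^ n ≤
      wfRank (Word.defectLT F G (n + 1)) := by
  have h := relRank_add_relRank_le (bot_le : ⊥ ≤ Word.defectLT F G n)
    (Word.defectLT_mono F G n.le_succ)
  rw [relRank_bot, relRank_bot] at h
  exact (add_le_add le_rfl (Word.pow_le_relRank_defectLT hGF n)).trans h

theorem Word.pow_le_wfRank_over {F G : Closeds X} (hGF : G ≤ F) (n : ℕ) :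
    relRank (Word.over G) (Word.block F G) ^ n ≤ wfRank (Word.over F) :=
  le_add_self.trans ((Word.wfRank_defectLT_add_pow_le hGF n).trans
    (wfRank_mono fun _ h => h.1))

theorem Word.wfRank_le_relRank_block_bot (F : Closeds X) :
    wfRank F ≤ relRank (Word.over ⊥) (Word.block F ⊥) := by
  refine wfRank_le_of_strictMonoOn (fun F => relRank (Word.over ⊥) (Word.block F ⊥)) F ?_
  intro F F' h _
  refine relRank_lt_of_le (Word.over_le_block F ⊥) (lt_of_le_of_ne
    (closedImage_mono (Word.single_mono h.le) le_rfl) fun heq => ?_)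
  obtain ⟨x, hx', hx⟩ := Set.exists_of_ssubset (SetLike.coe_ssubset_coe.2 h)
  have hmem : Word.letter x ∈ Word.block F ⊥ := by
    rw [heq]
    exact mem_closedImage (op := Word.append) (x := Word.letter x) (y := ([] : List X))
      (Word.letter_mem_single.2 hx') fun _ h => absurd h List.not_mem_nil
  rcases Word.mem_block hmem with h | ⟨y, hy, -, v, -, h⟩
  · exact absurd (h x (List.mem_singleton.2 rfl)) (Set.notMem_empty x)
  · obtain ⟨rfl, -⟩ := List.cons_eq_cons.1 h
    exact hx hy

/-- Prefixing a letter of `F` outside `G` embeds the closed sets of words over `G` strictly above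
`Word.over G`. -/
theorem Word.wfRank_over_le_relRank_block {F G : Closeds X} (h : G < F) :
    wfRank (Word.over G) ≤ relRank (Word.over G) (Word.block F G) := by
  obtain ⟨x, hxF, hxG⟩ := Set.exists_of_ssubset (SetLike.coe_ssubset_coe.2 h)
  refine wfRank_le_of_strictMonoOn
    (fun K => relRank (Word.over G) (closedImage Word.append (Word.single F) K)) (Word.over G) ?_
  intro K K' hKK' hK'
  refine relRank_lt (lt_of_le_of_ne (sup_le_sup_left (closedImage_mono le_rfl hKK'.le) _)
    fun heq => ?_)
  obtain ⟨v, hv', hv⟩ := Set.exists_of_ssubset (SetLike.coe_ssubset_coe.2 hKK')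
  have hmem : (Word.letter x).append v ∈
      Word.over G ⊔ closedImage Word.append (Word.single F) K := by
    rw [heq]
    exact Or.inr (mem_closedImage (Word.letter_mem_single.2 hxF) hv')
  rcases hmem with hmem | hmem
  · exact hxG (hmem x List.mem_cons_self)
  · obtain ⟨l, hl, k, hk, hlk⟩ := Word.isClosedOp_append.mem_closedImage_iff.1 hmem
    match l, hl with
    | [], _ =>
      have : x ∈ k.letters := by
        rw [show k.letters = x :: v.letters from hlk]
        exact List.mem_cons_self
      exact hxG (hK' (hKK'.le hk) x this)
    | [y], _ =>
      have h2 : y :: k.letters = x :: v.letters := hlk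
      obtain ⟨-, h2⟩ := List.cons_eq_cons.1 h2
      have h3 : k = v := h2
      exact hv (h3 ▸ hk)
    | _ :: _ :: _, hl => exact absurd hl.1 (by simp [Word.letters])

theorem Word.omega0_le_wfRank_over {F : Closeds X} (h : F ≠ ⊥) : ω ≤ wfRank (Word.over F) := by
  rw [Ordinal.omega0_le]
  intro n
  have key : (n : Ordinal.{u}) ≤ wfRank (Word.defectLT F ⊥ n) := by
    induction n with
    | zero => simp
    | succ n ih =>
      push_cast
      refine (add_le_add ih ?_).trans (Word.wfRank_defectLT_add_pow_le bot_le n)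
      exact one_le_pow₀ ((wfRank_pos_iff.2 h).trans (Word.wfRank_le_relRank_block_bot F))
  exact key.trans (wfRank_mono fun _ h => h.1)

/-- Blocks over `⊥` supply the powers of ‖F‖; blocks over a closed `G < F` of prescribed rank supply
the powers of the bound known for `G`. -/
theorem Word.le_wfRank_over {F : Closeds X} (h : F ≠ ⊥) :
    ω ^ (ω : Ordinal.{u}) ^ adjustedExponent (wfRank F) ≤ wfRank (Word.over F) := by
  induction F using WellFoundedLT.induction with
  | ind F ih =>
  refine opow_opow_adjustedExponent_le (wfRank_pos_iff.2 h) (Word.omega0_le_wfRank_over h)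
    (fun k => ?_) fun γ hγ1 hγ k => ?_
  · exact (pow_le_pow_left' (Word.wfRank_le_relRank_block_bot F) k).trans
      (Word.pow_le_wfRank_over bot_le k)
  · obtain ⟨G, hG, rfl⟩ := exists_wfRank_eq hγ
    exact (pow_le_pow_left' ((ih G hG (wfRank_pos_iff.1 hγ1)).trans
      (Word.wfRank_over_le_relRank_block hG)) k).trans (Word.pow_le_wfRank_over hG.le k)

theorem Word.stature_eq (h : stature X ≠ 0) :
    stature (Word X) = ω ^ (ω : Ordinal.{u}) ^ adjustedExponent (stature X) := by
  have h0 : (⊤ : Closeds X) ≠ ⊥ := by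
    intro h'
    apply h
    change wfRank (⊤ : Closeds X) = 0
    rw [h', wfRank_bot]
  change wfRank (⊤ : Closeds (Word X)) = _ ^ _ ^ adjustedExponent (wfRank (⊤ : Closeds X))
  rw [← Word.over_top]
  exact le_antisymm (wfRank_le_iff.2 fun A hA => Word.wfRank_lt_of_lt_over hA)
    (Word.le_wfRank_over h0)

end WordStature

/-! ### Relations between multisets -/

section MultisetRel

variable {α β γ : Type u}

theorem Multiset.Rel.comp_of_mem {r : α → β → Prop} {p : β → γ → Prop} {q : α → γ → Prop}
    {s : Multiset α} {t : Multiset β} {v : Multiset γ} (hst : Multiset.Rel r s t)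
    (htv : Multiset.Rel p t v) (h : ∀ a ∈ s, ∀ b ∈ t, ∀ c ∈ v, r a b → p b c → q a c) :
    Multiset.Rel q s v := by
  induction hst generalizing v with
  | zero => rw [Multiset.rel_zero_left.1 htv]; exact .zero
  | cons hab _ ih =>
    obtain ⟨c, v', hc, hv', rfl⟩ := Multiset.rel_cons_left.1 htv
    refine .cons (h _ (Multiset.mem_cons_self _ _) _ (Multiset.mem_cons_self _ _) _
      (Multiset.mem_cons_self _ _) hab hc) (ih hv' fun a ha b hb c hc => ?_)
    exact h a (Multiset.mem_cons_of_mem ha) b (Multiset.mem_cons_of_mem hb) c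
      (Multiset.mem_cons_of_mem hc)

theorem Multiset.Rel.exists_le_left {r : α → β → Prop} {s s' : Multiset α} {t : Multiset β}
    (h : Multiset.Rel r s t) (hs : s' ≤ s) : ∃ t' ≤ t, Multiset.Rel r s' t' := by
  obtain ⟨s'', rfl⟩ := Multiset.le_iff_exists_add.1 hs
  obtain ⟨t', t'', h', -, rfl⟩ := Multiset.rel_add_left.1 h
  exact ⟨t', Multiset.le_add_right _ _, h'⟩

theorem Multiset.Rel.exists_list {r : α → β → Prop} {l : List α} {t : Multiset β}
    (h : Multiset.Rel r (l : Multiset α) t) :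
    ∃ l' : List β, (l' : Multiset β) = t ∧ List.Forall₂ r l l' := by
  induction l generalizing t with
  | nil =>
    rw [Multiset.coe_nil, Multiset.rel_zero_left] at h
    exact ⟨[], h.symm, .nil⟩
  | cons a l ih =>
    rw [← Multiset.cons_coe, Multiset.rel_cons_left] at h
    obtain ⟨b, t', hb, ht', rfl⟩ := h
    obtain ⟨l', rfl, hl'⟩ := ih ht'
    exact ⟨b :: l', rfl, .cons hb hl'⟩

theorem Multiset.rel_coe_of_forall₂ {r : α → β → Prop} {l : List α} {l' : List β}
    (h : List.Forall₂ r l l') : Multiset.Rel r (l : Multiset α) (l' : Multiset β) := by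
  induction h with
  | nil => exact .zero
  | cons h _ ih => exact .cons h ih

theorem Multiset.exists_add_of_le_add {m a b : Multiset α} (h : m ≤ a + b) :
    ∃ a' ≤ a, ∃ b' ≤ b, m = a' + b' := by
  classical
  exact ⟨m - b, Multiset.sub_le_iff_le_add.2 h, m ∩ b, Multiset.inter_le_right,
    (Multiset.sub_add_inter m b).symm⟩

end MultisetRel

/-! ### The topology on finite multisets -/

namespace FinMultiset

variable {X : Type u}

/-- The underlying multiset. -/
def letters (m : FinMultiset X) : Multiset X := m

/-- The multisets above one obtained from `m` by replacing each element `x` by an element of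
`U x`. -/
def nhd (U : X → Set X) (m : FinMultiset X) : Set (FinMultiset X) :=
  {m' | ∃ m'' ≤ m'.letters, Multiset.Rel (fun x y => y ∈ U x) m.letters m''}

/-- A greedy matching: each choice uses up one candidate, and every element of `m` has at least as
many candidates as `m` has elements. -/
theorem mem_nhd_of_card_le {U : X → Set X} (m : Multiset X) (m' : Multiset X)
    (h : ∀ x ∈ m, ∃ k ≤ m', (∀ y ∈ k, y ∈ U x) ∧ m.card ≤ k.card) :
    (m' : FinMultiset X) ∈ nhd U m := by
  induction m using Multiset.induction_on generalizing m' with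
  | empty => exact ⟨0, Multiset.zero_le _, .zero⟩
  | cons x m ih =>
    classical
    obtain ⟨k, hk, hkU, hcard⟩ := h x (Multiset.mem_cons_self x m)
    obtain ⟨y, hy⟩ : ∃ y, y ∈ k := by
      apply Multiset.card_pos_iff_exists_mem.1
      rw [Multiset.card_cons] at hcard
      omega
    have hym' : y ∈ m' := Multiset.mem_of_le hk hy
    obtain ⟨m'', hm'', hrel⟩ := ih (m'.erase y) fun x' hx' => by
      obtain ⟨k, hk, hkU, hcard⟩ := h x' (Multiset.mem_cons_of_mem hx')
      refine ⟨k.erase y, Multiset.erase_le_erase y hk,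
        fun z hz => hkU z (Multiset.mem_of_mem_erase hz), ?_⟩
      rw [Multiset.card_cons] at hcard
      have := Multiset.card_le_card (Multiset.erase_le_iff_le_cons.1 (le_refl (k.erase y)))
      rw [Multiset.card_cons] at this
      omega
    refine ⟨y ::ₘ m'', ?_, .cons (hkU y hy) hrel⟩
    rw [← Multiset.cons_erase hym']
    exact Multiset.cons_le_cons y hm''

/-- The sum of two multisets. -/
def add (m n : FinMultiset X) : FinMultiset X := m.letters + n.letters

@[simp]
theorem letters_add (m n : FinMultiset X) : (m.add n).letters = m.letters + n.letters := rfl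

/-- The multiset with one element. -/
def letter (x : X) : FinMultiset X := ({x} : Multiset X)

variable [TopologicalSpace X]

theorem exists_nhd_subset {O : Set (FinMultiset X)} (hO : IsOpen O) {m : FinMultiset X}
    (hm : m ∈ O) : ∃ U : X → Set X, IsNhdChoice U ∧ nhd U m ⊆ O := by
  obtain ⟨w, rfl⟩ := Quot.exists_rep m
  obtain ⟨U, hU, hUO⟩ := Word.exists_nhd_subset (isOpen_coinduced.1 hO)
    (w := (w : Word X)) hm
  refine ⟨U, hU, ?_⟩
  rintro m' ⟨m'', hle, hrel⟩
  obtain ⟨l, rfl, hl⟩ := Multiset.Rel.exists_list (l := w) hrel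
  obtain ⟨r, hr⟩ := Multiset.le_iff_exists_add.1 hle
  obtain ⟨r, rfl⟩ := Quot.exists_rep r
  have hmem : (l ++ r : List X) ∈ Word.nhd U (w : Word X) :=
    List.sublistForall₂_iff.2 ⟨l, hl, List.sublist_append_left _ _⟩
  have hm' : m' = parikh (l ++ r : List X) := hr
  rw [hm']
  exact hUO hmem

theorem isOpen_iff {O : Set (FinMultiset X)} :
    IsOpen O ↔ ∀ m ∈ O, ∃ U : X → Set X, IsNhdChoice U ∧ nhd U m ⊆ O := by
  refine ⟨fun hO m hm => exists_nhd_subset hO hm, fun h => ?_⟩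
  refine isOpen_coinduced.2 (Word.isOpen_iff.2 fun w hw => ?_)
  obtain ⟨U, hU, hUO⟩ := h _ hw
  refine ⟨U, hU, fun w' hw' => hUO ?_⟩
  obtain ⟨l, hl, hsub⟩ := List.sublistForall₂_iff.1 hw'
  exact ⟨l, hsub.subperm, Multiset.rel_coe_of_forall₂ hl⟩

theorem isClosed_iff {A : Set (FinMultiset X)} :
    IsClosed A ↔ ∀ m ∉ A, ∃ U : X → Set X, IsNhdChoice U ∧ ∀ m' ∈ nhd U m, m' ∉ A := by
  rw [← isOpen_compl_iff, isOpen_iff]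
  rfl

theorem mem_nhd_self {U : X → Set X} (hU : IsNhdChoice U) (m : FinMultiset X) : m ∈ nhd U m :=
  ⟨m.letters, le_rfl, Multiset.rel_refl_of_refl_on fun x _ => (hU x).2⟩

theorem mem_of_le {A : Set (FinMultiset X)} (hA : IsClosed A) {m m' : FinMultiset X}
    (h : m.letters ≤ m'.letters) (hm' : m' ∈ A) : m ∈ A := by
  by_contra hm
  obtain ⟨U, hU, h'⟩ := isClosed_iff.1 hA m hm
  obtain ⟨m'', hle, hrel⟩ := mem_nhd_self hU m
  exact h' m' ⟨m'', hle.trans h, hrel⟩ hm'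

theorem isOpen_nhd {U : X → Set X} (hU : IsNhdChoice U) (m : FinMultiset X) :
    IsOpen (nhd U m) := by
  rw [isOpen_iff]
  rintro m₁ ⟨m₂, hle, hrel⟩
  have hfin : ((fun x => (U x)ᶜ) '' {x | x ∈ m.letters}).Finite :=
    (Multiset.finite_toSet m.letters).image _
  refine ⟨_, isNhdChoice_of_finite hfin ?_, ?_⟩
  · rintro _ ⟨x, -, rfl⟩
    exact (hU x).1.isClosed_compl
  · rintro m₃ ⟨m₄, hle', hrel'⟩
    obtain ⟨m₅, hle'', hrel''⟩ := hrel'.exists_le_left hle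
    refine ⟨m₅, hle''.trans hle', hrel.comp_of_mem hrel'' fun x hx y _ z _ hxy hyz => ?_⟩
    by_contra hz
    exact hyz _ ⟨x, hx, rfl⟩ hz hxy

theorem isClosed_of_finite {A : Set (FinMultiset X)} {𝒞 : Set (Set X)} (h𝒞 : 𝒞.Finite)
    (hcl : ∀ C ∈ 𝒞, IsClosed C)
    (hsub : ∀ m m' : FinMultiset X, m.letters ≤ m'.letters → m' ∈ A → m ∈ A)
    (hspec : ∀ m m' : FinMultiset X,
      Multiset.Rel (fun x y => ∀ C ∈ 𝒞, y ∈ C → x ∈ C) m.letters m'.letters → m' ∈ A → m ∈ A) :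
    IsClosed A := by
  rw [isClosed_iff]
  rintro m hm
  refine ⟨_, isNhdChoice_of_finite h𝒞 hcl, ?_⟩
  rintro m' ⟨m'', hle, hrel⟩ hA
  exact hm (hspec m m'' hrel (hsub m'' m' hle hA))

theorem isClosedOp_add : IsClosedOp (add (X := X)) where
  continuous := by
    rw [continuous_def]
    intro O hO
    rw [isOpen_prod_iff]
    intro a b hab
    obtain ⟨U, hU, hUO⟩ := exists_nhd_subset hO hab
    refine ⟨nhd U a, nhd U b, isOpen_nhd hU a, isOpen_nhd hU b, mem_nhd_self hU a,
      mem_nhd_self hU b, ?_⟩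
    rintro ⟨a', b'⟩ ⟨⟨a'', ha, ha'⟩, ⟨b'', hb, hb'⟩⟩
    exact hUO ⟨a'' + b'', add_le_add ha hb, ha'.add hb'⟩
  isClosed := by
    intro A B
    rw [isClosed_iff]
    intro m hm
    -- The finitely many decompositions of `m` play the role of the cuts of a word.
    let ι := {p : Multiset X × Multiset X // p ∈ {p | p ∈ m.letters.antidiagonal}}
    have : Finite ι := Multiset.finite_toSet m.letters.antidiagonal
    have key : ∀ p : ι, ∃ U : X → Set X, IsNhdChoice U ∧
        ∀ a b : FinMultiset X, a ∈ nhd U p.1.1 → b ∈ nhd U p.1.2 → ¬ (a ∈ A ∧ b ∈ B) := by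
      rintro ⟨⟨a, b⟩, hp⟩
      by_cases hA : (a : FinMultiset X) ∈ A
      · by_cases hB : (b : FinMultiset X) ∈ B
        · exact absurd ⟨a, hA, b, hB, Multiset.mem_antidiagonal.1 hp⟩ hm
        · obtain ⟨U, hU, h⟩ := isClosed_iff.1 B.isClosed _ hB
          exact ⟨U, hU, fun a b _ hb h' => h b hb h'.2⟩
      · obtain ⟨U, hU, h⟩ := isClosed_iff.1 A.isClosed _ hA
        exact ⟨U, hU, fun a b ha _ h' => h a ha h'.1⟩
    choose U hU hUA using key
    refine ⟨_, IsNhdChoice.iInter hU, ?_⟩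
    rintro _ ⟨m'', hle, hrel⟩ ⟨a, ha, b, hb, rfl⟩
    obtain ⟨a'', ha'', b'', hb'', rfl⟩ := Multiset.exists_add_of_le_add hle
    obtain ⟨a', b', ha', hb', hab⟩ := Multiset.rel_add_right.1 hrel
    let p : ι := ⟨(a', b'), Multiset.mem_antidiagonal.2 hab.symm⟩
    exact hUA p a b
      ⟨a'', ha'', ha'.mono fun x _ y _ hy => Set.mem_iInter.1 hy p⟩
      ⟨b'', hb'', hb'.mono fun x _ y _ hy => Set.mem_iInter.1 hy p⟩ ⟨ha, hb⟩

theorem continuous_letter : Continuous (letter (X := X)) :=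
  continuous_coinduced_rng.comp Word.continuous_letter

instance noetherianSpace [NoetherianSpace X] : NoetherianSpace (FinMultiset X) :=
  noetherianSpace_of_surjective (parikh : Word X → FinMultiset X) continuous_coinduced_rng
    Quot.exists_rep

/-! ### Closed sets of multisets -/

/-- The closed set of multisets over `F` with less than `n` elements outside `G`. -/
def few (F G : Closeds X) (n : ℕ) : Closeds (FinMultiset X) where
  carrier := {m | (∀ x ∈ m.letters, x ∈ F) ∧ ∀ m' ≤ m.letters, (∀ x ∈ m', x ∉ G) → m'.card < n}
  isClosed' := by
    refine isClosed_of_finite (𝒞 := {(F : Set X), (G : Set X)}) (Set.toFinite _) ?_ ?_ ?_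
    · rintro C (rfl | rfl)
      · exact F.isClosed
      · exact G.isClosed
    · exact fun m m' h hm' => ⟨fun x hx => hm'.1 x (Multiset.mem_of_le h hx),
        fun k hk => hm'.2 k (hk.trans h)⟩
    · intro m m' h hm'
      refine ⟨fun x hx => ?_, fun k hk hkG => ?_⟩
      · obtain ⟨y, hy, hxy⟩ := Multiset.exists_mem_of_rel_of_mem h hx
        exact hxy _ (Or.inl rfl) (hm'.1 y hy)
      · obtain ⟨k', hk', hrel⟩ := h.exists_le_left hk
        rw [Multiset.card_eq_card_of_rel hrel]
        refine hm'.2 k' hk' fun y hy hyG => ?_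
        obtain ⟨x, hx, hxy⟩ := Multiset.exists_mem_of_rel_of_mem (Multiset.rel_flip.2 hrel) hy
        exact hkG x hx (hxy _ (Or.inr rfl) hyG)

/-- The closed set of multisets with at most one element, taken in `F`. -/
def single (F : Closeds X) : Closeds (FinMultiset X) where
  carrier := {m | m.letters.card ≤ 1 ∧ ∀ x ∈ m.letters, x ∈ F}
  isClosed' := by
    refine isClosed_of_finite (𝒞 := {(F : Set X)}) (Set.toFinite _) ?_ ?_ ?_
    · rintro C rfl
      exact F.isClosed
    · exact fun m m' h hm' => ⟨(Multiset.card_le_card h).trans hm'.1,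
        fun x hx => hm'.2 x (Multiset.mem_of_le h hx)⟩
    · intro m m' h hm'
      refine ⟨(Multiset.card_eq_card_of_rel h).le.trans hm'.1, fun x hx => ?_⟩
      obtain ⟨y, hy, hxy⟩ := Multiset.exists_mem_of_rel_of_mem h hx
      exact hxy _ rfl (hm'.2 y hy)

theorem letter_mem_single {F : Closeds X} {x : X} : letter x ∈ single F ↔ x ∈ F := by
  constructor
  · exact fun h => h.2 x (Multiset.mem_singleton_self x)
  · intro h
    refine ⟨le_of_eq (Multiset.card_singleton x), fun y hy => ?_⟩
    rwa [Multiset.mem_singleton.1 hy]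

theorem zero_mem_single (F : Closeds X) : (0 : Multiset X) ∈ single F :=
  ⟨by simp [letters], fun _ h => absurd h (Multiset.notMem_zero _)⟩

theorem eq_zero_or_letter_of_mem_single {F : Closeds X} {m : FinMultiset X} (h : m ∈ single F) :
    m = (0 : Multiset X) ∨ ∃ x ∈ F, m = letter x := by
  rcases Nat.le_one_iff_eq_zero_or_eq_one.1 h.1 with h0 | h1
  · exact Or.inl (Multiset.card_eq_zero.1 h0)
  · obtain ⟨x, hx⟩ := Multiset.card_eq_one.1 h1
    exact Or.inr ⟨x, h.2 x (by rw [hx]; exact Multiset.mem_singleton_self x), hx⟩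

theorem eq_bot_or_eq_single {A : Closeds (FinMultiset X)} {F : Closeds X} (h : A ≤ single F) :
    A = ⊥ ∨ ∃ G ≤ F, A = single G := by
  rcases Set.eq_empty_or_nonempty (A : Set (FinMultiset X)) with h0 | ⟨m₀, hm₀⟩
  · exact Or.inl (SetLike.coe_injective h0)
  · refine Or.inr ⟨⟨_, A.isClosed.preimage continuous_letter⟩,
      fun x hx => letter_mem_single.1 (h hx), le_antisymm ?_ ?_⟩
    · intro m hm
      refine ⟨(h hm).1, fun x hx => ?_⟩
      exact mem_of_le A.isClosed (Multiset.singleton_le.2 hx) hm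
    · intro m hm
      rcases eq_zero_or_letter_of_mem_single hm with rfl | ⟨x, hx, rfl⟩
      · exact mem_of_le A.isClosed (Multiset.zero_le _) hm₀
      · exact hx

theorem single_sup_le {F G H : Closeds X} (h : F ≤ G ⊔ H) : single F ≤ single G ⊔ single H := by
  intro m hm
  rcases eq_zero_or_letter_of_mem_single hm with rfl | ⟨x, hx, rfl⟩
  · exact Or.inl (zero_mem_single G)
  · rcases h hx with hx | hx
    · exact Or.inl (letter_mem_single.2 hx)
    · exact Or.inr (letter_mem_single.2 hx)

theorem le_of_single_le {F G : Closeds X} (h : single F ≤ single G) : F ≤ G :=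
  fun _ hx => letter_mem_single.1 (h (letter_mem_single.2 hx))

/-- The multisets obtained by adding a multiset over `F` and elements of the members of a
submultiset of `s`. -/
def elementary (F : Closeds X) (s : Multiset (IrreducibleCloseds X)) :
    Closeds (FinMultiset X) where
  carrier := {m | ∃ m₀ m₁ t, m.letters = m₀ + m₁ ∧ (∀ x ∈ m₀, x ∈ F) ∧ t ≤ s ∧
    Multiset.Rel (fun x C => x ∈ C) m₁ t}
  isClosed' := by
    refine isClosed_of_finite
      (𝒞 := insert (F : Set X) ((fun C : IrreducibleCloseds X => (C : Set X)) '' {C | C ∈ s}))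
      (((Multiset.finite_toSet s).image _).insert _) ?_ ?_ ?_
    · rintro C (rfl | ⟨C, -, rfl⟩)
      · exact F.isClosed
      · exact C.isClosed
    · rintro m m' h ⟨m₀, m₁, t, hm, hm₀, ht, hrel⟩
      rw [hm] at h
      obtain ⟨a, ha, b, hb, hab⟩ := Multiset.exists_add_of_le_add h
      obtain ⟨t', ht', hrel'⟩ := hrel.exists_le_left hb
      exact ⟨a, b, t', hab, fun x hx => hm₀ x (Multiset.mem_of_le ha hx), ht'.trans ht, hrel'⟩
    · rintro m m' h ⟨m₀, m₁, t, hm, hm₀, ht, hrel⟩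
      rw [hm] at h
      obtain ⟨a, b, ha, hb, hab⟩ := Multiset.rel_add_right.1 h
      refine ⟨a, b, t, hab, fun x hx => ?_, ht, hb.comp_of_mem hrel fun x _ y _ C hC hxy hyC =>
        hxy _ (Or.inr ⟨C, Multiset.mem_of_le ht hC, rfl⟩) hyC⟩
      obtain ⟨y, hy, hxy⟩ := Multiset.exists_mem_of_rel_of_mem ha hx
      exact hxy _ (Or.inl rfl) (hm₀ y hy)

theorem mem_elementary {F : Closeds X} {s : Multiset (IrreducibleCloseds X)} {m : FinMultiset X} :
    m ∈ elementary F s ↔ ∃ m₀ m₁ t, m.letters = m₀ + m₁ ∧ (∀ x ∈ m₀, x ∈ F) ∧ t ≤ s ∧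
      Multiset.Rel (fun x C => x ∈ C) m₁ t :=
  Iff.rfl

theorem mem_elementary_zero {F : Closeds X} {m : FinMultiset X} :
    m ∈ elementary F 0 ↔ ∀ x ∈ m.letters, x ∈ F := by
  rw [mem_elementary]
  constructor
  · rintro ⟨m₀, m₁, t, hm, hm₀, ht, hrel⟩
    rw [Multiset.le_zero] at ht
    rw [ht, Multiset.rel_zero_right] at hrel
    rwa [hm, hrel, add_zero]
  · exact fun h => ⟨m.letters, 0, 0, (add_zero _).symm, h, le_rfl, .zero⟩

theorem elementary_cons (F : Closeds X) (C : IrreducibleCloseds X)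
    (s : Multiset (IrreducibleCloseds X)) :
    elementary F (C ::ₘ s) = closedImage add (elementary F s) (single C.toClosed) := by
  apply le_antisymm
  · rintro m ⟨m₀, m₁, t, hm, hm₀, ht, hrel⟩
    by_cases hC : t ≤ s
    · rw [show m = m.add (0 : Multiset X) from (add_zero m.letters).symm]
      exact mem_closedImage (op := add) ⟨m₀, m₁, t, hm, hm₀, hC, hrel⟩ (zero_mem_single _)
    · have hCt : C ∈ t := by
        by_contra hCt
        exact hC ((Multiset.le_cons_of_notMem hCt).1 ht)
      obtain ⟨t, rfl⟩ := Multiset.exists_cons_of_mem hCt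
      obtain ⟨x, m₂, hx, hm₂, rfl⟩ := Multiset.rel_cons_right.1 hrel
      have hmem : (m₀ + m₂ : Multiset X) ∈ elementary F s :=
        ⟨m₀, m₂, t, rfl, hm₀, (Multiset.cons_le_cons_iff C).1 ht, hm₂⟩
      have := mem_closedImage (op := add) hmem (letter_mem_single (F := C.toClosed).2 hx)
      have heq : m = (m₀ + m₂ : FinMultiset X).add (letter x) := by
        refine hm.trans ?_
        change _ = m₀ + m₂ + {x}
        rw [← Multiset.singleton_add x m₂, add_comm {x} m₂, add_assoc]
      rw [heq]
      exact this
  · refine closedImage_le.2 ?_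
    rintro m ⟨m₀, m₁, t, hm, hm₀, ht, hrel⟩ n hn
    rcases eq_zero_or_letter_of_mem_single hn with rfl | ⟨x, hx, rfl⟩
    · exact ⟨m₀, m₁, t, (add_zero m.letters).trans hm, hm₀, ht.trans (Multiset.le_cons_self s C),
        hrel⟩
    · refine ⟨m₀, x ::ₘ m₁, C ::ₘ t, ?_, hm₀, Multiset.cons_le_cons C ht, .cons hx hrel⟩
      change m.letters + {x} = _
      rw [hm, ← Multiset.singleton_add x m₁, add_comm {x} m₁, add_assoc]

/-- Open sets of multisets are closed upwards, so the sum of two witnesses over `F` lies in both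
open sets. -/
theorem isIrreducible_elementary_zero (F : Closeds X) :
    IsIrreducible (elementary F 0 : Set (FinMultiset X)) := by
  refine ⟨⟨(0 : Multiset X), mem_elementary_zero.2 fun _ h => absurd h (Multiset.notMem_zero _)⟩,
    ?_⟩
  rintro O O' hO hO' ⟨m, hm, hmO⟩ ⟨m', hm', hmO'⟩
  have hup : ∀ O : Set (FinMultiset X), IsOpen O → ∀ m m' : FinMultiset X,
      m.letters ≤ m'.letters → m ∈ O → m' ∈ O := by
    intro O hO m m' h hm
    by_contra hm'
    exact mem_of_le hO.isClosed_compl h hm' hm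
  refine ⟨m.add m', mem_elementary_zero.2 fun x hx => ?_,
    hup O hO m _ (Multiset.le_add_right _ _) hmO, hup O' hO' m' _ (Multiset.le_add_left _ _) hmO'⟩
  rcases Multiset.mem_add.1 hx with hx | hx
  · exact mem_elementary_zero.1 hm x hx
  · exact mem_elementary_zero.1 hm' x hx

theorem isIrreducible_single {C : Closeds X} (hC : IsIrreducible (C : Set X)) :
    IsIrreducible (single C : Set (FinMultiset X)) := by
  have h := (hC.image letter continuous_letter.continuousOn).closure
  convert h using 1
  apply le_antisymm
  · intro m hm
    rcases eq_zero_or_letter_of_mem_single hm with rfl | ⟨x, hx, rfl⟩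
    · obtain ⟨x, hx⟩ := hC.nonempty
      exact mem_of_le isClosed_closure (m' := letter x) (Multiset.zero_le _)
        (subset_closure ⟨x, hx, rfl⟩)
    · exact subset_closure ⟨x, hx, rfl⟩
  · refine closure_minimal ?_ (single C).isClosed
    rintro _ ⟨x, hx, rfl⟩
    exact letter_mem_single.2 hx

end FinMultiset

theorem le_of_isIrreducible_of_forall_mem {X ι : Type u} [TopologicalSpace X] {A : Closeds X}
    (hA : IsIrreducible (A : Set X)) (s : Multiset ι) (f : ι → Closeds X)
    (h : ∀ m ∈ A, ∃ x ∈ s, m ∈ f x) : ∃ x ∈ s, A ≤ f x := by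
  have hsup : ∀ s : Multiset ι, A ≤ (s.map f).sup → ∃ x ∈ s, A ≤ f x := by
    intro s hs
    induction s using Multiset.induction_on with
    | empty =>
      obtain ⟨m, hm⟩ := hA.nonempty
      have := hs hm
      rw [Multiset.map_zero, Multiset.sup_zero] at this
      exact absurd this (Set.notMem_empty m)
    | cons a s ih =>
      rw [Multiset.map_cons, Multiset.sup_cons] at hs
      rcases le_or_le_of_isIrreducible hA hs with hs | hs
      · exact ⟨a, Multiset.mem_cons_self a s, hs⟩
      · obtain ⟨x, hx, hle⟩ := ih hs
        exact ⟨x, Multiset.mem_cons_of_mem hx, hle⟩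
  refine hsup s fun m hm => ?_
  obtain ⟨x, hx, hmx⟩ := h m hm
  exact Multiset.le_sup (Multiset.mem_map_of_mem f hx) hmx

/-- The first coordinate is fixed using irreducibility of `C`, then the second using that of `D`;
continuity in each variable is enough. -/
theorem isIrreducible_closedImage {X Y W : Type u} [TopologicalSpace X] [TopologicalSpace Y]
    [TopologicalSpace W] {op : X → Y → W} (hop : Continuous fun p : X × Y => op p.1 p.2)
    {C : Closeds X} {D : Closeds Y} (hC : IsIrreducible (C : Set X))
    (hD : IsIrreducible (D : Set Y)) : IsIrreducible (closedImage op C D : Set W) := by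
  refine IsIrreducible.closure ⟨hC.nonempty.image2 hD.nonempty, ?_⟩
  rintro O O' hO hO' ⟨_, ⟨x, hx, y, hy, rfl⟩, hxy⟩ ⟨_, ⟨x', hx', y', hy', rfl⟩, hxy'⟩
  have h1 : ∀ (O : Set W), IsOpen O → ∀ y, IsOpen {x | op x y ∈ O} := fun O hO y =>
    hO.preimage (hop.comp (continuous_id.prodMk continuous_const))
  have h2 : ∀ (O : Set W), IsOpen O → ∀ x, IsOpen {y | op x y ∈ O} := fun O hO x =>
    hO.preimage (hop.comp (continuous_const.prodMk continuous_id))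
  obtain ⟨x₀, hx₀, hx₀O, hx₀O'⟩ := hC.isPreirreducible _ _ (h1 O hO y) (h1 O' hO' y')
    ⟨x, hx, hxy⟩ ⟨x', hx', hxy'⟩
  obtain ⟨y₀, hy₀, hy₀O, hy₀O'⟩ := hD.isPreirreducible _ _ (h2 O hO x₀) (h2 O' hO' x₀)
    ⟨y, hy, hx₀O⟩ ⟨y', hy', hx₀O'⟩
  exact ⟨_, ⟨x₀, hx₀, y₀, hy₀, rfl⟩, hy₀O, hy₀O'⟩

/-! ### Classification of the irreducible closed sets of multisets. -/

namespace FinMultiset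

variable {X : Type u} [TopologicalSpace X]

theorem isIrreducible_elementary (F : Closeds X) (s : Multiset (IrreducibleCloseds X)) :
    IsIrreducible (elementary F s : Set (FinMultiset X)) := by
  induction s using Multiset.induction_on with
  | empty => exact isIrreducible_elementary_zero F
  | cons C s ih =>
    rw [elementary_cons]
    exact isIrreducible_closedImage isClosedOp_add.continuous ih
      (isIrreducible_single C.isIrreducible)

/-- `A` misses a neighbourhood of some `m` over `F`. By the greedy matching, each element of `A` has
fewer than `card m` entries in `U x` for some `x` in `m`; irreducibility makes `x` uniform. -/
theorem exists_le_few {A : Closeds (FinMultiset X)} (hA : IsIrreducible (A : Set (FinMultiset X)))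
    {F : Closeds X} (h : A < elementary F 0) :
    ∃ G < F, ∃ n : ℕ, A ≤ few F G (n + 1) := by
  obtain ⟨m, hmF, hmA⟩ := Set.exists_of_ssubset (SetLike.coe_ssubset_coe.2 h)
  obtain ⟨U, hU, hUA⟩ := isClosed_iff.1 A.isClosed m hmA
  obtain ⟨x, hx, hle⟩ := le_of_isIrreducible_of_forall_mem hA m.letters
    (fun x => few F (F ⊓ ⟨(U x)ᶜ, (hU x).1.isClosed_compl⟩) m.letters.card) fun m' hm' => by
    by_contra! hcon
    refine hUA m' (mem_nhd_of_card_le m.letters m'.letters fun x hx => ?_) hm'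
    have hm'F : ∀ y ∈ m'.letters, y ∈ F := mem_elementary_zero.1 (h.le hm')
    have := hcon x hx
    by_contra! hk
    refine this ⟨hm'F, fun k hkm hkG => hk k hkm fun y hy => ?_⟩
    by_contra hyU
    exact hkG y hy ⟨hm'F y (Multiset.mem_of_le hkm hy), hyU⟩
  refine ⟨F ⊓ ⟨(U x)ᶜ, (hU x).1.isClosed_compl⟩,
    inf_lt_left.2 fun h' => h' (mem_elementary_zero.1 hmF x hx) (hU x).2,
    m.letters.card, hle.trans fun m' hm' => ⟨hm'.1, fun k hk hkG => (hm'.2 k hk hkG).trans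
      (Nat.lt_succ_self _)⟩⟩

theorem few_one_le (F G : Closeds X) : few F G 1 ≤ elementary G 0 := by
  intro m hm
  refine mem_elementary_zero.2 fun x hx => ?_
  by_contra hxG
  have := hm.2 {x} (Multiset.singleton_le.2 hx) fun y hy => by
    rwa [Multiset.mem_singleton.1 hy]
  simp at this

theorem few_succ_le (F G : Closeds X) (n : ℕ) :
    few F G (n + 2) ≤ closedImage add (few F G (n + 1)) (single F) := by
  intro m hm
  by_cases h : ∃ x ∈ m.letters, x ∉ G
  · obtain ⟨x, hx, hxG⟩ := h
    obtain ⟨m', hm'⟩ := Multiset.exists_cons_of_mem hx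
    have hmem : (m' : FinMultiset X) ∈ few F G (n + 1) := by
      refine ⟨fun y hy => hm.1 y (hm' ▸ Multiset.mem_cons_of_mem hy), fun k hk hkG => ?_⟩
      have := hm.2 (x ::ₘ k) (hm' ▸ Multiset.cons_le_cons x hk) fun y hy => by
        rcases Multiset.mem_cons.1 hy with rfl | hy
        · exact hxG
        · exact hkG y hy
      rw [Multiset.card_cons] at this
      omega
    have heq : m = (m' : FinMultiset X).add (letter x) := by
      refine hm'.trans ?_
      change _ = m' + {x}
      rw [← Multiset.singleton_add x m', add_comm]
    rw [heq]
    exact mem_closedImage hmem (letter_mem_single.2 (hm.1 x hx))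
  · push Not at h
    rw [show m = m.add (0 : Multiset X) from (add_zero m.letters).symm]
    refine mem_closedImage (op := add) ⟨hm.1, fun k hk hkG => ?_⟩ (zero_mem_single F)
    rcases Multiset.empty_or_exists_mem k with rfl | ⟨y, hy⟩
    · simp
    · exact absurd (h y (Multiset.mem_of_le hk hy)) (hkG y hy)

variable [NoetherianSpace X]

/-- Every irreducible closed set of multisets is elementary. -/
theorem exists_eq_elementary {A : Closeds (FinMultiset X)}
    (hA : IsIrreducible (A : Set (FinMultiset X))) {F : Closeds X} (h : A ≤ elementary F 0) :
    ∃ G ≤ F, ∃ s, A = elementary G s := by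
  induction F using WellFoundedLT.induction generalizing A with
  | ind F ih =>
  rcases h.eq_or_lt with h' | h'
  · exact ⟨F, le_rfl, 0, h'⟩
  · obtain ⟨G, hG, n, hle⟩ := exists_le_few hA h'
    clear h h'
    induction n generalizing A with
    | zero =>
      obtain ⟨G', hG', s, hs⟩ := ih G hG hA (hle.trans (few_one_le F G))
      exact ⟨G', hG'.trans hG.le, s, hs⟩
    | succ n ihn =>
      -- One possible element outside `G` is split off. The factor `A₂` is a `single H`: an empty
      -- `H` contributes nothing, and otherwise irreducibility passes to `H`.
      obtain ⟨A₁, A₂, h₁, h₂, rfl⟩ := isClosedOp_add.exists_irreducible_eq hA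
        (hle.trans (few_succ_le F G n))
      obtain ⟨G', hG', s, hs⟩ := ihn A₁.isIrreducible h₁
      rcases eq_bot_or_eq_single h₂ with h₂ | ⟨H, hH, h₂'⟩
      · obtain ⟨m, hm⟩ := A₂.isIrreducible.nonempty
        have : m ∈ A₂.toClosed := hm
        rw [h₂] at this
        exact absurd this (Set.notMem_empty m)
      · rcases Set.eq_empty_or_nonempty (H : Set X) with hH0 | hH0
        · refine ⟨G', hG', s, ?_⟩
          rw [hs, h₂']
          apply le_antisymm
          · refine closedImage_le.2 fun m hm n hn => ?_
            rcases eq_zero_or_letter_of_mem_single hn with rfl | ⟨x, hx, rfl⟩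
            · rwa [show m.add (0 : Multiset X) = m from add_zero m.letters]
            · exact absurd hx (by rw [← SetLike.mem_coe, hH0]; exact Set.notMem_empty x)
          · intro m hm
            rw [show m = m.add (0 : Multiset X) from (add_zero m.letters).symm]
            exact mem_closedImage hm (zero_mem_single H)
        · rcases exists_isIrreducible_or hH0 with hHi | ⟨H₁, hH₁, H₂, hH₂, hle'⟩
          · refine ⟨G', hG', ⟨H, hHi, H.isClosed⟩ ::ₘ s, ?_⟩
            rw [elementary_cons, hs, h₂']
            rfl
          · exfalso
            rcases le_or_le_of_isIrreducible A₂.isIrreducible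
              (h₂'.le.trans (single_sup_le hle')) with h' | h'
            · exact absurd hH₁ (not_lt_of_ge (le_of_single_le (h₂'.ge.trans h')))
            · exact absurd hH₂ (not_lt_of_ge (le_of_single_le (h₂'.ge.trans h')))

end FinMultiset

/-! ### Inclusions between elementary sets of multisets -/

namespace FinMultiset

variable {X : Type u} [TopologicalSpace X]

theorem elementary_mono {F F' : Closeds X} {s s' : Multiset (IrreducibleCloseds X)} (hF : F ≤ F')
    (hs : s ≤ s') : elementary F s ≤ elementary F' s' := by
  rintro m ⟨m₀, m₁, t, hm, hm₀, ht, hrel⟩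
  exact ⟨m₀, m₁, t, hm, fun x hx => hF (hm₀ x hx), ht.trans hs, hrel⟩

/-- Enough copies of a point of `F` outside `F'` cannot all be accommodated by the finite multiset
`s'`. -/
theorem le_of_elementary_le {F F' : Closeds X} {s s' : Multiset (IrreducibleCloseds X)}
    (h : elementary F s ≤ elementary F' s') : F ≤ F' := by
  intro x hx
  by_contra hxF'
  have hmem : (Multiset.replicate (s'.card + 1) x : FinMultiset X) ∈ elementary F s :=
    ⟨_, 0, 0, (add_zero _).symm, fun y hy => by rwa [Multiset.eq_of_mem_replicate hy],
      Multiset.zero_le _, .zero⟩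
  obtain ⟨m₀, m₁, t, hm, hm₀, ht, hrel⟩ := h hmem
  change Multiset.replicate (s'.card + 1) x = m₀ + m₁ at hm
  have h₀ : m₀ = 0 := by
    refine Multiset.eq_zero_of_forall_notMem fun y hy => hxF' ?_
    have : y ∈ Multiset.replicate (s'.card + 1) x := hm ▸ Multiset.mem_add.2 (Or.inl hy)
    rw [← Multiset.eq_of_mem_replicate this]
    exact hm₀ y hy
  have h₁ := congrArg Multiset.card hm
  rw [h₀, zero_add, Multiset.card_replicate, Multiset.card_eq_card_of_rel hrel] at h₁
  have := Multiset.card_le_card ht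
  omega

-- A member `C` of `s` not inside `F'` has a point outside `F'` and outside every member of `s'` not
-- containing `C`, by irreducibility. Testing the inclusion on the multiset of these points gives
-- the matching.
open scoped Classical in
theorem exists_rel_of_elementary_le {F F' : Closeds X} {s s' : Multiset (IrreducibleCloseds X)}
    (h : elementary F s ≤ elementary F' s') :
    ∃ t ≤ s', Multiset.Rel (· ≤ ·) (s.filter fun C => ¬ C.toClosed ≤ F') t := by
  have key : ∀ C : IrreducibleCloseds X, ∃ x ∈ C, ¬ C.toClosed ≤ F' →
      x ∉ F' ∧ ∀ D ∈ s', x ∈ D → C ≤ D := by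
    intro C
    by_cases hC : C.toClosed ≤ F'
    · obtain ⟨x, hx⟩ := C.isIrreducible.nonempty
      exact ⟨x, hx, fun h => absurd hC h⟩
    by_contra! hcon
    obtain ⟨D, hD, hle⟩ := le_of_isIrreducible_of_forall_mem (A := C.toClosed) C.isIrreducible
      (F' ::ₘ (s'.filter fun D => ¬ C ≤ D).map IrreducibleCloseds.toClosed) id fun x hx => by
        obtain ⟨-, h'⟩ := hcon x hx
        by_cases hxF' : x ∈ F'
        · exact ⟨F', Multiset.mem_cons_self _ _, hxF'⟩
        · obtain ⟨D, hD, hxD, hCD⟩ := h' hxF'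
          exact ⟨D.toClosed, Multiset.mem_cons_of_mem (Multiset.mem_map_of_mem _
            (Multiset.mem_filter.2 ⟨hD, hCD⟩)), hxD⟩
    rcases Multiset.mem_cons.1 hD with rfl | hD
    · exact hC hle
    · obtain ⟨E, hE, rfl⟩ := Multiset.mem_map.1 hD
      exact (Multiset.mem_filter.1 hE).2 hle
  choose x hxC hx using key
  set q := s.filter fun C => ¬ C.toClosed ≤ F' with hq
  have hqF' : ∀ C ∈ q, ¬ C.toClosed ≤ F' := fun C hC => (Multiset.mem_filter.1 hC).2
  have hmem : (q.map x : FinMultiset X) ∈ elementary F s :=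
    ⟨0, q.map x, q, (zero_add _).symm, fun y hy => absurd hy (Multiset.notMem_zero y),
      Multiset.filter_le _ s, Multiset.rel_map_left.2 (Multiset.rel_refl_of_refl_on fun C _ =>
        hxC C)⟩
  obtain ⟨m₀, m₁, t, hm, hm₀, ht, hrel⟩ := h hmem
  change q.map x = m₀ + m₁ at hm
  have h₀ : m₀ = 0 := by
    refine Multiset.eq_zero_of_forall_notMem fun y hy => ?_
    have : y ∈ q.map x := hm ▸ Multiset.mem_add.2 (Or.inl hy)
    obtain ⟨C, hC, rfl⟩ := Multiset.mem_map.1 this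
    exact (hx C (hqF' C hC)).1 (hm₀ _ hy)
  rw [h₀, zero_add] at hm
  rw [← hm, Multiset.rel_map_left] at hrel
  exact ⟨t, ht, hrel.mono fun C hC D hD hCD =>
    (hx C (hqF' C hC)).2 D (Multiset.mem_of_le ht hD) hCD⟩

open scoped Classical in
theorem elementary_filter (F : Closeds X) (s : Multiset (IrreducibleCloseds X)) :
    elementary F (s.filter fun C => ¬ C.toClosed ≤ F) = elementary F s := by
  refine le_antisymm (elementary_mono le_rfl (Multiset.filter_le _ s)) ?_
  induction s using Multiset.induction_on with
  | empty => exact le_rfl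
  | cons C s ih =>
    by_cases hC : C.toClosed ≤ F
    · rw [Multiset.filter_cons_of_neg (p := fun C : IrreducibleCloseds X => ¬ C.toClosed ≤ F) s
        (not_not.2 hC)]
      refine le_trans ?_ ih
      rw [elementary_cons]
      refine closedImage_le.2 ?_
      rintro m ⟨m₀, m₁, t, hm, hm₀, ht, hrel⟩ n hn
      refine ⟨m₀ + n.letters, m₁, t, ?_, fun x hx => ?_, ht, hrel⟩
      · rw [letters_add, hm, add_right_comm]
      · rcases Multiset.mem_add.1 hx with hx | hx
        · exact hm₀ x hx
        · exact hC (hn.2 x hx)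
    · rw [Multiset.filter_cons_of_pos (p := fun C : IrreducibleCloseds X => ¬ C.toClosed ≤ F) s hC,
        elementary_cons, elementary_cons]
      exact closedImage_mono ih le_rfl

/-- The irreducible closed set whose underlying closed set is `elementary F s`. -/
def elementaryIrreducible (F : Closeds X) (s : Multiset (IrreducibleCloseds X)) :
    IrreducibleCloseds (FinMultiset X) :=
  ⟨elementary F s, isIrreducible_elementary F s, (elementary F s).isClosed⟩

theorem elementaryIrreducible_lt {F F' : Closeds X} {s s' : Multiset (IrreducibleCloseds X)} :
    elementaryIrreducible F s < elementaryIrreducible F' s' ↔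
      elementary F s < elementary F' s' := Iff.rfl

/-- No member of `s` is contained in `F`. -/
def IsReduced (F : Closeds X) (s : Multiset (IrreducibleCloseds X)) : Prop :=
  ∀ C ∈ s, ¬ C.toClosed ≤ F

theorem isReduced_zero (F : Closeds X) : IsReduced F 0 := fun C hC =>
  absurd hC (Multiset.notMem_zero C)

theorem exists_eq_elementaryIrreducible [NoetherianSpace X]
    (A : IrreducibleCloseds (FinMultiset X)) :
    ∃ F s, IsReduced F s ∧ A = elementaryIrreducible F s := by
  classical
  obtain ⟨F, -, s, h⟩ := exists_eq_elementary (A := A.toClosed) A.isIrreducible (F := ⊤)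
    fun m _ => mem_elementary_zero.2 fun _ _ => trivial
  refine ⟨F, s.filter fun C => ¬ C.toClosed ≤ F, fun C hC => (Multiset.mem_filter.1 hC).2, ?_⟩
  apply IrreducibleCloseds.toClosed_injective
  rw [h, ← elementary_filter]
  rfl

theorem sobrificationRank_eq [NoetherianSpace X] :
    sobrificationRank (FinMultiset X) = wfRank (elementaryIrreducible (⊤ : Closeds X) 0) + 1 := by
  rw [← Order.succ_eq_add_one]
  apply le_antisymm
  · refine Ordinal.iSup_le fun A => Order.succ_le_succ (wfRank_mono ?_)
    exact fun m _ => mem_elementary_zero.2 fun _ _ => trivial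
  · exact Ordinal.le_iSup (fun A : IrreducibleCloseds (FinMultiset X) =>
      Order.succ (IsWellFounded.rank (· < ·) A)) _

end FinMultiset

/-! ### Upper bounds -/

theorem naddSum_map_le_of_rel {ι : Type u} [PartialOrder ι] {f g : ι → Ordinal.{u}}
    {s t : Multiset ι} (h : Multiset.Rel (· ≤ ·) s t)
    (hfg : ∀ C ∈ s, ∀ D ∈ t, C ≤ D → f C ≤ g D) : naddSum (s.map f) ≤ naddSum (t.map g) := by
  induction h with
  | zero => exact le_rfl
  | cons hab _ ih =>
    rw [Multiset.map_cons, Multiset.map_cons, naddSum_cons, naddSum_cons]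
    exact nadd_le_nadd (hfg _ (Multiset.mem_cons_self _ _) _ (Multiset.mem_cons_self _ _) hab)
      (ih fun C hC D hD => hfg C (Multiset.mem_cons_of_mem hC) D (Multiset.mem_cons_of_mem hD))

theorem naddSum_map_lt_of_rel {ι : Type u} [PartialOrder ι] {g : ι → Ordinal.{u}}
    {s t : Multiset ι} (h : Multiset.Rel (· ≤ ·) s t)
    (hg : ∀ C ∈ s, ∀ D ∈ t, C < D → g C < g D) (hne : s ≠ t) :
    naddSum (s.map g) < naddSum (t.map g) := by
  have hle : ∀ C ∈ s, ∀ D ∈ t, C ≤ D → g C ≤ g D := fun C hC D hD hCD => by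
    rcases hCD.eq_or_lt with rfl | hCD
    · exact le_rfl
    · exact (hg C hC D hD hCD).le
  induction h with
  | zero => exact absurd rfl hne
  | @cons a b s t hab hst ih =>
    have hle' : ∀ C ∈ s, ∀ D ∈ t, C ≤ D → g C ≤ g D := fun C hC D hD =>
      hle C (Multiset.mem_cons_of_mem hC) D (Multiset.mem_cons_of_mem hD)
    rw [Multiset.map_cons, Multiset.map_cons, naddSum_cons, naddSum_cons]
    refine nadd_lt_of_not_both
      (hle _ (Multiset.mem_cons_self _ _) _ (Multiset.mem_cons_self _ _) hab)
      (naddSum_map_le_of_rel hst hle') ?_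
    rcases hab.eq_or_lt with rfl | hab
    · refine Or.inr (ih (fun C hC D hD => hg C (Multiset.mem_cons_of_mem hC) D
        (Multiset.mem_cons_of_mem hD)) (fun h => hne (by rw [h])) hle')
    · exact Or.inl (hg _ (Multiset.mem_cons_self _ _) _ (Multiset.mem_cons_self _ _) hab)

theorem naddSum_map_lt_of_rel_of_le {ι : Type u} [PartialOrder ι] {g : ι → Ordinal.{u}}
    {s t s' : Multiset ι} (h : Multiset.Rel (· ≤ ·) s t) (hts : t ≤ s')
    (hg : ∀ C ∈ s, ∀ D ∈ s', C < D → g C < g D) (hpos : ∀ D ∈ s', g D ≠ 0) (hne : s ≠ s') :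
    naddSum (s.map g) < naddSum (s'.map g) := by
  obtain ⟨r, rfl⟩ := Multiset.le_iff_exists_add.1 hts
  rw [Multiset.map_add, naddSum_add]
  have hg' : ∀ C ∈ s, ∀ D ∈ t, C < D → g C < g D := fun C hC D hD =>
    hg C hC D (Multiset.mem_add.2 (Or.inl hD))
  by_cases hst : s = t
  · subst hst
    rcases Multiset.empty_or_exists_mem r with rfl | ⟨D, hD⟩
    · exact absurd (add_zero s).symm hne
    · obtain ⟨r, rfl⟩ := Multiset.exists_cons_of_mem hD
      rw [Multiset.map_cons, naddSum_cons]
      have h0 : 0 < nadd (g D) (naddSum (r.map g)) :=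
        (pos_iff_ne_zero.2 (hpos D (Multiset.mem_add.2 (Or.inr hD)))).trans_le (le_nadd_left _ _)
      exact (nadd_zero (naddSum (s.map g))).symm.trans_lt (nadd_lt_nadd_left h0 _)
  · exact (naddSum_map_lt_of_rel h hg' hst).trans_le (le_nadd_left _ _)

namespace FinMultiset

variable {X : Type u} [TopologicalSpace X] [NoetherianSpace X]

/-- The contribution of `C` to the rank of an elementary set with base `F`. -/
def weight (F : Closeds X) (C : IrreducibleCloseds X) : Ordinal.{u} :=
  min (wfRank (F ⊔ C.toClosed) - wfRank F) (wfRank C + 1)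

theorem weight_mono (F : Closeds X) {C D : IrreducibleCloseds X} (h : C ≤ D) :
    weight F C ≤ weight F D :=
  min_le_min
    (Ordinal.sub_le.2 ((wfRank_mono (sup_le_sup_left (IrreducibleCloseds.toClosed_le.2 h) F)).trans
      (Ordinal.le_add_sub _ _)))
    (add_le_add_left (wfRank_mono h) 1)

/-- Irreducibility of `D` is what makes the join with `F` strictly increasing: `D` inside `F ⊔ C`
would lie inside `F` or `C`. -/
theorem weight_lt {F : Closeds X} {C D : IrreducibleCloseds X} (h : C < D)
    (hD : ¬ D.toClosed ≤ F) : weight F C < weight F D := by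
  refine min_lt_min ?_ (by simpa using wfRank_lt h)
  have hlt : F ⊔ C.toClosed < F ⊔ D.toClosed := by
    refine lt_of_le_not_ge (sup_le_sup_left (IrreducibleCloseds.toClosed_le.2 h.le) F) fun h' => ?_
    rcases le_or_le_of_isIrreducible D.isIrreducible (le_sup_right.trans h') with h' | h'
    · exact hD h'
    · exact not_lt_of_ge (IrreducibleCloseds.toClosed_le.1 h') h
  rw [Ordinal.lt_sub, Ordinal.add_sub_cancel_of_le (wfRank_mono le_sup_left)]
  exact wfRank_lt hlt

theorem weight_ne_zero {F : Closeds X} {C : IrreducibleCloseds X} (h : ¬ C.toClosed ≤ F) :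
    weight F C ≠ 0 := by
  rw [← pos_iff_ne_zero]
  refine lt_min ?_ (Order.succ_eq_add_one (wfRank C) ▸ Order.bot_lt_succ _)
  rw [Ordinal.lt_sub, add_zero]
  exact wfRank_lt (left_lt_sup.2 h)

/-- An upper bound for the rank of `elementary F s`. -/
def size (F : Closeds X) (s : Multiset (IrreducibleCloseds X)) : Ordinal.{u} :=
  nadd (naturalProd (wfRank F) ω) (naddSum (s.map (weight F)))

/-- With a fixed base, the injective matching of members increases the sum of weights. When the base
grows, light members are paid for by the growth of its product by ω, and heavy members are matched
into `s'` without losing weight. -/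
theorem size_lt {F F' : Closeds X} {s s' : Multiset (IrreducibleCloseds X)} (hs : IsReduced F s)
    (hs' : IsReduced F' s') (h : elementary F s < elementary F' s') : size F s < size F' s' := by
  classical
  obtain ⟨t, ht, hrel⟩ := exists_rel_of_elementary_le h.le
  rcases (le_of_elementary_le h.le).eq_or_lt with rfl | hF
  · rw [Multiset.filter_eq_self.2 hs] at hrel
    refine nadd_lt_nadd_left ?_ _
    refine naddSum_map_lt_of_rel_of_le hrel ht (fun C _ D hD hCD => weight_lt hCD (hs' D hD))
      (fun D hD => weight_ne_zero (hs' D hD)) ?_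
    rintro rfl
    exact lt_irrefl _ h
  · obtain ⟨δ, hδ⟩ : ∃ δ, wfRank F' = wfRank F + δ :=
      ⟨_, (Ordinal.add_sub_cancel_of_le (wfRank_mono hF.le)).symm⟩
    have hδ0 : δ ≠ 0 := by
      rintro rfl
      rw [add_zero] at hδ
      exact (wfRank_lt hF).ne' hδ
    set a := Ordinal.log ω δ with ha
    have hδa : δ < ω ^ (a + 1) := lt_opow_log_add_one δ
    set p : IrreducibleCloseds X → Prop := fun C => weight F C < ω ^ (a + 1) with hp
    have hbig : ∀ C, ¬ p C → weight F C ≤ weight F' C := by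
      intro C hC
      refine le_min ?_ (min_le_right _ _)
      -- A heavy weight absorbs δ from the left, so measuring from the rank of `F'` instead of `F`
      -- does not reduce it.
      rw [Ordinal.le_sub_of_le (wfRank_mono le_sup_left), hδ, add_assoc,
        Ordinal.add_of_omega0_opow_le hδa (not_lt.1 hC)]
      calc wfRank F + weight F C ≤ wfRank F + (wfRank (F ⊔ C.toClosed) - wfRank F) := by
            gcongr
            exact min_le_left _ _
        _ = wfRank (F ⊔ C.toClosed) := Ordinal.add_sub_cancel_of_le (wfRank_mono le_sup_left)
        _ ≤ _ := wfRank_mono (sup_le_sup_right hF.le _)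
    -- A member inside `F'` has weight at most δ, hence is light.
    have hpF' : ∀ C, ¬ p C → ¬ C.toClosed ≤ F' := by
      intro C hC hCF'
      refine hC ((min_le_left _ _).trans_lt (lt_of_le_of_lt ?_ hδa))
      rw [Ordinal.sub_le, ← hδ]
      exact wfRank_mono (sup_le hF.le hCF')
    have hle : s.filter (fun C => ¬ p C) ≤ s.filter fun C => ¬ C.toClosed ≤ F' :=
      Multiset.monotone_filter_right s hpF'
    obtain ⟨t', ht', hrel'⟩ := hrel.exists_le_left hle
    obtain ⟨r, rfl⟩ := Multiset.le_iff_exists_add.1 (ht'.trans ht)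
    have h1 : nadd (naturalProd (wfRank F) ω) (naddSum ((s.filter p).map (weight F))) <
        naturalProd (wfRank F') ω := by
      rw [hδ]
      refine nadd_naturalProd_omega0_lt hδ0 (naddSum_lt_opow fun x hx => ?_)
      obtain ⟨C, hC, rfl⟩ := Multiset.mem_map.1 hx
      exact (Multiset.mem_filter.1 hC).2
    have h2 : naddSum ((s.filter fun C => ¬ p C).map (weight F)) ≤
        naddSum ((t' + r).map (weight F')) := by
      rw [Multiset.map_add, naddSum_add]
      refine (naddSum_map_le_of_rel hrel' fun C hC D _ hCD => ?_).trans (le_nadd_left _ _)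
      exact (hbig C (Multiset.mem_filter.1 hC).2).trans (weight_mono F' hCD)
    rw [size, size, ← Multiset.filter_add_not p s, Multiset.map_add, naddSum_add, ← nadd_assoc]
    exact nadd_lt_of_not_both h1.le h2 (Or.inl h1)

theorem wfRank_elementaryIrreducible_le {F : Closeds X} {s : Multiset (IrreducibleCloseds X)}
    (hs : IsReduced F s) : wfRank (elementaryIrreducible F s) ≤ size F s := by
  have key : ∀ (A : IrreducibleCloseds (FinMultiset X)) (F : Closeds X) (s), IsReduced F s →
      A = elementaryIrreducible F s → wfRank A ≤ size F s := by
    intro A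
    induction A using WellFoundedLT.induction with
    | ind A ih =>
    rintro F s hs rfl
    rw [wfRank_le_iff]
    intro B hB
    obtain ⟨G, t, ht, rfl⟩ := exists_eq_elementaryIrreducible B
    exact (ih _ hB G t ht rfl).trans_lt (size_lt ht hs hB)
  exact key _ F s hs rfl

theorem sobrificationRank_le :
    sobrificationRank (FinMultiset X) ≤ naturalProd (stature X) ω + 1 := by
  rw [sobrificationRank_eq]
  gcongr
  refine (wfRank_elementaryIrreducible_le (isReduced_zero ⊤)).trans_eq ?_
  rw [size, Multiset.map_zero, naddSum_zero, nadd_zero]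
  rfl

theorem sobrificationRank_le_of_forall {Λ : Ordinal.{u}}
    (h : ∀ F < (⊤ : Closeds X), ∀ s, size F s < Λ) :
    sobrificationRank (FinMultiset X) ≤ Λ + 1 := by
  rw [sobrificationRank_eq]
  gcongr
  rw [wfRank_le_iff]
  intro B hB
  obtain ⟨F, s, hs, rfl⟩ := exists_eq_elementaryIrreducible B
  refine (wfRank_elementaryIrreducible_le hs).trans_lt (h F (lt_top_iff_ne_top.2 ?_) s)
  rintro rfl
  have : s = 0 := Multiset.eq_zero_of_forall_notMem fun C hC => hs C hC le_top
  rw [this] at hB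
  exact lt_irrefl _ hB

/-- For a proper base, the product by ω stays below the bound because ω^α' is a limit. The weights
stay below it through their second term, the rank among irreducible closed sets of words. -/
theorem sobrificationRank_word_le {Z : Type u} [TopologicalSpace Z] [NoetherianSpace Z]
    (h : 2 ≤ stature Z) :
    sobrificationRank (FinMultiset (Word Z)) ≤
      ω ^ (ω : Ordinal.{u}) ^ adjustedExponent (stature Z) + 1 := by
  have h0 : stature Z ≠ 0 := by
    rintro h0
    rw [h0] at h
    simp at h
  refine sobrificationRank_le_of_forall fun F hF s => ?_
  have hlim : ∀ x : Ordinal.{u}, x < ω ^ adjustedExponent (stature Z) →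
      x + 1 < ω ^ adjustedExponent (stature Z) :=
    fun x hx => (Ordinal.isSuccLimit_opow_left Ordinal.isSuccLimit_omega0
      (adjustedExponent_ne_zero h)).add_one_lt hx
  refine nadd_lt_opow ?_ (naddSum_lt_opow fun x hx => ?_)
  · have hlt : wfRank F < ω ^ (ω : Ordinal.{u}) ^ adjustedExponent (stature Z) :=
      (wfRank_lt hF).trans_eq (Word.stature_eq h0)
    obtain ⟨e, he, hFe⟩ := (Ordinal.lt_opow_of_isSuccLimit Ordinal.omega0_ne_zero
      (Ordinal.isSuccLimit_opow_left Ordinal.isSuccLimit_omega0 (adjustedExponent_ne_zero h))).1 hlt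
    exact (naturalProd_omega0_lt hFe).trans (opow_lt_opow_omega0.2 (hlim e he))
  · obtain ⟨C, -, rfl⟩ := Multiset.mem_map.1 hx
    refine (min_le_right _ _).trans_lt ?_
    have h1 : wfRank C ≤ ω ^ (stature Z + 1) :=
      Word.wfRank_irreducible_le (F := ⊤) C (Word.over_top (X := Z) ▸ le_top)
    refine (add_le_add_left h1 1).trans_lt ?_
    refine (Ordinal.isSuccLimit_opow_left Ordinal.isSuccLimit_omega0 ?_).add_one_lt
      (opow_add_one_lt_opow_opow_adjustedExponent h)
    exact Ordinal.opow_ne_zero _ Ordinal.omega0_ne_zero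

end FinMultiset

/-! ### Lower bounds -/

open scoped Classical in
theorem Multiset.Rel.countP_le {ι : Type u} [Preorder ι] {s t : Multiset ι}
    (h : Multiset.Rel (· ≤ ·) s t) (C : ι) : s.countP (C ≤ ·) ≤ t.countP (C ≤ ·) := by
  induction h with
  | zero => exact le_rfl
  | @cons a b s t hab _ ih =>
    rw [Multiset.countP_cons, Multiset.countP_cons]
    by_cases ha : C ≤ a
    · rw [if_pos ha, if_pos (ha.trans hab)]
      omega
    · rw [if_neg ha]
      omega

namespace FinMultiset

variable {X : Type u} [TopologicalSpace X]

-- The number of members above a given `C` is a monotone invariant; it certifies that inclusions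
-- between elementary sets are strict.
open scoped Classical in
theorem countP_le_of_elementary_le {F F' : Closeds X} {s s' : Multiset (IrreducibleCloseds X)}
    (h : elementary F s ≤ elementary F' s') {C : IrreducibleCloseds X} (hC : ¬ C.toClosed ≤ F') :
    s.countP (C ≤ ·) ≤ s'.countP (C ≤ ·) := by
  obtain ⟨t, ht, hrel⟩ := exists_rel_of_elementary_le h
  refine le_trans ?_ ((hrel.countP_le C).trans (Multiset.countP_le_of_le _ ht))
  rw [Multiset.countP_filter]
  refine (Multiset.countP_congr rfl fun D _ => ?_).le
  exact propext ⟨fun hD => ⟨hD, fun hDF' =>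
    hC (le_trans (IrreducibleCloseds.toClosed_le.2 hD) hDF')⟩,
    fun hD => hD.1⟩

theorem elementary_lt_cons {F : Closeds X} (s : Multiset (IrreducibleCloseds X))
    {C : IrreducibleCloseds X} (hC : ¬ C.toClosed ≤ F) :
    elementary F s < elementary F (C ::ₘ s) := by
  classical
  refine lt_of_le_not_ge (elementary_mono le_rfl (Multiset.le_cons_self s C)) fun h => ?_
  have := countP_le_of_elementary_le h hC
  rw [Multiset.countP_cons, if_pos le_rfl] at this
  omega

theorem elementary_cons_lt_cons {F : Closeds X} (s : Multiset (IrreducibleCloseds X))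
    {C D : IrreducibleCloseds X} (hD : ¬ D.toClosed ≤ F) (h : C < D) :
    elementary F (C ::ₘ s) < elementary F (D ::ₘ s) := by
  classical
  refine lt_of_le_not_ge ?_ fun h' => ?_
  · rw [elementary_cons, elementary_cons]
    refine closedImage_mono le_rfl fun m hm => ⟨hm.1, fun x hx => h.le (hm.2 x hx)⟩
  · have := countP_le_of_elementary_le h' hD
    rw [Multiset.countP_cons, Multiset.countP_cons, if_pos le_rfl, if_neg (not_le_of_gt h)] at this
    omega

theorem elementary_lt_elementary_zero {F G : Closeds X} {s : Multiset (IrreducibleCloseds X)}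
    (hG : G < F) (hs : ∀ C ∈ s, C.toClosed ≤ F) : elementary G s < elementary F 0 := by
  refine lt_of_le_not_ge ?_ fun h => not_le_of_gt hG (le_of_elementary_le h)
  rintro m ⟨m₀, m₁, t, hm, hm₀, ht, hrel⟩
  rw [mem_elementary_zero, hm]
  intro x hx
  rcases Multiset.mem_add.1 hx with hx | hx
  · exact hG.le (hm₀ x hx)
  · obtain ⟨C, hC, hxC⟩ := Multiset.exists_mem_of_rel_of_mem hrel hx
    exact hs C (Multiset.mem_of_le ht hC) hxC

variable [NoetherianSpace X]

/-- The ordinal ω · ‖E‖ + n is realized by the base `E < F` with `n` copies of the closure of a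
point of `F` outside `E`. -/
theorem omega0_mul_wfRank_le (F : Closeds X) :
    ω * wfRank F ≤ wfRank (elementaryIrreducible F 0) := by
  induction F using WellFoundedLT.induction with
  | ind F ih =>
  refine le_of_forall_lt fun x hx => ?_
  obtain ⟨q, hq, r, hr, rfl⟩ := exists_eq_mul_add_of_lt hx
  obtain ⟨n, rfl⟩ := Ordinal.lt_omega0.1 hr
  obtain ⟨E, hE, rfl⟩ := exists_wfRank_eq hq
  obtain ⟨x, hxF, hxE⟩ := Set.exists_of_ssubset (SetLike.coe_ssubset_coe.2 hE)
  let C : IrreducibleCloseds X := ⟨closure {x}, isIrreducible_singleton.closure, isClosed_closure⟩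
  have hCF : C.toClosed ≤ F :=
    closure_minimal (Set.singleton_subset_iff.2 hxF) F.isClosed
  have hCE : ¬ C.toClosed ≤ E := fun h => hxE (h (subset_closure rfl))
  have key : ∀ n : ℕ, ω * wfRank E + n ≤
      wfRank (elementaryIrreducible E (Multiset.replicate n C)) := by
    intro n
    induction n with
    | zero => simpa using ih E hE
    | succ n ihn =>
      rw [Nat.cast_add_one, ← add_assoc, ← Order.succ_eq_add_one, Order.succ_le_iff]
      exact ihn.trans_lt (wfRank_lt (elementaryIrreducible_lt.2
        (by rw [Multiset.replicate_succ]; exact elementary_lt_cons _ hCE)))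
  refine (key n).trans_lt (wfRank_lt (elementaryIrreducible_lt.2
    (elementary_lt_elementary_zero hE fun D hD => ?_)))
  rwa [Multiset.eq_of_mem_replicate hD]

theorem omega0_mul_stature_le :
    ω * stature X + 1 ≤ sobrificationRank (FinMultiset X) := by
  rw [sobrificationRank_eq]
  gcongr
  exact omega0_mul_wfRank_le ⊤

/-- One extra member running through the chain `D d` gains at least `d`. Indices start above 0
because gaining 0 corresponds to no extra member. -/
theorem wfRank_elementaryIrreducible_add_le {F : Closeds X} (s : Multiset (IrreducibleCloseds X))
    {c : Ordinal.{u}} (hc : 0 < c) (D : ∀ d, 0 < d → IrreducibleCloseds X)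
    (hDF : ∀ d hd, ¬ (D d hd).toClosed ≤ F)
    (hD : ∀ d hd e he, d < e → e ≤ c → D d hd < D e he) :
    wfRank (elementaryIrreducible F s) + c ≤
      wfRank (elementaryIrreducible F (D c hc ::ₘ s)) := by
  induction c using WellFoundedLT.induction with
  | ind c ih =>
  refine le_of_forall_lt fun x hx => ?_
  rcases lt_or_ge x (wfRank (elementaryIrreducible F s)) with h | h
  · exact h.trans (wfRank_lt (elementaryIrreducible_lt.2 (elementary_lt_cons s (hDF c hc))))
  · obtain ⟨d, rfl⟩ := exists_add_of_le h
    have hd : d < c := lt_of_add_lt_add_left hx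
    rcases eq_zero_or_pos d with rfl | hd0
    · rw [add_zero]
      exact wfRank_lt (elementaryIrreducible_lt.2 (elementary_lt_cons s (hDF c hc)))
    · exact (ih d hd hd0 fun d hd' e he hde hec => hD d hd' e he hde (hec.trans hd.le)).trans_lt
        (wfRank_lt (elementaryIrreducible_lt.2 (elementary_cons_lt_cons s (hDF c hc)
          (hD d hd0 c hc hd le_rfl))))

end FinMultiset

/-! ### Ordinals with their Alexandroff topology -/

theorem exists_eq_add_opow_of_dvd {b : Ordinal.{u}} (hb : b ≠ 0) :
    ∃ p a : Ordinal.{u}, ω ^ a ∣ p ∧ b = p + ω ^ a := by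
  induction b using cnf_induction with
  | zero => exact absurd rfl hb
  | add e r hr ih =>
    by_cases h0 : r = 0
    · exact ⟨0, e, dvd_zero _, by rw [h0, add_zero, zero_add]⟩
    · obtain ⟨p, a, hdvd, rfl⟩ := ih h0
      have hae : a < e + 1 := opow_lt_opow_omega0.1 (le_add_self.trans_lt hr)
      exact ⟨ω ^ e + p, a,
        dvd_add (Ordinal.opow_dvd_opow ω (Order.lt_add_one_iff.1 hae)) hdvd,
        (add_assoc _ _ _).symm⟩

/-- The ordinal `α` with its Alexandroff topology. -/
abbrev OrdinalSpace (α : Ordinal.{u}) : Type u := Topology.WithUpperSet α.ToType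

namespace OrdinalSpace

variable {α : Ordinal.{u}}

/-- The ordinal below `α` corresponding to a point. -/
def height (x : OrdinalSpace α) : Ordinal.{u} :=
  (Ordinal.ToType.toOrd (Topology.WithUpperSet.ofUpperSet x) : Set.Iio α)

theorem height_lt (x : OrdinalSpace α) : height x < α :=
  (Ordinal.ToType.toOrd (Topology.WithUpperSet.ofUpperSet x)).2

theorem height_le_height {x y : OrdinalSpace α} : height x ≤ height y ↔ x ≤ y :=
  Ordinal.ToType.mk.symm.le_iff_le (x := Topology.WithUpperSet.ofUpperSet x)
    (y := Topology.WithUpperSet.ofUpperSet y)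

theorem exists_height_eq {b : Ordinal.{u}} (h : b < α) : ∃ x : OrdinalSpace α, height x = b :=
  ⟨Topology.WithUpperSet.toUpperSet (Ordinal.ToType.mk ⟨b, h⟩),
    congrArg Subtype.val (Ordinal.ToType.mk.symm_apply_apply (⟨b, h⟩ : Set.Iio α))⟩

theorem isClosed_iff {A : Set (OrdinalSpace α)} : IsClosed A ↔ IsLowerSet A := by
  rw [← isOpen_compl_iff]
  exact isUpperSet_compl

/-- The closed set of points of height less than `b`. -/
def initial (α b : Ordinal.{u}) : Closeds (OrdinalSpace α) where
  carrier := {x | height x < b}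
  isClosed' := isClosed_iff.2 fun _ _ h hx => (height_le_height.2 h).trans_lt hx

theorem mem_initial {b : Ordinal.{u}} {x : OrdinalSpace α} : x ∈ initial α b ↔ height x < b :=
  Iff.rfl

theorem initial_mono {b c : Ordinal.{u}} (h : b ≤ c) : initial α b ≤ initial α c :=
  fun _ hx => lt_of_lt_of_le (mem_initial.1 hx) h

theorem initial_lt {b c : Ordinal.{u}} (h : b < c) (hc : c ≤ α) : initial α b < initial α c := by
  refine lt_of_le_not_ge (initial_mono h.le) fun h' => ?_
  obtain ⟨x, rfl⟩ := exists_height_eq (h.trans_le hc)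
  exact lt_irrefl _ (mem_initial.1 (h' (mem_initial.2 h)))

theorem initial_top : initial α α = ⊤ :=
  top_le_iff.1 fun x _ => height_lt x

theorem exists_eq_initial (F : Closeds (OrdinalSpace α)) : ∃ b ≤ α, F = initial α b := by
  by_cases hF : F = ⊤
  · exact ⟨α, le_rfl, hF.trans initial_top.symm⟩
  · have hne : (height '' (F : Set (OrdinalSpace α))ᶜ).Nonempty := by
      refine Set.Nonempty.image _ (Set.nonempty_compl.2 fun h => hF (SetLike.coe_injective h))
    obtain ⟨x, hx, hxb⟩ := csInf_mem hne
    refine ⟨height x, (height_lt x).le, le_antisymm (fun y hy => ?_) fun y hy => ?_⟩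
    · rw [mem_initial]
      by_contra hxy
      exact hx (isClosed_iff.1 F.isClosed (height_le_height.1 (not_lt.1 hxy)) hy)
    · by_contra hyF
      rw [mem_initial, hxb] at hy
      exact not_lt_of_ge (csInf_le' (Set.mem_image_of_mem height hyF)) hy

theorem acc_initial (b : Ordinal.{u}) : Acc (· < ·) (initial α b) := by
  induction b using WellFoundedLT.induction with
  | ind b ih =>
  refine ⟨_, fun F hF => ?_⟩
  obtain ⟨c, -, rfl⟩ := exists_eq_initial F
  exact ih c (lt_of_not_ge fun h => not_le_of_gt hF (initial_mono h))

instance noetherianSpace : NoetherianSpace (OrdinalSpace α) :=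
  ((noetherianSpace_TFAE (OrdinalSpace α)).out 0 1).2 <| isWellFounded_iff _ _ |>.2 ⟨fun F => by
    obtain ⟨b, -, rfl⟩ := exists_eq_initial F
    exact acc_initial b⟩

theorem wfRank_initial {b : Ordinal.{u}} (hb : b ≤ α) : wfRank (initial α b) = b := by
  induction b using WellFoundedLT.induction with
  | ind b ih =>
  apply le_antisymm
  · rw [wfRank_le_iff]
    intro F hF
    obtain ⟨c, hc, rfl⟩ := exists_eq_initial F
    have hcb : c < b := lt_of_not_ge fun h => not_le_of_gt hF (initial_mono h)
    rwa [ih c hcb hc]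
  · refine le_of_forall_lt fun c hc => ?_
    rw [← ih c hc (hc.le.trans hb)]
    exact wfRank_lt (initial_lt hc hb)

theorem stature_eq : stature (OrdinalSpace α) = α :=
  (congrArg wfRank initial_top).symm.trans (wfRank_initial le_rfl)

theorem isIrreducible_of_nonempty {F : Closeds (OrdinalSpace α)}
    (hF : (F : Set (OrdinalSpace α)).Nonempty) : IsIrreducible (F : Set (OrdinalSpace α)) := by
  refine ⟨hF, fun U V hU hV ⟨x, hxF, hx⟩ ⟨y, hyF, hy⟩ => ?_⟩
  have hup : ∀ U : Set (OrdinalSpace α), IsOpen U → IsUpperSet U := fun U hU => hU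
  rcases le_total (height x) (height y) with h | h
  · exact ⟨y, hyF, hup U hU (height_le_height.1 h) hx, hy⟩
  · exact ⟨x, hxF, hx, hup V hV (height_le_height.1 h) hy⟩

/-- The irreducible closed set of points of height less than `b`. -/
def initialIrreducible (α b : Ordinal.{u}) (hb : 0 < b) (hα : 0 < α) :
    IrreducibleCloseds (OrdinalSpace α) :=
  ⟨initial α b, isIrreducible_of_nonempty
    (let ⟨x, hx⟩ := exists_height_eq hα
    ⟨x, hx.trans_lt hb⟩), (initial α b).isClosed⟩

open FinMultiset

/-- Split off the last normal-form term, `b = p + ω^a`. Over the base `p`, the initial segments `p +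
d` with `d ≤ ω^a` form a chain of irreducible closed sets, so every copy of the segment `b` is worth
ω^a. -/
theorem naturalProd_le_wfRank {b : Ordinal.{u}} (hb : b ≤ α) :
    naturalProd b ω ≤ wfRank (elementaryIrreducible (initial α b) 0) := by
  induction b using WellFoundedLT.induction with
  | ind b ih =>
  by_cases hb0 : b = 0
  · rw [hb0, naturalProd_zero_omega0]
    exact zero_le
  obtain ⟨p, a, hdvd, rfl⟩ := exists_eq_add_opow_of_dvd hb0
  have ha : (0 : Ordinal.{u}) < ω ^ a := Ordinal.opow_pos a Ordinal.omega0_pos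
  have hp : p < p + ω ^ a := lt_add_of_pos_right p ha
  have hα : 0 < α := (pos_iff_ne_zero.2 hb0).trans_le hb
  let D : ∀ d : Ordinal.{u}, 0 < d → IrreducibleCloseds (OrdinalSpace α) := fun d hd =>
    initialIrreducible α (p + d) (hd.trans_le le_add_self) hα
  have key : ∀ n : ℕ, naturalProd p ω + ω ^ a * n ≤
      wfRank (elementaryIrreducible (initial α p) (Multiset.replicate n (D (ω ^ a) ha))) := by
    intro n
    induction n with
    | zero => simpa using ih p hp (hp.le.trans hb)
    | succ n ihn =>
      rw [Nat.cast_add_one, mul_add_one, ← add_assoc, Multiset.replicate_succ]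
      refine (add_le_add_left ihn _).trans (wfRank_elementaryIrreducible_add_le _ ha D ?_ ?_)
      · intro d hd h
        obtain ⟨x, hx⟩ := exists_height_eq (hp.trans_le hb)
        have hx' := mem_initial.1 (h (mem_initial.2 (hx.trans_lt (lt_add_of_pos_right p hd))))
        exact hx'.ne hx
      · intro d hd e he hde hec
        exact initial_lt (α := α) (by gcongr) (le_trans (by gcongr) hb)
  have hnat : naturalProd (p + ω ^ a) ω = naturalProd p ω + ω ^ a * ω := by
    have h1 := naturalProd_omega0_opow_add (e := a) (r := 0) (Ordinal.opow_pos _ Ordinal.omega0_pos)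
    rw [add_zero, naturalProd_zero_omega0, add_zero] at h1
    rw [naturalProd_omega0_add hdvd (opow_lt_opow_omega0.2 (lt_add_one a)), h1,
      ← Order.succ_eq_add_one,      Ordinal.opow_succ]
  rw [hnat]
  refine le_of_forall_lt fun x hx => ?_
  obtain ⟨y, hy, hxy⟩ := (Ordinal.lt_add_iff (mul_ne_zero ha.ne' Ordinal.omega0_ne_zero)).1 hx
  obtain ⟨c, hc, r, hr, rfl⟩ := exists_eq_mul_add_of_lt hy
  obtain ⟨n, rfl⟩ := Ordinal.lt_omega0.1 hc
  -- The remainder after `n` copies is less than ω^a, so one more copy covers it.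
  refine hxy.trans_lt (lt_of_le_of_lt (b := naturalProd p ω + ω ^ a * (n + 1 : ℕ)) ?_ ?_)
  · gcongr
    rw [Nat.cast_add_one, mul_add_one]
    gcongr
  · refine (key (n + 1)).trans_lt (wfRank_lt (elementaryIrreducible_lt.2
      (elementary_lt_elementary_zero (initial_lt hp hb) fun C hC => ?_)))
    rw [Multiset.eq_of_mem_replicate hC]
    exact le_rfl

theorem sobrificationRank_eq :
    sobrificationRank (FinMultiset (OrdinalSpace α)) = naturalProd α ω + 1 := by
  apply le_antisymm
  · exact FinMultiset.sobrificationRank_le.trans_eq (by rw [stature_eq])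
  · rw [FinMultiset.sobrificationRank_eq, ← initial_top]
    gcongr
    exact naturalProd_le_wfRank le_rfl

end OrdinalSpace

/-! ### Finite multisets of words -/

theorem FinMultiset.sobrificationRank_word {Z : Type u} [TopologicalSpace Z] [NoetherianSpace Z]
    (h : 2 ≤ stature Z) :
    sobrificationRank (FinMultiset (Word Z)) =
        ω ^ (ω : Ordinal.{u}) ^ adjustedExponent (stature Z) + 1 ∧
      sobrificationRank (FinMultiset (Word Z)) = ω * stature (Word Z) + 1 := by
  have h0 : stature Z ≠ 0 := by
    rintro h0
    simp [h0] at h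
  have hmul : ω * stature (Word Z) = ω ^ (ω : Ordinal.{u}) ^ adjustedExponent (stature Z) := by
    -- The exponent ω^α' is infinite because α' ≠ 0, so it absorbs the 1 coming from the factor ω.
    rw [Word.stature_eq h0, omega0_mul_opow, Ordinal.one_add_of_omega0_le]
    exact Ordinal.left_le_opow _ (pos_iff_ne_zero.2 (adjustedExponent_ne_zero h))
  have h1 := FinMultiset.omega0_mul_stature_le (X := Word Z)
  have h2 := FinMultiset.sobrificationRank_word_le h
  rw [hmul] at h1 ⊢
  exact ⟨h2.antisymm h1, h2.antisymm h1⟩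

end

theorem mainTheorem7 :
    -- the lower and upper bounds
    (∀ (X : Type u) [TopologicalSpace X] [NoetherianSpace X],
      ∃ _ : NoetherianSpace (FinMultiset X),
        ω * stature X + 1 ≤ sobrificationRank (FinMultiset X) ∧
        sobrificationRank (FinMultiset X) ≤ naturalProd (stature X) ω + 1) ∧
    -- the two bounds coincide exactly when the stature is below `ω ^ ω`
    (∀ (X : Type u) [TopologicalSpace X] [NoetherianSpace X],
      ω * stature X + 1 = naturalProd (stature X) ω + 1 ↔ stature X < ω ^ (ω : Ordinal.{u})) ∧
    -- the exact value in that case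
    (∀ (X : Type u) [TopologicalSpace X] [NoetherianSpace X],
      stature X < ω ^ (ω : Ordinal.{u}) →
      ∃ _ : NoetherianSpace (FinMultiset X),
        sobrificationRank (FinMultiset X) = ω * stature X + 1 ∧
        sobrificationRank (FinMultiset X) = naturalProd (stature X) ω + 1 ∧
        (∃ l : List ℕ, l.Pairwise (· ≥ ·) ∧
          stature X = (l.map fun n : ℕ => ω ^ (n : Ordinal.{u})).sum) ∧
        ∀ l : List ℕ, l.Pairwise (· ≥ ·) →
          stature X = (l.map fun n : ℕ => ω ^ (n : Ordinal.{u})).sum →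
          sobrificationRank (FinMultiset X) =
            (l.map fun n : ℕ => ω ^ ((n : Ordinal.{u}) + 1)).sum + 1) ∧
    -- the lower bound is attained by all spaces of words over spaces of stature at least `2`
    (∀ (Z : Type u) [TopologicalSpace Z] [NoetherianSpace Z], 2 ≤ stature Z →
      ∃ (_ : NoetherianSpace (Word Z)) (_ : NoetherianSpace (FinMultiset (Word Z))),
        sobrificationRank (FinMultiset (Word Z)) =
          ω ^ (ω ^ adjustedExponent (stature Z)) + 1 ∧
        sobrificationRank (FinMultiset (Word Z)) = ω * stature (Word Z) + 1) ∧
    -- the upper bound is attained by all ordinals with their Alexandroff topology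
    (∀ α : Ordinal.{u},
      ∃ (_ : NoetherianSpace (Topology.WithUpperSet α.ToType))
        (_ : NoetherianSpace (FinMultiset (Topology.WithUpperSet α.ToType))),
        sobrificationRank (FinMultiset (Topology.WithUpperSet α.ToType)) =
          naturalProd (stature (Topology.WithUpperSet α.ToType)) ω + 1 ∧
        sobrificationRank (FinMultiset (Topology.WithUpperSet α.ToType)) = naturalProd α ω + 1) := by
  have hiff : ∀ (X : Type u) [TopologicalSpace X] [NoetherianSpace X],
      ω * stature X + 1 = naturalProd (stature X) ω + 1 ↔ stature X < ω ^ (ω : Ordinal.{u}) := by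
    intro X _ _
    rw [← omega0_mul_eq_naturalProd_iff, ← Order.succ_eq_add_one, ← Order.succ_eq_add_one,
      Order.succ_eq_succ_iff]
  refine ⟨fun X _ _ => ⟨inferInstance, FinMultiset.omega0_mul_stature_le,
    FinMultiset.sobrificationRank_le⟩, hiff, fun X _ _ hX => ?_, fun Z _ _ hZ =>
    ⟨inferInstance, inferInstance, FinMultiset.sobrificationRank_word hZ⟩, fun α =>
    ⟨inferInstance, inferInstance, ?_, OrdinalSpace.sobrificationRank_eq⟩⟩
  · have hsob : sobrificationRank (FinMultiset X) = ω * stature X + 1 :=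
      le_antisymm (FinMultiset.sobrificationRank_le.trans_eq ((hiff X).2 hX).symm)
        FinMultiset.omega0_mul_stature_le
    refine ⟨inferInstance, hsob, hsob.trans ((hiff X).2 hX), exists_list_eq_sum_opow hX,
      fun l _ hl => ?_⟩
    rw [← omega0_mul_sum_opow, ← hl]
    exact hsob
  · rw [OrdinalSpace.stature_eq]
    exact OrdinalSpace.sobrificationRank_eq
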